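/- Let $\mathbb H^2=\{z\in\mathbb C^3: z_1^2+z_2^2+z_3^2=0,\ z\neq0\}$ be the Kepler manifold and $\mathbb M^2=\{z\in\mathbb H^2:|z|<1\}$ its unit ball. For a function $u>0$ on $\mathbb M^2$ for which the volume form $u^3\wedge^2(\frac i2\partial\overline\partial\log\frac1u)$ is nonnegative (for instance if $\log\frac1u$ is strictly plurisubharmonic), let $K_{u^3\wedge^2(\frac i2\partial\overline\partial\log\frac1u)}(x,y)$ be the reproducing kernel of the weighted Bergman space of all holomorphic functions on $\mathbb M^2$ that are square integrable with respect to $u^3\wedge^2(\frac i2\partial\overline\partial\log\frac1u)$. Theorem. Let $f\in C^\infty(0,1]$ be real-valued with $f>0$ on $(0,1)$, $f(1)=0$ and $f'(1)=-1$, and let $u(z):=f(|z|^2)$; assume that $u^3\wedge^2(\frac i2\partial\overline\partial\log\frac1u)$ is nonnegative on $\mathbb M^2$. Suppose that there is a constant $c\neq0$ such that $$\frac c{u(z)^3}-K_{u^3\wedge^2(\frac i2\partial\overline\partial\log\frac1u)}(z,z)$$ is smooth on $\mathbb M^2$ up to $|z|=1$, i.e. extends to a $C^\infty$ function on $\{z\in\mathbb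 H^2:|z|\le1\}$. Then there are $v\in\mathbb R$ and $h\in C^\infty(0,1]$ with $h^{(k)}(1)=0$ for all $k\ge0$ such that on $(0,1]$ $$t f'\,(f f'+t f f''-t f'^2)=\phi_v+h,$$ where, with $L:=\log\frac1t$, $$\phi_v(t)=e^{L/4}\Big(\cosh\frac{L\sqrt v}4-\frac1{\sqrt v}\sinh\frac{L\sqrt v}4\Big)=\frac{(1+\sqrt v)\,t^{(-1+\sqrt v)/4}-(1-\sqrt v)\,t^{(-1-\sqrt v)/4}}{2\sqrt v}$$ for $v\neq0$ (the value is real and independent of the choice of the complex square root $\sqrt v$), and $\phi_0(t)=e^{L/4}(1-\frac L4)$ is the limit of this as $v\to0$. -/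

import Mathlib

open scoped ContDiff ComplexConjugate ENNReal
open MeasureTheory

noncomputable section

namespace Kepler

/-! ### The Kepler manifold of dimension two and its unit ball -/

/-- The ambient space `ℂ³` with its Euclidean norm. -/
abbrev Amb : Type := EuclideanSpace ℂ (Fin 3)

/-- The Kepler manifold `ℍ² = {z ∈ ℂ³ : z · z = 0, z ≠ 0}` (bilinear, not Hermitian, product). -/
def manifold : Set Amb := {z | ∑ j, z j * z j = 0 ∧ z ≠ 0}

/-- Its unit ball `𝕄² = {z ∈ ℍ² : |z| < 1}`. -/
def ball : Set Amb := {z | z ∈ manifold ∧ ‖z‖ < 1}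

/-- `𝕄²` together with its outer boundary `|z| = 1`; the origin is not included. -/
def ballWithBoundary : Set Amb := {z | z ∈ manifold ∧ ‖z‖ ≤ 1}

/-- A function on a complex submanifold `M` of `ℂ³` is holomorphic if near each point of `M` it is
the restriction of a holomorphic function of the ambient space. Values off `M` play no role. -/
def IsHolomorphicOn (M : Set Amb) (g : Amb → ℂ) : Prop :=
  ∀ p ∈ M, ∃ V : Set Amb, IsOpen V ∧ p ∈ V ∧
    ∃ G : Amb → ℂ, DifferentiableOn ℂ G V ∧ ∀ z ∈ V ∩ M, G z = g z

/-- A function on `𝕄²` is smooth up to `|z| = 1` if near each point of `𝕄²` and of its outer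
boundary it agrees on `𝕄²` with a function that is `C^∞` on an open set of the ambient space. -/
def IsSmoothUpToBoundary (g : Amb → ℂ) : Prop :=
  ∀ p ∈ ballWithBoundary, ∃ V : Set Amb, IsOpen V ∧ p ∈ V ∧
    ∃ G : Amb → ℂ, ContDiffOn ℝ ∞ G V ∧ ∀ z ∈ V ∩ ball, G z = g z

/-! ### Local holomorphic coordinates

The map `cover` restricts to a holomorphic two-to-one covering `ℂ² ∖ {0} → ℍ²` with deck
transformation `w ↦ -w`; its local inverses are holomorphic charts which cover `ℍ²`. -/

/-- The parametrization `(a, b) ↦ (a² - b², i (a² + b²), 2 a b)` of the Kepler manifold. -/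
def cover (w : ℂ × ℂ) : Amb :=
  !₂[w.1 ^ 2 - w.2 ^ 2, Complex.I * (w.1 ^ 2 + w.2 ^ 2), 2 * w.1 * w.2]

theorem cover_eq_cover_iff (w w' : ℂ × ℂ) : cover w = cover w' ↔ w = w' ∨ w = -w' := by
  constructor
  · intro h
    have h0 := congrArg (fun z : Amb => z 0) h
    have h1 := congrArg (fun z : Amb => z 1) h
    have h2 := congrArg (fun z : Amb => z 2) h
    simp [cover] at h0 h1 h2
    have ha : w.1 ^ 2 = w'.1 ^ 2 := by linear_combination (h0 + h1) / 2
    have hb : w.2 ^ 2 = w'.2 ^ 2 := by linear_combination (h1 - h0) / 2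
    rcases sq_eq_sq_iff_eq_or_eq_neg.1 ha with e | e <;>
    rcases sq_eq_sq_iff_eq_or_eq_neg.1 hb with e' | e'
    · exact Or.inl (Prod.ext e e')
    · by_cases hz : w'.1 = 0
      · right; ext1 <;> simp [e, e', hz]
      · have : w'.2 = 0 := by
          rw [e, e'] at h2
          have : w'.1 * w'.2 = 0 := by linear_combination -h2 / 4
          exact (mul_eq_zero.1 this).resolve_left hz
        left; ext1 <;> simp [e, e', this]
    · by_cases hz : w'.1 = 0
      · left; ext1 <;> simp [e, e', hz]
      · have : w'.2 = 0 := by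
          rw [e, e'] at h2
          have : w'.1 * w'.2 = 0 := by linear_combination -h2 / 4
          exact (mul_eq_zero.1 this).resolve_left hz
        right; ext1 <;> simp [e, e', this]
    · exact Or.inr (Prod.ext e e')
  · rintro (rfl | rfl) <;> simp [cover]

theorem cover_image : cover '' {w | w ≠ 0} = manifold := by
  ext z
  constructor
  · rintro ⟨w, hw, rfl⟩
    refine ⟨?_, ?_⟩
    · simp only [cover, Fin.sum_univ_three]
      simp
      linear_combination (w.1 ^ 2 + w.2 ^ 2) ^ 2 * Complex.I_sq
    · intro h
      have h00 : cover w = cover 0 := by rw [h]; ext i; fin_cases i <;> simp [cover]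
      rcases (cover_eq_cover_iff w 0).1 h00 with h | h
      · exact hw h
      · exact hw (by simpa using h)
  · rintro ⟨hz, hne⟩
    rw [Fin.sum_univ_three] at hz
    obtain ⟨a, ha⟩ := IsAlgClosed.exists_eq_mul_self ((z 0 - Complex.I * z 1) / 2)
    obtain ⟨b, hb⟩ := IsAlgClosed.exists_eq_mul_self ((-z 0 - Complex.I * z 1) / 2)
    have hI := Complex.I_sq
    have hab : (2 * a * b) ^ 2 = z 2 ^ 2 := by
      have : (2 * a * b) ^ 2 = 4 * (a * a) * (b * b) := by ring
      rw [this, ← ha, ← hb]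
      linear_combination z 1 ^ 2 * hI - hz
    have h0 : a * a - b * b = z 0 := by rw [← ha, ← hb]; ring
    have h1 : Complex.I * (a * a + b * b) = z 1 := by
      rw [← ha, ← hb]; linear_combination -z 1 * hI
    have key : ∃ c : ℂ, c * c = b * b ∧ 2 * a * c = z 2 := by
      rcases sq_eq_sq_iff_eq_or_eq_neg.1 hab with h | h
      · exact ⟨b, rfl, h⟩
      · exact ⟨-b, by ring, by linear_combination -h⟩
    obtain ⟨c, hc, hac⟩ := key
    have hcov : cover (a, c) = z := by
      ext i
      fin_cases i
      · simp [cover]; linear_combination h0 - hc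
      · simp [cover]; linear_combination h1 + Complex.I * hc
      · simp [cover]; linear_combination hac
    refine ⟨(a, c), ?_, hcov⟩
    intro h
    apply hne
    rw [← hcov, h]
    ext i; fin_cases i <;> simp [cover]

/-! ### Complex Hessians and the volume element of a potential -/

/-- The derivative `∂_e = (D_e - i D_{ie}) / 2` of type `(1,0)`; for the `j`-th basis vector `e`
this is `∂/∂w_j`. -/
def delta (e : ℂ × ℂ) (g : ℂ × ℂ → ℂ) (w : ℂ × ℂ) : ℂ :=
  (fderiv ℝ g w e - Complex.I * fderiv ℝ g w (Complex.I • e)) / 2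

/-- The derivative `∂̄_e = (D_e + i D_{ie}) / 2` of type `(0,1)`. -/
def deltaBar (e : ℂ × ℂ) (g : ℂ × ℂ → ℂ) (w : ℂ × ℂ) : ℂ :=
  (fderiv ℝ g w e + Complex.I * fderiv ℝ g w (Complex.I • e)) / 2

/-- The standard basis of `ℂ²`. -/
def stdVec : Fin 2 → ℂ × ℂ := ![(1, 0), (0, 1)]

/-- The complex Hessian `(∂² Ψ / ∂w_j ∂w̄_k)_{j,k}` of a real function on `ℂ²`. -/
def complexHessian (Ψ : ℂ × ℂ → ℝ) (w : ℂ × ℂ) : Matrix (Fin 2) (Fin 2) ℂ :=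
  Matrix.of fun j k => delta (stdVec j) (deltaBar (stdVec k) fun x => (Ψ x : ℂ)) w

/-- The density, with respect to Lebesgue measure in the coordinates `w`, of the volume element
`u³ ∧² (i/2 ∂∂̄ log (1/u))`. The factor `2` is that of
`∧² (i/2 ∑ g_{jk} dw_j ∧ dw̄_k) = 2 det(g_{jk}) (i/2 dw_1 ∧ dw̄_1) ∧ (i/2 dw_2 ∧ dw̄_2)`. -/
def volumeDensity (u : Amb → ℝ) (w : ℂ × ℂ) : ℝ :=
  u (cover w) ^ 3 *
    (2 * (complexHessian (fun x => Real.log (1 / u (cover x))) w).det.re)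

/-- The volume element `u³ ∧² (i/2 ∂∂̄ log (1/u))` as a measure on `𝕄²`. Every point of `𝕄²` has
exactly two preimages `±w` under `cover`, whence the factor `1/2`. -/
def weightMeasure (u : Amb → ℝ) : Measure Amb :=
  (2⁻¹ : ℝ≥0∞) • Measure.map cover
    ((volume.restrict (cover ⁻¹' ball)).withDensity fun w => ENNReal.ofReal (volumeDensity u w))

/-- The form `u³ ∧² (i/2 ∂∂̄ log (1/u))` is a nonnegative volume form on `𝕄²`; for positive `u` this
holds whenever `log (1/u)` is plurisubharmonic. -/
def HasNonnegVolume (u : Amb → ℝ) : Prop :=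
  ∀ w ∈ cover ⁻¹' ball, 0 ≤ volumeDensity u w

/-! ### Weighted Bergman kernels -/

/-- Membership in the weighted Bergman space `L²_hol(M, μ)`. -/
def MemBergman (M : Set Amb) (μ : Measure Amb) (g : Amb → ℂ) : Prop :=
  IsHolomorphicOn M g ∧ MemLp g 2 μ

/-- `k` represents the evaluation at `y` in `L²_hol(M, μ)`: it belongs to the space and
`g(y) = ⟨g, k⟩` for all `g` in the space. -/
def IsReproducingAt (M : Set Amb) (μ : Measure Amb) (y : Amb) (k : Amb → ℂ) : Prop :=
  MemBergman M μ k ∧ ∀ g, MemBergman M μ g → g y = ∫ x, g x * conj (k x) ∂μ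

open Classical in
/-- The reproducing kernel `K_μ(x, y)` of `L²_hol(M, μ)` (with the value `0` if evaluation at `y`
is not represented by any element). -/
def bergmanKernel (M : Set Amb) (μ : Measure Amb) (x y : Amb) : ℂ :=
  if h : ∃ k, IsReproducingAt M μ y k then h.choose x else 0

/-- On the diagonal, the kernel does not depend on the choice of the representing function. -/
theorem bergmanKernel_diag {M : Set Amb} {μ : Measure Amb} {y : Amb} {k : Amb → ℂ}
    (hk : IsReproducingAt M μ y k) : bergmanKernel M μ y y = k y := by
  have h : ∃ k, IsReproducingAt M μ y k := ⟨k, hk⟩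
  rw [bergmanKernel, dif_pos h]
  have hc := h.choose_spec
  set k' := h.choose
  have e1 := hk.2 k' hc.1
  have e2 := hc.2 k hk.1
  have e3 := hk.2 k hk.1
  have e4 : conj (k' y) = k y := by
    rw [e1, e2, ← integral_conj]
    exact integral_congr_ae (Filter.Eventually.of_forall fun x => by simp [mul_comm])
  have e5 : conj (k y) = k y := by
    conv_lhs => rw [e3]
    conv_rhs => rw [e3]
    rw [← integral_conj]
    exact integral_congr_ae (Filter.Eventually.of_forall fun x => by simp [mul_comm])
  rw [← e5, ← e4]
  simp

/-! ### The weight of a radial potential and the exceptional family -/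

/-- `W[f] = t f' (f f' + t f f'' - t f'²)` on `(0, 1]`, with one-sided derivatives at `1`. -/
def radialWeight (f : ℝ → ℝ) (t : ℝ) : ℝ :=
  let f₁ := derivWithin f (Set.Ioc 0 1) t
  let f₂ := iteratedDerivWithin 2 f (Set.Ioc 0 1) t
  t * f₁ * (f t * f₁ + t * f t * f₂ - t * f₁ ^ 2)

/-- For `v ≠ 0` the function `e^{L/4} (cosh (L √v / 4) - sinh (L √v / 4) / √v)`, `L = log (1/t)`,
with a complex square root `√v`; for `v = 0` its limit `e^{L/4} (1 - L/4)`. The values are real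
and independent of the choice of `√v`. -/
def phi (v t : ℝ) : ℝ :=
  let L : ℝ := Real.log (1 / t)
  if v = 0 then Real.exp (L / 4) * (1 - L / 4)
  else
    let s : ℂ := (v : ℂ) ^ (1 / 2 : ℂ)
    (Complex.exp (L / 4) * (Complex.cosh (L * s / 4) - 1 / s * Complex.sinh (L * s / 4))).re

theorem phi_eq_hyperbolic {v : ℝ} (hv : v ≠ 0) (t : ℝ) {s : ℂ} (hs : s ^ 2 = v) :
    (phi v t : ℂ) = Complex.exp ((Real.log (1 / t) : ℝ) / 4) *
      (Complex.cosh ((Real.log (1 / t) : ℝ) * s / 4)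
        - 1 / s * Complex.sinh ((Real.log (1 / t) : ℝ) * s / 4)) := by
  set L : ℝ := Real.log (1 / t) with hL
  let F : ℂ → ℂ := fun s => Complex.exp (L / 4) *
    (Complex.cosh (L * s / 4) - 1 / s * Complex.sinh (L * s / 4))
  have hneg : ∀ a : ℂ, F (-a) = F a := by
    intro a
    simp only [F]
    rw [show (L : ℂ) * -a / 4 = -(L * a / 4) by ring, Complex.cosh_neg, Complex.sinh_neg]
    simp
  have hev : ∀ a b : ℂ, a ^ 2 = v → b ^ 2 = v → F a = F b := by
    intro a b ha hb
    rcases sq_eq_sq_iff_eq_or_eq_neg.1 (ha.trans hb.symm) with h | h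
    · rw [h]
    · rw [h, hneg]
  have hreal : ∀ a : ℂ, a ^ 2 = v → ((F a).re : ℂ) = F a := by
    intro a ha
    rw [← Complex.conj_eq_iff_re]
    have h1 : conj (F a) = F (conj a) := by
      simp only [F, map_mul, map_sub, map_div₀, map_one, ← Complex.exp_conj, ← Complex.cosh_conj,
        ← Complex.sinh_conj, Complex.conj_ofReal, map_ofNat]
    rw [h1]
    refine hev _ _ ?_ ha
    rw [← map_pow, ha, Complex.conj_ofReal]
  have h0 : ((v : ℂ) ^ (1 / 2 : ℂ)) ^ 2 = v := by
    rw [← Complex.cpow_nat_mul]; simp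
  have : phi v t = (F ((v : ℂ) ^ (1 / 2 : ℂ))).re := by
    simp only [phi, if_neg hv, F, ← hL]
  rw [this, hreal _ h0, hev _ s h0 hs]

theorem phi_eq_powers {v t : ℝ} (hv : v ≠ 0) (ht : 0 < t) {s : ℂ} (hs : s ^ 2 = v) :
    (phi v t : ℂ) = ((1 + s) * (t : ℂ) ^ ((-1 + s) / 4) - (1 - s) * (t : ℂ) ^ ((-1 - s) / 4))
      / (2 * s) := by
  have hs0 : s ≠ 0 := by
    rintro rfl
    apply hv
    have : (v : ℂ) = 0 := by rw [← hs]; simp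
    exact_mod_cast this
  have ht0 : (t : ℂ) ≠ 0 := by exact_mod_cast ht.ne'
  rw [phi_eq_hyperbolic hv t hs, Complex.cpow_def_of_ne_zero ht0, Complex.cpow_def_of_ne_zero ht0,
    ← Complex.ofReal_log ht.le, one_div t, Real.log_inv, Complex.cosh, Complex.sinh]
  set l : ℂ := ((Real.log t : ℝ) : ℂ)
  have e : (((-Real.log t : ℝ) : ℂ)) = -l := by simp [l]
  rw [e, show l * ((-1 + s) / 4) = -l / 4 + -(-l * s / 4) by ring,
    show l * ((-1 - s) / 4) = -l / 4 + -l * s / 4 by ring, Complex.exp_add, Complex.exp_add]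
  field_simp
  ring

end Kepler

end

/-! Under `cover` the ball becomes a punctured ball of ℂ² with |cover w|² = 2|w|⁴, and the volume
form gets the density 32 W(t), where W = `radialWeight f` and t = |z|². This density is invariant
under the torus acting on ℂ². Averaging over the torus therefore diagonalizes evaluation at the
points (q, iq, 0), and there K(z,z) = (4π²)⁻¹ ∑ k_l t^l, with k_l = (2l+1)/m_l and m_l = ∫₀¹ x^l
W(x) dx (`bergmanKernel_nullPoint`). On the segment of these points the hypothesis says that C f⁻³ -
∑ k_l t^l, with C = 4π²c, has an asymptotic expansion in powers of 1 - t at t = 1.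

As f vanishes to first order at 1, C f⁻³ has a pole of order three there and no logarithm. By
Watson's lemma the jet of W at 1 determines the expansion of m_l, hence of k_l, in powers of 1/l. A
leading term d l⁻ⁿ with n ≥ 1 would put a singularity of type (1-t)ⁿ⁻¹ log(1-t) into the series,
which is excluded. So k_l has to be a quadratic polynomial in l up to O(l⁻ᴺ) for every N. The
functions φ_v are the weights with this property: φ_v solves a second order Euler equation, so
(2l+1)/∫ x^l φ_v is 2l² + 3l + (9-v)/8 up to an exponentially small error
(`tendsto_phiCoeff_mul_integral`).

It remains to match jets at 1. W(1) = 1 = φ_v(1) holds by normalization. The poles of order three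
and two force C = 4 and f''(1) = 1/2, which gives W'(1) = 0 = φ_v'(1)
(`iteratedDerivWithin_two_eq_half`). The parameter v is fitted to W''(1). All higher jets agree by
induction: `tendsto_kernelCoeff_sub_phiCoeff` turns the first discrepancy of the jets into a leading
term d l⁻ⁿ of k_l minus the polynomial, and `limit_eq_zero_of_hasExpansion` gives d = 0. -/

noncomputable section
namespace Kepler
open Filter Topology

/-! ### Abelian theorems for power series at 1 -/

/-- Abelian theorem: a power series whose coefficients are asymptotic to `d` times those of a
divergent nonnegative one behaves like `d` times that series at `1`. -/
theorem tendsto_tsum_div_tsum {b e : ℕ → ℝ} {d : ℝ} (hb : ∀ l, 0 ≤ b l)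
    (hs : ∀ t ∈ Set.Ico (0 : ℝ) 1, Summable fun l => b l * t ^ l)
    (hS : Tendsto (fun t : ℝ => ∑' l, b l * t ^ l) (𝓝[<] 1) atTop)
    (he : Tendsto e atTop (𝓝 d)) :
    Tendsto (fun t : ℝ => (∑' l, e l * b l * t ^ l) / ∑' l, b l * t ^ l) (𝓝[<] 1) (𝓝 d) := by
  obtain ⟨C, hC⟩ : ∃ C, ∀ l, |e l - d| ≤ C := by
    obtain ⟨C, hC⟩ := (he.sub_const d).norm.bddAbove_range
    exact ⟨C, fun l => hC ⟨l, rfl⟩⟩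
  rw [Metric.tendsto_nhds]
  intro ε hε
  obtain ⟨N, hN⟩ := Metric.tendsto_atTop.1 he (ε / 2) (by positivity)
  set A : ℝ := ∑ l ∈ Finset.range N, C * b l
  have hC0 : 0 ≤ C := (abs_nonneg _).trans (hC 0)
  have h1 : ∀ᶠ t : ℝ in 𝓝[<] 1, t ∈ Set.Ioo (0 : ℝ) 1 := Ioo_mem_nhdsLT (by norm_num)
  -- `A` bounds the first `N` terms uniformly in t < 1. Beyond this threshold `A` < (ε/2) S, so head
  -- and tail contribute at most half of ε S each.
  filter_upwards [h1, hS.eventually_gt_atTop (2 * A / ε + 1)] with t ht hSt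
  have hA0 : 0 ≤ A := Finset.sum_nonneg fun l _ => mul_nonneg hC0 (hb l)
  set S := ∑' l, b l * t ^ l
  have hS0 : 0 < S := lt_trans (by positivity) hSt
  have hst := hs t ⟨ht.1.le, ht.2⟩
  have ht0 : ∀ l, 0 ≤ b l * t ^ l := fun l => mul_nonneg (hb l) (pow_nonneg ht.1.le l)
  have hsd : Summable fun l => |e l - d| * (b l * t ^ l) := by
    refine Summable.of_nonneg_of_le (fun l => mul_nonneg (abs_nonneg _) (ht0 l)) (fun l => ?_)
      (hst.mul_left C)
    exact mul_le_mul_of_nonneg_right (hC l) (ht0 l)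
  have hse' : Summable fun l => (e l - d) * (b l * t ^ l) := by
    refine Summable.of_norm (hsd.congr fun l => ?_)
    rw [Real.norm_eq_abs, abs_mul, abs_of_nonneg (ht0 l)]
  have hse : Summable fun l => e l * b l * t ^ l :=
    (hse'.add (hst.mul_left d)).congr fun l => by ring
  have hdiff : (∑' l, e l * b l * t ^ l) - d * S = ∑' l, (e l - d) * (b l * t ^ l) := by
    rw [← tsum_mul_left, ← hse.tsum_sub (hst.mul_left d)]
    exact tsum_congr fun l => by ring
  have hbd : |(∑' l, e l * b l * t ^ l) - d * S| ≤ A + ε / 2 * S := by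
    rw [hdiff]
    calc |∑' l, (e l - d) * (b l * t ^ l)| ≤ ∑' l, |e l - d| * (b l * t ^ l) := by
          have := norm_tsum_le_tsum_norm hse'.norm
          refine this.trans (le_of_eq (tsum_congr fun l => ?_))
          rw [Real.norm_eq_abs, abs_mul, abs_of_nonneg (ht0 l)]
      _ ≤ ∑' l, ((if l ∈ Finset.range N then C * b l else 0) + ε / 2 * (b l * t ^ l)) := by
          refine hsd.tsum_le_tsum (fun l => ?_) (Summable.add ?_ (hst.mul_left _))
          · split_ifs with hl
            · have : |e l - d| * (b l * t ^ l) ≤ C * b l := by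
                refine mul_le_mul (hC l) ?_ (ht0 l) hC0
                exact mul_le_of_le_one_right (hb l) (pow_le_one₀ ht.1.le ht.2.le)
              have := mul_nonneg (half_pos hε).le (ht0 l)
              linarith
            · rw [zero_add]
              refine mul_le_mul_of_nonneg_right ?_ (ht0 l)
              have := hN l (by simpa using hl)
              rw [Real.dist_eq] at this
              exact this.le
          · exact summable_of_ne_finset_zero (s := Finset.range N) fun l hl => by simp [hl]
      _ = A + ε / 2 * S := by
          rw [Summable.tsum_add _ (hst.mul_left _), tsum_mul_left]
          · congr 1
            rw [tsum_eq_sum (s := Finset.range N)]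
            · exact Finset.sum_congr rfl fun l hl => by rw [if_pos hl]
            · intro l hl; rw [if_neg hl]
          · exact summable_of_ne_finset_zero (s := Finset.range N) fun l hl => by simp [hl]
  have hAS : A < ε / 2 * S := by
    have h2 : 2 * A / ε < S := by linarith
    rw [div_lt_iff₀ hε] at h2
    linarith
  rw [Real.dist_eq, show (∑' l, e l * b l * t ^ l) / S - d
    = ((∑' l, e l * b l * t ^ l) - d * S) / S by field_simp, abs_div, abs_of_pos hS0,
    div_lt_iff₀ hS0]
  linarith

theorem tendsto_one_sub_nhdsLT_one : Tendsto (fun t : ℝ => 1 - t) (𝓝[<] 1) (𝓝[>] 0) := by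
  refine tendsto_nhdsWithin_iff.2 ⟨?_, ?_⟩
  · have : Tendsto (fun t : ℝ => 1 - t) (𝓝 1) (𝓝 (1 - 1)) := (continuous_const.sub continuous_id).tendsto 1
    rw [sub_self] at this
    exact this.mono_left nhdsWithin_le_nhds
  · filter_upwards [self_mem_nhdsWithin] with t ht
    simpa using ht

theorem tendsto_one_sub_mul_tsum {a : ℕ → ℝ} {d : ℝ} (ha : Tendsto a atTop (𝓝 d)) :
    Tendsto (fun t : ℝ => (1 - t) * ∑' l, a l * t ^ l) (𝓝[<] 1) (𝓝 d) := by
  have h1 : ∀ᶠ t : ℝ in 𝓝[<] 1, t ∈ Set.Ioo (0 : ℝ) 1 := Ioo_mem_nhdsLT (by norm_num)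
  have hg : ∀ t ∈ Set.Ico (0 : ℝ) 1, HasSum (fun l : ℕ => (1 : ℝ) * t ^ l) (1 - t)⁻¹ := by
    intro t ht
    simpa using hasSum_geometric_of_lt_one ht.1 ht.2
  have := tendsto_tsum_div_tsum (b := fun _ => 1) (fun _ => zero_le_one)
    (fun t ht => (hg t ht).summable) ?_ ha
  · refine this.congr' ?_
    filter_upwards [h1] with t ht
    rw [(hg t ⟨ht.1.le, ht.2⟩).tsum_eq, div_inv_eq_mul, mul_comm]
    simp
  · refine (tendsto_inv_nhdsGT_zero.comp tendsto_one_sub_nhdsLT_one).congr' ?_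
    filter_upwards [h1] with t ht
    exact (hg t ⟨ht.1.le, ht.2⟩).tsum_eq.symm

theorem hasSum_succ_mul_pow {t : ℝ} (ht : t ∈ Set.Ico (0 : ℝ) 1) :
    HasSum (fun l : ℕ => ((l : ℝ) + 1) * t ^ l) (((1 - t) ^ 2)⁻¹) := by
  have ht' : ‖t‖ < 1 := by rw [Real.norm_eq_abs, abs_of_nonneg ht.1]; exact ht.2
  have h := (hasSum_coe_mul_geometric_of_norm_lt_one ht').add (hasSum_geometric_of_lt_one ht.1 ht.2)
  have h1 : (1 - t) ≠ 0 := by linarith [ht.2]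
  have e1 : t / (1 - t) ^ 2 + (1 - t)⁻¹ = ((1 - t) ^ 2)⁻¹ := by field_simp; ring
  rw [e1] at h
  simpa only [add_mul, one_mul] using h

theorem tendsto_one_sub_sq_mul_tsum {a : ℕ → ℝ} {d : ℝ}
    (ha : Tendsto (fun l : ℕ => a l / ((l : ℝ) + 1)) atTop (𝓝 d)) :
    Tendsto (fun t : ℝ => (1 - t) ^ 2 * ∑' l, a l * t ^ l) (𝓝[<] 1) (𝓝 d) := by
  have h1 : ∀ᶠ t : ℝ in 𝓝[<] 1, t ∈ Set.Ioo (0 : ℝ) 1 := Ioo_mem_nhdsLT (by norm_num)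
  have := tendsto_tsum_div_tsum (b := fun l => (l : ℝ) + 1) (fun _ => by positivity)
    (fun t ht => (hasSum_succ_mul_pow ht).summable) ?_ ha
  · refine this.congr' ?_
    filter_upwards [h1] with t ht
    rw [(hasSum_succ_mul_pow ⟨ht.1.le, ht.2⟩).tsum_eq, div_inv_eq_mul, mul_comm]
    congr 1
    refine tsum_congr fun l => ?_
    have : (l : ℝ) + 1 ≠ 0 := by positivity
    field_simp
  · have h2 := (tendsto_pow_atTop (n := 2) (by norm_num)).comp
      (tendsto_inv_nhdsGT_zero.comp tendsto_one_sub_nhdsLT_one)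
    refine h2.congr' ?_
    filter_upwards [h1] with t ht
    rw [(hasSum_succ_mul_pow ⟨ht.1.le, ht.2⟩).tsum_eq]
    simp

/-! ### Moments -/

theorem integral_pow_mul_one_sub_pow (l j : ℕ) :
    ∫ x in Set.Ioo (0 : ℝ) 1, x ^ l * (1 - x) ^ j
      = j.factorial / ∏ i ∈ Finset.range (j + 1), ((l : ℝ) + 1 + i) := by
  rw [← integral_Ioc_eq_integral_Ioo, ← intervalIntegral.integral_of_le zero_le_one]
  have h := Complex.betaIntegral_eval_nat_add_one_right (u := (l : ℂ) + 1)
    (by simp; positivity) j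
  have h2 : Complex.betaIntegral ((l : ℂ) + 1) (j + 1)
      = ((∫ x in (0 : ℝ)..1, x ^ l * (1 - x) ^ j : ℝ) : ℂ) := by
    rw [Complex.betaIntegral, ← intervalIntegral.integral_ofReal]
    refine intervalIntegral.integral_congr fun x _ => ?_
    simp
  rw [h2] at h
  apply Complex.ofReal_injective
  rw [h]
  push_cast
  rfl

theorem tendsto_pow_mul_integral_beta (j : ℕ) :
    Tendsto (fun l : ℕ => (l : ℝ) ^ (j + 1) * ∫ x in Set.Ioo (0 : ℝ) 1, x ^ l * (1 - x) ^ j)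
      atTop (𝓝 j.factorial) := by
  have h1 : ∀ i : ℕ, Tendsto (fun l : ℕ => (l : ℝ) / ((l : ℝ) + 1 + i)) atTop (𝓝 1) := by
    intro i
    have := tendsto_natCast_div_add_atTop (𝕜 := ℝ) ((1 : ℝ) + i)
    simpa [add_assoc] using this
  have h2 := (tendsto_finsetProd (Finset.range (j + 1)) fun i _ => h1 i).const_mul (j.factorial : ℝ)
  simp only [Finset.prod_const_one, mul_one] at h2
  refine h2.congr fun l => ?_
  rw [integral_pow_mul_one_sub_pow, Finset.prod_div_distrib, Finset.prod_const, Finset.card_range]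
  ring

theorem integrableOn_pow_mul_of_le {g : ℝ → ℝ} {l₀ l : ℕ} (hl : l₀ ≤ l)
    (hg : IntegrableOn (fun x => x ^ l₀ * g x) (Set.Ioo (0 : ℝ) 1)) :
    IntegrableOn (fun x => x ^ l * g x) (Set.Ioo (0 : ℝ) 1) := by
  have : (fun x => x ^ l * g x) = fun x => x ^ (l - l₀) * (x ^ l₀ * g x) := by
    ext x; rw [← mul_assoc, ← pow_add, Nat.sub_add_cancel hl]
  rw [this]
  refine Integrable.bdd_mul hg (c := 1) (by fun_prop) ?_
  refine (ae_restrict_iff' measurableSet_Ioo).2 (Eventually.of_forall fun x hx => ?_)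
  rw [Real.norm_eq_abs, abs_of_nonneg (pow_nonneg hx.1.le _)]
  exact pow_le_one₀ hx.1.le hx.2.le

/-- Laplace's method. Near 1 the integrand is at most η (1-x)^j x^l, whose integral is a Beta value
of order l^{-j-1}. On (0, ρ] the factor x^{l-l₀} is exponentially small against the fixed integrable
function x^{l₀} g. -/
theorem tendsto_pow_mul_integral_zero {g : ℝ → ℝ} {l₀ j : ℕ}
    (hg : IntegrableOn (fun x => x ^ l₀ * g x) (Set.Ioo (0 : ℝ) 1))
    (h0 : Tendsto (fun x => g x / (1 - x) ^ j) (𝓝[<] 1) (𝓝 0)) :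
    Tendsto (fun l : ℕ => (l : ℝ) ^ (j + 1) * ∫ x in Set.Ioo (0 : ℝ) 1, x ^ l * g x)
      atTop (𝓝 0) := by
  rw [Metric.tendsto_nhds]
  intro ε hε
  set η : ℝ := ε / (2 * (j.factorial + 1))
  have hη : 0 < η := by positivity
  have hbeta := (tendsto_pow_mul_integral_beta j).eventually_lt_const
    (lt_add_one (j.factorial : ℝ))
  have hnear : ∀ᶠ x : ℝ in 𝓝[<] 1, |g x| ≤ η * (1 - x) ^ j := by
    filter_upwards [(Metric.tendsto_nhds.1 h0) η hη, self_mem_nhdsWithin] with x hx hx1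
    have h1x : 0 < (1 - x) ^ j := pow_pos (by simpa using hx1) j
    rw [Real.dist_eq, sub_zero, abs_div, abs_of_pos h1x, div_lt_iff₀ h1x] at hx
    exact hx.le
  obtain ⟨a, ha1, ha⟩ := (mem_nhdsLT_iff_exists_Ioo_subset' (by norm_num : (0 : ℝ) < 1)).1 hnear
  -- The maximum with 1/2 keeps ρ positive, since ρ^{l₀} is divided by below.
  set ρ : ℝ := max a (1 / 2)
  have hρ0 : 0 < ρ := lt_of_lt_of_le (by norm_num) (le_max_right _ _)
  have hρ1 : ρ < 1 := max_lt ha1 (by norm_num)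
  set C : ℝ := ∫ x in Set.Ioo (0 : ℝ) 1, |x ^ l₀ * g x|
  have hC0 : 0 ≤ C := integral_nonneg fun _ => abs_nonneg _
  have hexp : Tendsto (fun l : ℕ => (l : ℝ) ^ (j + 1) * ρ ^ l * (C / ρ ^ l₀)) atTop (𝓝 0) := by
    have := (tendsto_pow_const_mul_const_pow_of_abs_lt_one (j + 1) (r := ρ)
      (by rwa [abs_of_pos hρ0])).mul_const (C / ρ ^ l₀)
    simpa using this
  filter_upwards [hbeta, hexp.eventually_lt_const (half_pos hε), eventually_ge_atTop l₀]
    with l hl1 hl2 hl3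
  have hpt : ∀ x ∈ Set.Ioo (0 : ℝ) 1, |x ^ l * g x|
      ≤ ρ ^ (l - l₀) * |x ^ l₀ * g x| + η * (x ^ l * (1 - x) ^ j) := by
    intro x hx
    have h1 : 0 ≤ η * (x ^ l * (1 - x) ^ j) :=
      mul_nonneg hη.le (mul_nonneg (pow_nonneg hx.1.le _) (pow_nonneg (by linarith [hx.2]) _))
    have h2 : 0 ≤ ρ ^ (l - l₀) * |x ^ l₀ * g x| := by positivity
    rcases le_or_gt x ρ with hxρ | hxρ
    · have : |x ^ l * g x| = x ^ (l - l₀) * |x ^ l₀ * g x| := by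
        rw [abs_mul, abs_mul, ← mul_assoc, abs_of_pos (pow_pos hx.1 l), abs_of_pos (pow_pos hx.1 l₀),
          ← pow_add, Nat.sub_add_cancel hl3]
      rw [this]
      have := mul_le_mul_of_nonneg_right (pow_le_pow_left₀ hx.1.le hxρ (l - l₀))
        (abs_nonneg (x ^ l₀ * g x))
      linarith
    · have h3 : |g x| ≤ η * (1 - x) ^ j := ha ⟨lt_of_le_of_lt (le_max_left _ _) hxρ, hx.2⟩
      rw [abs_mul, abs_of_pos (pow_pos hx.1 l)]
      have := mul_le_mul_of_nonneg_left h3 (pow_pos hx.1 l).le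
      linarith
  have hbi : IntegrableOn (fun x : ℝ => x ^ l * (1 - x) ^ j) (Set.Ioo (0 : ℝ) 1) := by
    refine (Continuous.integrableOn_Icc (by fun_prop)).mono_set Set.Ioo_subset_Icc_self
  have hmain : |∫ x in Set.Ioo (0 : ℝ) 1, x ^ l * g x|
      ≤ ρ ^ (l - l₀) * C + η * ∫ x in Set.Ioo (0 : ℝ) 1, x ^ l * (1 - x) ^ j := by
    refine (abs_integral_le_integral_abs).trans ?_
    rw [← integral_const_mul, ← integral_const_mul, ← integral_add]
    · refine setIntegral_mono_on ?_ ?_ measurableSet_Ioo hpt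
      · exact (integrableOn_pow_mul_of_le hl3 hg).abs
      · exact (hg.abs.const_mul _).add (hbi.const_mul _)
    · exact hg.abs.const_mul _
    · exact hbi.const_mul _
  rw [Real.dist_eq, sub_zero, abs_mul, abs_of_nonneg (by positivity)]
  have h4 := mul_le_mul_of_nonneg_left hmain (by positivity : (0 : ℝ) ≤ (l : ℝ) ^ (j + 1))
  have h5 : (l : ℝ) ^ (j + 1) * (ρ ^ (l - l₀) * C) = (l : ℝ) ^ (j + 1) * ρ ^ l * (C / ρ ^ l₀) := by
    rw [pow_sub₀ _ hρ0.ne' hl3]; field_simp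
  have h6 : η * ((l : ℝ) ^ (j + 1) * ∫ x in Set.Ioo (0 : ℝ) 1, x ^ l * (1 - x) ^ j) ≤ ε / 2 := by
    have := mul_le_mul_of_nonneg_left hl1.le hη.le
    refine this.trans (le_of_eq ?_)
    simp only [η]; field_simp
  rw [mul_add, h5] at h4
  linarith

/-- Watson's lemma for moments, leading order. -/
theorem tendsto_pow_mul_integral {g : ℝ → ℝ} {l₀ j : ℕ} {κ : ℝ}
    (hg : IntegrableOn (fun x => x ^ l₀ * g x) (Set.Ioo (0 : ℝ) 1))
    (h0 : Tendsto (fun x => g x / (1 - x) ^ j) (𝓝[<] 1) (𝓝 κ)) :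
    Tendsto (fun l : ℕ => (l : ℝ) ^ (j + 1) * ∫ x in Set.Ioo (0 : ℝ) 1, x ^ l * g x)
      atTop (𝓝 (κ * j.factorial)) := by
  have hbi : ∀ l, IntegrableOn (fun x : ℝ => x ^ l * (κ * (1 - x) ^ j)) (Set.Ioo (0 : ℝ) 1) :=
    fun l => (Continuous.integrableOn_Icc (by fun_prop)).mono_set Set.Ioo_subset_Icc_self
  have h1 := tendsto_pow_mul_integral_zero (g := fun x => g x - κ * (1 - x) ^ j) (l₀ := l₀) (j := j)
    ?_ ?_
  · have h2 := h1.add ((tendsto_pow_mul_integral_beta j).const_mul κ)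
    rw [zero_add] at h2
    refine h2.congr' ?_
    filter_upwards [eventually_ge_atTop l₀] with l hl
    have : ∫ x in Set.Ioo (0 : ℝ) 1, x ^ l * (g x - κ * (1 - x) ^ j)
        = (∫ x in Set.Ioo (0 : ℝ) 1, x ^ l * g x)
          - κ * ∫ x in Set.Ioo (0 : ℝ) 1, x ^ l * (1 - x) ^ j := by
      rw [← integral_const_mul, ← integral_sub (integrableOn_pow_mul_of_le hl hg)]
      · exact integral_congr_ae (Eventually.of_forall fun x => by ring)
      · exact (hbi l).congr (Eventually.of_forall fun x => by ring)
    rw [this]; ring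
  · exact (hg.sub (hbi l₀)).congr (Eventually.of_forall fun x => by simp; ring)
  · have := h0.sub_const κ
    rw [sub_self] at this
    refine this.congr' ?_
    filter_upwards [self_mem_nhdsWithin] with x hx
    have : (1 - x) ^ j ≠ 0 := pow_ne_zero _ (by have : x < 1 := hx; linarith)
    field_simp

/-! ### Asymptotic expansions at `1` -/

/-- To the left of `1` the function is approximated to any order by polynomials. -/
def HasExpansion (p : ℝ → ℝ) : Prop :=
  ∀ n : ℕ, ∃ P : Polynomial ℝ,
    (fun t => p t - P.eval t) =O[𝓝[<] 1] fun t : ℝ => (1 - t) ^ n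

theorem isBigO_one_eval (P : Polynomial ℝ) :
    (fun t => P.eval t) =O[𝓝[<] 1] fun _ : ℝ => (1 : ℝ) :=
  (P.continuous.tendsto 1 |>.mono_left nhdsWithin_le_nhds).isBigO_one ℝ

theorem hasExpansion_polynomial (P : Polynomial ℝ) : HasExpansion fun t => P.eval t :=
  fun n => ⟨P, by simpa using Asymptotics.isBigO_zero _ _⟩

theorem HasExpansion.congr {p q : ℝ → ℝ} (hp : HasExpansion p) (h : p =ᶠ[𝓝[<] 1] q) :
    HasExpansion q := fun n => by
  obtain ⟨P, hP⟩ := hp n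
  refine ⟨P, hP.congr' ?_ EventuallyEq.rfl⟩
  filter_upwards [h] with t ht
  rw [ht]

theorem HasExpansion.sub {p q : ℝ → ℝ} (hp : HasExpansion p) (hq : HasExpansion q) :
    HasExpansion fun t => p t - q t := fun n => by
  obtain ⟨P, hP⟩ := hp n
  obtain ⟨Q, hQ⟩ := hq n
  refine ⟨P - Q, (hP.sub hQ).congr_left fun t => ?_⟩
  rw [Polynomial.eval_sub]; ring

theorem HasExpansion.isBigO_one {p : ℝ → ℝ} (hp : HasExpansion p) :
    p =O[𝓝[<] 1] fun _ : ℝ => (1 : ℝ) := by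
  obtain ⟨P, hP⟩ := hp 0
  simpa using hP.add ((isBigO_one_eval P).congr_right fun t => (pow_zero (1 - t)).symm)

theorem HasExpansion.mul {p q : ℝ → ℝ} (hp : HasExpansion p) (hq : HasExpansion q) :
    HasExpansion fun t => p t * q t := fun n => by
  obtain ⟨P, hP⟩ := hp n
  obtain ⟨Q, hQ⟩ := hq n
  refine ⟨P * Q, ?_⟩
  have h1 := hP.mul hq.isBigO_one
  have h2 := (isBigO_one_eval P).mul hQ
  simp only [mul_one, one_mul] at h1 h2
  have h := h1.add h2
  refine h.congr_left fun t => ?_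
  rw [Polynomial.eval_mul]; ring

theorem HasExpansion.neg {p : ℝ → ℝ} (hp : HasExpansion p) : HasExpansion fun t => -p t := by
  simpa using (hasExpansion_polynomial 0).sub hp

theorem tendsto_one_sub_pow_nhdsLT (n : ℕ) :
    Tendsto (fun t : ℝ => (1 - t) ^ (n + 1)) (𝓝[<] 1) (𝓝 0) := by
  have h := ((tendsto_one_sub_nhdsLT_one.mono_right nhdsWithin_le_nhds).pow (n + 1))
  simpa using h

theorem eval_one_of_isBigO {p : ℝ → ℝ} {a : ℝ} {P : Polynomial ℝ} {n : ℕ}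
    (h0 : Tendsto p (𝓝[<] 1) (𝓝 a))
    (hP : (fun t => p t - P.eval t) =O[𝓝[<] 1] fun t : ℝ => (1 - t) ^ (n + 1)) :
    P.eval 1 = a := by
  have h1 := hP.trans_tendsto (tendsto_one_sub_pow_nhdsLT n)
  have h2 : Tendsto (fun t => P.eval t) (𝓝[<] 1) (𝓝 a) := by simpa using h0.sub h1
  exact tendsto_nhds_unique
    ((P.continuous.tendsto 1).mono_left nhdsWithin_le_nhds) h2

/-- Since P(1) = a ≠ 0, P is a unit modulo (1-X)^{n+1}. A Bézout inverse U of P approximates 1/p,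
because 1 - U p = V (1-t)^{n+1} - U (p - P). -/
theorem HasExpansion.inv {p : ℝ → ℝ} {a : ℝ} (hp : HasExpansion p) (ha : a ≠ 0)
    (h0 : Tendsto p (𝓝[<] 1) (𝓝 a)) : HasExpansion fun t => (p t)⁻¹ := fun n => by
  -- At order n = 0 the bound O(1) would not determine P(1), so one extra order is taken and given
  -- up at the end.
  obtain ⟨P, hP⟩ := hp (n + 1)
  have hPa := eval_one_of_isBigO h0 hP
  have hcop : IsCoprime P ((Polynomial.C 1 - Polynomial.X) ^ (n + 1)) := by
    refine IsCoprime.pow_right ?_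
    rw [← IsCoprime.neg_right_iff, neg_sub, isCoprime_comm]
    refine (Polynomial.irreducible_X_sub_C (1 : ℝ)).coprime_iff_not_dvd.2 fun h => ha ?_
    rw [← hPa]; exact Polynomial.dvd_iff_isRoot.1 h
  obtain ⟨U, V, hUV⟩ := hcop
  refine ⟨U, ?_⟩
  have hi : (fun t => (p t)⁻¹) =O[𝓝[<] 1] fun _ : ℝ => (1 : ℝ) := (h0.inv₀ ha).isBigO_one ℝ
  have h1 : (fun t : ℝ => V.eval t * (1 - t) ^ (n + 1) - U.eval t * (p t - P.eval t))
      =O[𝓝[<] 1] fun t : ℝ => (1 - t) ^ (n + 1) := by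
    have := ((isBigO_one_eval V).mul
      (Asymptotics.isBigO_refl (fun t : ℝ => (1 - t) ^ (n + 1)) (𝓝[<] 1))).sub
      ((isBigO_one_eval U).mul hP)
    simpa only [one_mul] using this
  have h2 := (hi.mul h1).congr' (f₂ := fun t => (p t)⁻¹ - U.eval t)
    (g₂ := fun t : ℝ => (1 - t) ^ (n + 1)) ?_ (Eventually.of_forall fun t => by simp)
  · refine h2.trans ?_
    have := (Asymptotics.isBigO_refl (fun t : ℝ => (1 - t) ^ n) (𝓝[<] 1)).mul
      ((tendsto_one_sub_pow_nhdsLT 0).isBigO_one ℝ)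
    simpa [pow_succ] using this
  · filter_upwards [h0.eventually_ne ha] with t ht
    have h3 : U.eval t * P.eval t + V.eval t * (1 - t) ^ (n + 1) = 1 := by
      have := congrArg (Polynomial.eval t) hUV
      simpa using this
    field_simp
    linear_combination h3

/-- A sufficiently good approximating polynomial also vanishes at 1, hence is divisible by X - 1.
The quotient by 1 - t costs one order and a sign. -/
theorem HasExpansion.div_one_sub {p : ℝ → ℝ} (hp : HasExpansion p)
    (h0 : Tendsto p (𝓝[<] 1) (𝓝 0)) : HasExpansion fun t => p t / (1 - t) := fun n => by
  obtain ⟨P, hP⟩ := hp (n + 1)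
  obtain ⟨Q, hQ⟩ := Polynomial.dvd_iff_isRoot.2 (eval_one_of_isBigO h0 hP)
  refine ⟨-Q, ?_⟩
  have h1 := (Asymptotics.isBigO_refl (fun t : ℝ => (1 - t)⁻¹) (𝓝[<] 1)).mul hP
  refine h1.congr' ?_ ?_
  · filter_upwards [self_mem_nhdsWithin] with t ht
    have : 1 - t ≠ 0 := by have : t < 1 := ht; linarith
    rw [hQ]
    simp
    field_simp
    ring
  · filter_upwards [self_mem_nhdsWithin] with t ht
    have : 1 - t ≠ 0 := by have : t < 1 := ht; linarith
    rw [pow_succ']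
    field_simp

theorem hasExpansion_of_contDiffOn {f : ℝ → ℝ} {a : ℝ} (ha : a < 1)
    (hf : ContDiffOn ℝ ∞ f (Set.Ioc a 1)) : HasExpansion f := fun n => by
  have h := (taylor_isLittleO (n := n) (convex_Ioc a 1) ⟨ha, le_rfl⟩
    (hf.of_le (by exact_mod_cast le_top))).isBigO
  refine ⟨∑ k ∈ Finset.range (n + 1), Polynomial.C ((k.factorial : ℝ)⁻¹ *
    iteratedDerivWithin k f (Set.Ioc a 1) 1) * (Polynomial.X - Polynomial.C 1) ^ k, ?_⟩
  have hle : 𝓝[<] (1 : ℝ) ≤ 𝓝[Set.Ioc a 1] 1 := by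
    rw [← nhdsWithin_Ioo_eq_nhdsLT ha]
    exact nhdsWithin_mono _ Set.Ioo_subset_Ioc_self
  refine ((h.mono hle).congr_left fun t => ?_).trans (Asymptotics.isBigO_of_le _ fun t => ?_)
  · rw [taylor_within_apply, Polynomial.eval_finsetSum]
    congr 1
    refine Finset.sum_congr rfl fun k _ => ?_
    simp
    ring
  · rw [norm_pow, norm_pow, norm_sub_rev]

/-! ### Coefficients of power series that have an expansion at 1 -/

theorem summable_mul_pow_of_isBigO {a : ℕ → ℝ} {k : ℕ}
    (ha : a =O[atTop] fun l : ℕ => (l : ℝ) ^ k) {t : ℝ} (ht : |t| < 1) :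
    Summable fun l => a l * t ^ l := by
  refine summable_of_isBigO_nat (g := fun l : ℕ => (l : ℝ) ^ k * |t| ^ l) ?_ ?_
  · exact summable_pow_mul_geometric_of_norm_lt_one k (by simpa using ht)
  · refine ha.mul (Asymptotics.isBigO_of_le _ fun l => ?_)
    simp

theorem one_sub_pow_le_nat_mul {t : ℝ} (h0 : 0 ≤ t) (l : ℕ) : 1 - t ^ l ≤ l * (1 - t) := by
  have := one_add_mul_le_pow (a := t - 1) (by linarith) l
  rw [add_sub_cancel] at this
  linarith

theorem nat_mul_pow_mul_le_one_sub_pow {t : ℝ} (h0 : 0 ≤ t) (h1 : t ≤ 1) (l : ℕ) :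
    l * t ^ l * (1 - t) ≤ 1 - t ^ l := by
  have := geom_sum_mul_neg t l
  rw [← this]
  refine mul_le_mul_of_nonneg_right ?_ (by linarith)
  calc (l : ℝ) * t ^ l = ∑ i ∈ Finset.range l, t ^ l := by simp
    _ ≤ _ := Finset.sum_le_sum fun i hi =>
      pow_le_pow_of_le_one h0 h1 (Finset.mem_range.1 hi).le

/-- The `n`-th multiplicative difference of a function with an expansion is `O((1 - t)^n)`. -/
theorem HasExpansion.isBigO_difference {p : ℝ → ℝ} (hp : HasExpansion p) (n : ℕ) :
    (fun t => ∑ i ∈ Finset.range (n + 1), (-1 : ℝ) ^ i * n.choose i * p (t ^ (i + 1)))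
      =O[𝓝[<] 1] fun t : ℝ => (1 - t) ^ n := by
  obtain ⟨P, hP⟩ := hp n
  have hunit : ∀ᶠ t : ℝ in 𝓝[<] 1, t ∈ Set.Ioo (0 : ℝ) 1 := Ioo_mem_nhdsLT (by norm_num)
  have hpow : ∀ m n : ℕ, (fun t : ℝ => (1 - t ^ m) ^ n) =O[𝓝[<] 1] fun t : ℝ => (1 - t) ^ n := by
    intro m n
    refine Asymptotics.IsBigO.pow (Asymptotics.IsBigO.of_bound m ?_) n
    filter_upwards [hunit] with t ht
    rw [Real.norm_eq_abs, Real.norm_eq_abs, abs_of_nonneg (by linarith [pow_le_one₀ ht.1.le ht.2.le (n := m)]),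
      abs_of_nonneg (by linarith [ht.2])]
    exact one_sub_pow_le_nat_mul ht.1.le m
  have htend : ∀ i : ℕ, Tendsto (fun t : ℝ => t ^ (i + 1)) (𝓝[<] 1) (𝓝[<] 1) := by
    intro i
    refine tendsto_nhdsWithin_iff.2 ⟨?_, ?_⟩
    · have : Tendsto (fun t : ℝ => t ^ (i + 1)) (𝓝 1) (𝓝 (1 ^ (i + 1))) :=
        (continuous_pow (i + 1)).tendsto 1
      rw [one_pow] at this
      exact this.mono_left nhdsWithin_le_nhds
    · filter_upwards [hunit] with t ht
      exact pow_lt_one₀ ht.1.le ht.2 (Nat.succ_ne_zero i)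
  have h1 : (fun t => ∑ i ∈ Finset.range (n + 1), (-1 : ℝ) ^ i * n.choose i *
      (p (t ^ (i + 1)) - P.eval (t ^ (i + 1)))) =O[𝓝[<] 1] fun t : ℝ => (1 - t) ^ n := by
    refine Asymptotics.IsBigO.fun_sum fun i _ => ?_
    exact ((hP.comp_tendsto (htend i)).trans (hpow (i + 1) n)).const_mul_left _
  have h2 : (fun t => ∑ i ∈ Finset.range (n + 1), (-1 : ℝ) ^ i * n.choose i *
      P.eval (t ^ (i + 1))) =O[𝓝[<] 1] fun t : ℝ => (1 - t) ^ n := by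
    -- By the binomial theorem the difference of the monomial t^m is t^m (1 - t^m)^n. The exponents
    -- i + 1 start at 1 because an expansion says nothing about the value at t⁰ = 1.
    have hmon : ∀ t : ℝ, ∑ i ∈ Finset.range (n + 1), (-1 : ℝ) ^ i * n.choose i *
        P.eval (t ^ (i + 1))
        = ∑ m ∈ Finset.range (P.natDegree + 1), P.coeff m * (t ^ m * (1 - t ^ m) ^ n) := by
      intro t
      simp only [Polynomial.eval_eq_sum_range, Finset.mul_sum]
      rw [Finset.sum_comm]
      refine Finset.sum_congr rfl fun m _ => ?_
      rw [sub_eq_neg_add, add_pow, Finset.mul_sum, Finset.mul_sum]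
      refine Finset.sum_congr rfl fun i _ => ?_
      rw [one_pow, neg_pow (t ^ _) i, ← pow_mul, ← pow_mul]
      ring
    rw [funext hmon]
    refine Asymptotics.IsBigO.fun_sum fun m _ => ?_
    have hm : (fun t : ℝ => t ^ m) =O[𝓝[<] 1] fun _ : ℝ => (1 : ℝ) := by
      simpa using isBigO_one_eval (Polynomial.X ^ m)
    have h3 := hm.mul (hpow m n)
    simp only [one_mul] at h3
    exact h3.const_mul_left _
  refine (h1.add h2).congr_left fun t => ?_
  rw [← Finset.sum_add_distrib]
  exact Finset.sum_congr rfl fun i _ => by ring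

theorem sum_difference_tsum {a : ℕ → ℝ} {t : ℝ} (n : ℕ)
    (hs : ∀ i, Summable fun l => a l * (t ^ (i + 1)) ^ l) :
    HasSum (fun l => a l * (t ^ l * (1 - t ^ l) ^ n))
      (∑ i ∈ Finset.range (n + 1), (-1 : ℝ) ^ i * n.choose i * ∑' l, a l * (t ^ (i + 1)) ^ l) := by
  have h := hasSum_sum fun i (_ : i ∈ Finset.range (n + 1)) =>
    (hs i).hasSum.mul_left ((-1 : ℝ) ^ i * n.choose i)
  refine h.congr_fun ?_
  intro l
  rw [sub_eq_neg_add, add_pow, Finset.mul_sum, Finset.mul_sum]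
  refine Finset.sum_congr rfl fun i _ => ?_
  rw [one_pow, neg_pow (t ^ _) i, ← pow_mul, ← pow_mul]
  ring

/-- The n-th multiplicative difference turns the series into ∑ a_l t^l (1 - t^l)^n and, by the
expansion, is O((1-t)^n). If d > 0, each term of large index is about d (1-t)^n or more as t → 1,
because l t^l (1-t) ≤ 1 - t^l. Arbitrarily many such terms contradict the bound. This replaces an
analysis of the logarithmic singularity. -/
theorem limit_nonpos_of_hasExpansion {a : ℕ → ℝ} {d : ℝ} {n : ℕ}
    (h : HasExpansion fun t => ∑' l, a l * t ^ l)
    (ha : Tendsto (fun l : ℕ => (l : ℝ) ^ n * a l) atTop (𝓝 d)) : d ≤ 0 := by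
  by_contra! hd
  have hunit : ∀ᶠ t : ℝ in 𝓝[<] 1, t ∈ Set.Ioo (0 : ℝ) 1 := Ioo_mem_nhdsLT (by norm_num)
  have haO : a =O[atTop] fun l : ℕ => (l : ℝ) ^ 0 := by
    refine Asymptotics.IsBigO.trans ?_ ((ha.isBigO_one ℝ).congr_right fun l => by simp)
    refine Asymptotics.IsBigO.of_bound 1 ?_
    filter_upwards [eventually_ge_atTop 1] with l hl
    rw [norm_mul, one_mul]
    refine le_mul_of_one_le_left (norm_nonneg _) ?_
    rw [norm_pow, Real.norm_natCast]
    exact one_le_pow₀ (by exact_mod_cast hl)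
  obtain ⟨C, hC⟩ := (h.isBigO_difference n).bound
  obtain ⟨l₁, hl₁⟩ := eventually_atTop.1
    ((ha.eventually_const_lt (half_lt_self hd)).and (eventually_ge_atTop 1))
  set C₁ : ℝ := ∑ l ∈ Finset.range l₁, |a l| * (l : ℝ) ^ n
  -- `K` consecutive terms from index l₁ on are kept. The earlier terms cost at most C₁ (1-t)^n, the
  -- later ones are nonnegative, and t → 1 follows after division by (1-t)^n.
  have key : ∀ K : ℕ, d / 2 * K ≤ C + C₁ := by
    intro K
    have hlim : Tendsto (fun t : ℝ => d / 2 * ∑ i ∈ Finset.range K, (t ^ (l₁ + i)) ^ (n + 1))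
        (𝓝[<] 1) (𝓝 (d / 2 * K)) := by
      have hc : Continuous fun t : ℝ => d / 2 * ∑ i ∈ Finset.range K, (t ^ (l₁ + i)) ^ (n + 1) := by
        fun_prop
      have := (hc.tendsto 1).mono_left (nhdsWithin_le_nhds (s := Set.Iio 1))
      simpa using this
    refine le_of_tendsto hlim ?_
    filter_upwards [hunit, hC] with t ht htC
    have hp : 0 < (1 - t) ^ n := pow_pos (by linarith [ht.2]) n
    have hsum := sum_difference_tsum (a := a) (t := t) n fun i =>
      summable_mul_pow_of_isBigO haO (by
        rw [abs_of_pos (pow_pos ht.1 _)]; exact pow_lt_one₀ ht.1.le ht.2 (Nat.succ_ne_zero i))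
    have h01 : ∀ l, 0 ≤ 1 - t ^ l := fun l => by linarith [pow_le_one₀ ht.1.le ht.2.le (n := l)]
    have hbig : ∀ l, l₁ ≤ l → d / 2 * (t ^ l) ^ (n + 1) * (1 - t) ^ n
        ≤ a l * (t ^ l * (1 - t ^ l) ^ n) := by
      intro l hl
      obtain ⟨h1, h2⟩ := hl₁ l hl
      have hl0 : (0 : ℝ) < (l : ℝ) ^ n := pow_pos (by exact_mod_cast h2) n
      have h3 := pow_le_pow_left₀ (by have := ht.1.le; have : 0 ≤ 1 - t := by linarith [ht.2]
                                      positivity)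
        (nat_mul_pow_mul_le_one_sub_pow ht.1.le ht.2.le l) n
      have ha0 : 0 < a l := by
        by_contra! hneg
        have := mul_nonpos_of_nonneg_of_nonpos hl0.le hneg
        linarith
      have htl : 0 < t ^ l := pow_pos ht.1 l
      calc d / 2 * (t ^ l) ^ (n + 1) * (1 - t) ^ n
          ≤ (l : ℝ) ^ n * a l * (t ^ l) ^ (n + 1) * (1 - t) ^ n := by gcongr
        _ = a l * (t ^ l * (l * t ^ l * (1 - t)) ^ n) := by rw [mul_pow, mul_pow]; ring
        _ ≤ _ := by gcongr
    have hsmall : ∀ l, -(|a l| * (l : ℝ) ^ n * (1 - t) ^ n) ≤ a l * (t ^ l * (1 - t ^ l) ^ n) := by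
      intro l
      have h3 := pow_le_pow_left₀ (h01 l) (one_sub_pow_le_nat_mul ht.1.le l) n
      rw [mul_pow] at h3
      have h4 : 0 ≤ t ^ l * (1 - t ^ l) ^ n := mul_nonneg (pow_pos ht.1 l).le (pow_nonneg (h01 l) n)
      have h5 : t ^ l * (1 - t ^ l) ^ n ≤ (l : ℝ) ^ n * (1 - t) ^ n :=
        (mul_le_of_le_one_left (pow_nonneg (h01 l) n) (pow_le_one₀ ht.1.le ht.2.le)).trans h3
      have h6 := mul_le_mul_of_nonneg_left h5 (abs_nonneg (a l))
      have h7 := mul_le_mul_of_nonneg_right (neg_abs_le (a l)) h4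
      linarith
    have hpart := sum_le_hasSum (Finset.range (l₁ + K)) (fun l hl => ?_) hsum
    · rw [Finset.sum_range_add] at hpart
      have hA : -(C₁ * (1 - t) ^ n) ≤ ∑ l ∈ Finset.range l₁, a l * (t ^ l * (1 - t ^ l) ^ n) := by
        rw [Finset.sum_mul, ← Finset.sum_neg_distrib]
        exact Finset.sum_le_sum fun l _ => hsmall l
      have hB : (d / 2 * ∑ i ∈ Finset.range K, (t ^ (l₁ + i)) ^ (n + 1)) * (1 - t) ^ n
          ≤ ∑ i ∈ Finset.range K, a (l₁ + i) * (t ^ (l₁ + i) * (1 - t ^ (l₁ + i)) ^ n) := by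
        rw [Finset.mul_sum, Finset.sum_mul]
        exact Finset.sum_le_sum fun i _ => hbig _ (Nat.le_add_right _ _)
      rw [Real.norm_eq_abs, Real.norm_eq_abs, abs_of_pos hp] at htC
      have := (le_abs_self _).trans htC
      refine le_of_mul_le_mul_right ?_ hp
      linarith
    · have hl' : l₁ ≤ l := by
        rw [Finset.mem_range] at hl; omega
      refine le_trans ?_ (hbig l hl')
      have := (pow_pos ht.1 l)
      positivity
  obtain ⟨K, hK⟩ := exists_nat_gt ((C + C₁) / (d / 2))
  have := key K
  rw [div_lt_iff₀ (half_pos hd)] at hK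
  linarith

/-- If a power series has an expansion at `1`, then its coefficients admit no leading
term `d l^{-n}`. -/
theorem limit_eq_zero_of_hasExpansion {a : ℕ → ℝ} {d : ℝ} {n : ℕ}
    (h : HasExpansion fun t => ∑' l, a l * t ^ l)
    (ha : Tendsto (fun l : ℕ => (l : ℝ) ^ n * a l) atTop (𝓝 d)) : d = 0 := by
  refine le_antisymm (limit_nonpos_of_hasExpansion h ha) ?_
  have h2 : HasExpansion fun t => ∑' l, -a l * t ^ l := by
    simpa only [neg_mul, tsum_neg] using h.neg
  have := limit_nonpos_of_hasExpansion (d := -d) (n := n) h2 (by simpa using ha.neg)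
  linarith

/-! ### The exceptional family -/

/-- Up to the factor `e^{L/4}`, the function `φ_v` solves `C'' = (v / 16) C` in `L`. -/
theorem exists_phi_eq_exp_mul (v : ℝ) : ∃ C D : ℝ → ℝ,
    (∀ L, HasDerivAt C (D L) L) ∧ (∀ L, HasDerivAt D (v / 16 * C L) L) ∧ C 0 = 1 ∧ D 0 = -1 / 4 ∧
    ∀ t, phi v t = Real.exp (Real.log (1 / t) / 4) * C (Real.log (1 / t)) := by
  by_cases hv : v = 0
  · refine ⟨fun L => 1 - L / 4, fun _ => -1 / 4, fun L => ?_, fun L => ?_, by simp, rfl, fun t => ?_⟩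
    · exact (((hasDerivAt_id L).div_const 4).const_sub 1).congr_deriv (by ring)
    · simpa [hv] using hasDerivAt_const L (-1 / 4 : ℝ)
    · simp [phi, hv]
  · set s : ℂ := (v : ℂ) ^ (1 / 2 : ℂ) with hs
    have h2 : s ^ 2 = v := by rw [hs, ← Complex.cpow_nat_mul]; simp
    have hs0 : s ≠ 0 := by
      rintro h; rw [h] at h2; apply hv; exact_mod_cast (by simpa using h2.symm : (v : ℂ) = 0)
    set Cc : ℂ → ℂ := fun L => Complex.cosh (L * s / 4) - 1 / s * Complex.sinh (L * s / 4)
    set Dc : ℂ → ℂ := fun L => s / 4 * Complex.sinh (L * s / 4) - 1 / 4 * Complex.cosh (L * s / 4)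
    have hlin : ∀ L : ℂ, HasDerivAt (fun L : ℂ => L * s / 4) (s / 4) L := fun L => by
      simpa using ((hasDerivAt_id L).mul_const s).div_const 4
    have hC : ∀ L, HasDerivAt Cc (Dc L) L := fun L => by
      refine (((Complex.hasDerivAt_cosh _).comp L (hlin L)).sub
        (((Complex.hasDerivAt_sinh _).comp L (hlin L)).const_mul (1 / s))).congr_deriv ?_
      simp only [Dc]; field_simp
    have hD : ∀ L, HasDerivAt Dc ((v : ℂ) / 16 * Cc L) L := fun L => by
      refine ((((Complex.hasDerivAt_sinh _).comp L (hlin L)).const_mul (s / 4)).sub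
        (((Complex.hasDerivAt_cosh _).comp L (hlin L)).const_mul (1 / 4))).congr_deriv ?_
      simp only [Cc, ← h2]; field_simp; ring
    refine ⟨fun L => (Cc L).re, fun L => (Dc L).re, fun L => (hC L).real_of_complex, fun L => ?_,
      by simp [Cc], by norm_num [Dc], fun t => ?_⟩
    · refine (hD L).real_of_complex.congr_deriv ?_
      rw [show ((v : ℂ) / 16) = ((v / 16 : ℝ) : ℂ) by push_cast; rfl, Complex.re_ofReal_mul]
    · simp only [phi, if_neg hv, ← hs]
      rw [show (Complex.exp ((Real.log (1 / t) : ℝ) / 4 : ℂ))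
        = ((Real.exp (Real.log (1 / t) / 4) : ℝ) : ℂ) by push_cast; rfl, Complex.re_ofReal_mul]

theorem contDiff_of_hasDerivAt_pair {C D : ℝ → ℝ} {q : ℝ} (hC : ∀ L, HasDerivAt C (D L) L)
    (hD : ∀ L, HasDerivAt D (q * C L) L) : ContDiff ℝ ∞ C := by
  rw [contDiff_infty]
  have : ∀ n : ℕ, ContDiff ℝ n C ∧ ContDiff ℝ n D := by
    intro n
    induction n with
    | zero =>
      simp only [Nat.cast_zero, contDiff_zero]
      exact ⟨continuous_iff_continuousAt.2 fun L => (hC L).continuousAt,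
        continuous_iff_continuousAt.2 fun L => (hD L).continuousAt⟩
    | succ n ih =>
      push_cast
      rw [contDiff_succ_iff_deriv, contDiff_succ_iff_deriv, funext fun L => (hC L).deriv,
        funext fun L => (hD L).deriv]
      exact ⟨⟨fun L => (hC L).differentiableAt, by simp, ih.2⟩,
        ⟨fun L => (hD L).differentiableAt, by simp, contDiff_const.mul ih.1⟩⟩
  exact fun n => (this n).1

theorem contDiffOn_phi (v : ℝ) : ContDiffOn ℝ ∞ (phi v) (Set.Ioi 0) := by
  obtain ⟨C, D, hC, hD, -, -, h⟩ := exists_phi_eq_exp_mul v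
  rw [funext h]
  have hlog : ContDiffOn ℝ ∞ (fun t : ℝ => Real.log (1 / t)) (Set.Ioi 0) := by
    refine ContDiffOn.log (contDiffOn_const.div contDiffOn_id fun t ht => ?_) fun t ht => ?_
    · exact (Set.mem_Ioi.1 ht).ne'
    · exact (one_div_pos.2 ht).ne'
  exact (Real.contDiff_exp.comp_contDiffOn (hlog.div_const 4)).mul
    ((contDiff_of_hasDerivAt_pair hC hD).comp_contDiffOn hlog)

/-- The Euler differential equation of `φ_v`, as a first order system for `φ_v` and `t φ_v'`. -/
theorem exists_euler_system_phi (v : ℝ) : ∃ q : ℝ → ℝ,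
    (∀ t > 0, HasDerivAt (phi v) (q t / t) t) ∧
    (∀ t > 0, HasDerivAt q (-(q t / 2 + (1 - v) / 16 * phi v t) / t) t) ∧
    phi v 1 = 1 ∧ q 1 = 0 := by
  obtain ⟨C, D, hC, hD, hC0, hD0, h⟩ := exists_phi_eq_exp_mul v
  set l : ℝ → ℝ := fun t => Real.log (1 / t)
  have hl : ∀ t > 0, HasDerivAt l (-1 / t) t := fun t ht => by
    have h1 := (Real.hasDerivAt_log (inv_pos.2 ht).ne').comp t (hasDerivAt_inv ht.ne')
    have h2 : l = Real.log ∘ Inv.inv := by ext; simp [l]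
    rw [h2]
    refine h1.congr_deriv ?_
    field_simp
  have he : ∀ t > 0, HasDerivAt (fun t => Real.exp (l t / 4)) (Real.exp (l t / 4) * (-1 / t / 4)) t :=
    fun t ht => ((hl t ht).div_const 4).exp
  refine ⟨fun t => -(Real.exp (l t / 4) * (C (l t) / 4 + D (l t))), fun t ht => ?_, fun t ht => ?_,
    by simp [h, hC0], by norm_num [l, hC0, hD0]⟩
  · rw [funext h]
    refine ((he t ht).mul ((hC (l t)).comp t (hl t ht))).congr_deriv ?_
    have := ht.ne'
    simp only [l, Function.comp]
    field_simp
    ring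
  · refine ((he t ht).mul ((((hC (l t)).comp t (hl t ht)).div_const 4).add
      ((hD (l t)).comp t (hl t ht)))).neg.congr_deriv ?_
    have := ht.ne'
    rw [h t]
    simp only [l, Function.comp, Pi.add_apply]
    field_simp
    ring

/-! ### The asymptotics of the reciprocal moments -/

/-- The moments of the radial weight (with the value `0` for divergent ones). -/
def moment (f : ℝ → ℝ) (l : ℕ) : ℝ := ∫ x in Set.Ioo (0 : ℝ) 1, x ^ l * radialWeight f x

/-- The Taylor coefficients of the radial Bergman kernel, up to a constant. -/
def kernelCoeff (f : ℝ → ℝ) (l : ℕ) : ℝ := (2 * l + 1) / moment f l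

/-- The kernel coefficients that belong to `φ_v`. -/
def phiCoeff (v : ℝ) (l : ℕ) : ℝ := 2 * l ^ 2 + 3 * l + (9 - v) / 8

theorem uniqueDiffOn_Ioc_zero_one : UniqueDiffOn ℝ (Set.Ioc (0 : ℝ) 1) := uniqueDiffOn_Ioc 0 1

theorem one_mem_Ioc : (1 : ℝ) ∈ Set.Ioc (0 : ℝ) 1 := ⟨one_pos, le_rfl⟩

theorem nhdsLT_one_le : 𝓝[<] (1 : ℝ) ≤ 𝓝[Set.Ioc 0 1] 1 := by
  rw [← nhdsWithin_Ioo_eq_nhdsLT (one_pos : (0 : ℝ) < 1)]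
  exact nhdsWithin_mono _ Set.Ioo_subset_Ioc_self

theorem contDiffOn_iteratedDerivWithin_Ioc {f : ℝ → ℝ} (hf : ContDiffOn ℝ ∞ f (Set.Ioc 0 1))
    (k : ℕ) : ContDiffOn ℝ ∞ (iteratedDerivWithin k f (Set.Ioc 0 1)) (Set.Ioc 0 1) := by
  induction k with
  | zero => simpa using hf
  | succ k ih =>
    exact (ih.derivWithin uniqueDiffOn_Ioc_zero_one (m := ∞) (by simp)).congr fun x _ => by
      rw [iteratedDerivWithin_succ]

theorem contDiffOn_radialWeight {f : ℝ → ℝ} (hf : ContDiffOn ℝ ∞ f (Set.Ioc 0 1)) :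
    ContDiffOn ℝ ∞ (radialWeight f) (Set.Ioc 0 1) := by
  have h1 : ContDiffOn ℝ ∞ (derivWithin f (Set.Ioc 0 1)) (Set.Ioc 0 1) :=
    hf.derivWithin uniqueDiffOn_Ioc_zero_one (by simp)
  have h2 := contDiffOn_iteratedDerivWithin_Ioc hf 2
  have hid : ContDiffOn ℝ ∞ (fun t : ℝ => t) (Set.Ioc 0 1) := contDiffOn_id
  exact (hid.mul h1).mul (((hf.mul h1).add ((hid.mul hf).mul h2)).sub (hid.mul (h1.pow 2)))

theorem hasDerivWithinAt_iteratedDerivWithin {f : ℝ → ℝ} (hf : ContDiffOn ℝ ∞ f (Set.Ioc 0 1))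
    (k : ℕ) {t : ℝ} (ht : t ∈ Set.Ioc (0 : ℝ) 1) :
    HasDerivWithinAt (iteratedDerivWithin k f (Set.Ioc 0 1))
      (iteratedDerivWithin (k + 1) f (Set.Ioc 0 1) t) (Set.Ioc 0 1) t := by
  rw [iteratedDerivWithin_succ]
  exact (((contDiffOn_iteratedDerivWithin_Ioc hf k).differentiableOn (by simp)) t
    ht).hasDerivWithinAt

theorem radialWeight_one {f : ℝ → ℝ} (hf1 : f 1 = 0)
    (hf1' : derivWithin f (Set.Ioc 0 1) 1 = -1) : radialWeight f 1 = 1 := by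
  simp [radialWeight, hf1, hf1']

/-- The third derivative of f enters only with the factor f(1) = 0, so W'(1) is fixed by f''(1). It
vanishes exactly when f''(1) = 1/2. -/
theorem derivWithin_radialWeight_one {f : ℝ → ℝ} (hf : ContDiffOn ℝ ∞ f (Set.Ioc 0 1))
    (hf1 : f 1 = 0) (hf1' : derivWithin f (Set.Ioc 0 1) 1 = -1) :
    derivWithin (radialWeight f) (Set.Ioc 0 1) 1
      = 1 - 2 * iteratedDerivWithin 2 f (Set.Ioc 0 1) 1 := by
  have h0 := hasDerivWithinAt_iteratedDerivWithin hf 0 one_mem_Ioc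
  have h1 := hasDerivWithinAt_iteratedDerivWithin hf 1 one_mem_Ioc
  have h2 := hasDerivWithinAt_iteratedDerivWithin hf 2 one_mem_Ioc
  have hid := hasDerivWithinAt_id (1 : ℝ) (Set.Ioc 0 1)
  simp only [iteratedDerivWithin_zero, zero_add, iteratedDerivWithin_one] at h0 h1
  rw [hf1'] at h0
  have h := (hid.mul h1).mul (((h0.mul h1).add ((hid.mul h0).mul h2)).sub (hid.mul (h1.pow 2)))
  have hw := h.derivWithin (uniqueDiffOn_Ioc_zero_one 1 one_mem_Ioc)
  refine Eq.trans ?_ (hw.trans ?_)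
  · rfl
  · simp [hf1, hf1']
    ring

/-- Taylor's formula with the lower terms absent. The sign comes from (1-t)^j = (-1)^j (t-1)^j. -/
theorem tendsto_div_pow_of_jet {h : ℝ → ℝ} (hh : ContDiffOn ℝ ∞ h (Set.Ioc 0 1)) {j : ℕ}
    (hj : ∀ i < j, iteratedDerivWithin i h (Set.Ioc 0 1) 1 = 0) :
    Tendsto (fun t => h t / (1 - t) ^ j) (𝓝[<] 1)
      (𝓝 ((-1) ^ j * iteratedDerivWithin j h (Set.Ioc 0 1) 1 / j.factorial)) := by
  have h1 := (Real.taylor_tendsto (n := j) (convex_Ioc (0 : ℝ) 1) one_mem_Ioc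
    (hh.of_le (by exact_mod_cast le_top))).mono_left nhdsLT_one_le
  have h2 := (h1.const_mul ((-1) ^ j)).add_const
    ((-1) ^ j * iteratedDerivWithin j h (Set.Ioc 0 1) 1 / j.factorial)
  rw [mul_zero, zero_add] at h2
  refine h2.congr' ?_
  filter_upwards [self_mem_nhdsWithin] with t ht
  have ht1 : t - 1 ≠ 0 := by have : t < 1 := ht; linarith
  rw [taylor_within_apply, Finset.sum_range_succ, Finset.sum_eq_zero, zero_add,
    ← neg_sub t 1, neg_pow (t - 1)]
  · have : ((-1 : ℝ) ^ j) ≠ 0 := pow_ne_zero _ (by norm_num)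
    have h3 : ((-1 : ℝ) ^ j) * (-1) ^ j = 1 := by rw [← mul_pow]; norm_num
    simp only [smul_eq_mul]
    field_simp
    rw [sq, h3]
    ring
  · intro i hi
    rw [hj i (Finset.mem_range.1 hi), smul_zero]

/-- The moments of `φ_v` over `[1/2, 1]`, up to an exponentially small error. -/
theorem tendsto_phiCoeff_mul_integral (v : ℝ) (n : ℕ) :
    Tendsto (fun l : ℕ => (l : ℝ) ^ n * (phiCoeff v l * (∫ x in (1 / 2 : ℝ)..1, x ^ l * phi v x)
      - (2 * l + 1))) atTop (𝓝 0) := by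
  obtain ⟨q, hφ, hq, hφ1, hq1⟩ := exists_euler_system_phi v
  have hint : ∀ l : ℕ, phiCoeff v l * (∫ x in (1 / 2 : ℝ)..1, x ^ l * phi v x) - (2 * l + 1)
      = -((1 / 2) ^ (l + 1) * ((2 * l + 1) * phi v (1 / 2) - 2 * q (1 / 2))) := by
    intro l
    -- This primitive comes from integrating by parts twice: the Euler system cancels the terms in
    -- `q`. Its value at 1 is 2l+1, as φ_v(1) = 1 and q(1) = 0, and its value at 1/2 is
    -- exponentially small.
    have hder : ∀ x ∈ Set.uIcc (1 / 2 : ℝ) 1,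
        HasDerivAt (fun x => x ^ (l + 1) * ((2 * l + 1) * phi v x - 2 * q x))
          (phiCoeff v l * (x ^ l * phi v x)) x := by
      intro x hx
      rw [Set.uIcc_of_le (by norm_num)] at hx
      have hx0 : 0 < x := by linarith [hx.1]
      have h := (hasDerivAt_pow (l + 1) x).mul
        (((hφ x hx0).const_mul (2 * l + 1 : ℝ)).sub ((hq x hx0).const_mul 2))
      refine h.congr_deriv ?_
      simp only [phiCoeff, Nat.add_sub_cancel, pow_succ, Pi.sub_apply]
      push_cast
      field_simp
      ring
    have hcont : ContinuousOn (fun x => phiCoeff v l * (x ^ l * phi v x))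
        (Set.uIcc (1 / 2 : ℝ) 1) := by
      rw [Set.uIcc_of_le (by norm_num)]
      refine continuousOn_const.mul ((continuousOn_pow l).mul
        ((contDiffOn_phi v).continuousOn.mono fun x hx => ?_))
      have := hx.1
      simp only [Set.mem_Ioi]; linarith
    have := intervalIntegral.integral_eq_sub_of_hasDerivAt hder hcont.intervalIntegrable
    rw [intervalIntegral.integral_const_mul] at this
    rw [this, hφ1, hq1]
    simp
  have h1 := tendsto_pow_const_mul_const_pow_of_abs_lt_one (n + 1) (r := (1 / 2 : ℝ))
    (by rw [abs_of_pos] <;> norm_num)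
  have h2 := tendsto_pow_const_mul_const_pow_of_abs_lt_one n (r := (1 / 2 : ℝ))
    (by rw [abs_of_pos] <;> norm_num)
  have h3 := (h1.mul_const (-phi v (1 / 2))).add
    (h2.mul_const (-(1 / 2) * (phi v (1 / 2) - 2 * q (1 / 2))))
  rw [zero_mul, zero_mul, zero_add] at h3
  refine h3.congr fun l => ?_
  rw [hint]
  ring

variable {f : ℝ → ℝ}

theorem tendsto_nat_mul_moment (hf : ContDiffOn ℝ ∞ f (Set.Ioc 0 1)) (hf1 : f 1 = 0)
    (hf1' : derivWithin f (Set.Ioc 0 1) 1 = -1) {l₀ : ℕ}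
    (hint : IntegrableOn (fun x => x ^ l₀ * radialWeight f x) (Set.Ioo 0 1)) :
    Tendsto (fun l : ℕ => (l : ℝ) * moment f l) atTop (𝓝 1) := by
  have := tendsto_pow_mul_integral (j := 0) (κ := 1) hint ?_
  · simpa [moment] using this
  · have h1 := ((contDiffOn_radialWeight hf).continuousOn 1 one_mem_Ioc).tendsto.mono_left
      nhdsLT_one_le
    rw [radialWeight_one hf1 hf1'] at h1
    simpa using h1

theorem tendsto_phiCoeff_div_sq (v : ℝ) :
    Tendsto (fun l : ℕ => phiCoeff v l / (l : ℝ) ^ 2) atTop (𝓝 2) := by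
  have h1 : Tendsto (fun l : ℕ => (l : ℝ)⁻¹) atTop (𝓝 0) := tendsto_inv_atTop_nhds_zero_nat
  have h2 := (tendsto_const_nhds (x := (2 : ℝ))).add ((h1.const_mul 3).add
    ((h1.pow 2).const_mul ((9 - v) / 8)))
  simp only [mul_zero, ne_eq, OfNat.ofNat_ne_zero, not_false_eq_true, zero_pow, add_zero] at h2
  refine h2.congr' ?_
  filter_upwards [eventually_ge_atTop 1] with l hl
  have : (l : ℝ) ≠ 0 := by positivity
  simp only [phiCoeff]
  field_simp
  ring

/-- Agreement of the weight with `φ_v` to order `j` at `1` translates into agreement of the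
kernel coefficients. -/
theorem tendsto_kernelCoeff_sub_phiCoeff (hf : ContDiffOn ℝ ∞ f (Set.Ioc 0 1)) (hf1 : f 1 = 0)
    (hf1' : derivWithin f (Set.Ioc 0 1) 1 = -1) {l₀ : ℕ}
    (hint : IntegrableOn (fun x => x ^ l₀ * radialWeight f x) (Set.Ioo 0 1)) {v κ : ℝ} {j : ℕ}
    (hκ : Tendsto (fun t => (radialWeight f t - phi v t) / (1 - t) ^ j) (𝓝[<] 1) (𝓝 κ)) :
    Tendsto (fun l : ℕ => (l : ℝ) ^ j * (kernelCoeff f l - phiCoeff v l) / (l : ℝ) ^ 2) atTop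
      (𝓝 (-2 * (κ * j.factorial))) := by
  -- The cut-off at 1/2 avoids the possibly non-integrable growth of φ_v at 0 and leaves the germ at
  -- 1 unchanged.
  set φ₀ : ℝ → ℝ := Set.indicator (Set.Ioc (1 / 2) 1) (phi v)
  have hφ₀ : ∀ l : ℕ, IntegrableOn (fun x => x ^ l * φ₀ x) (Set.Ioo 0 1) := by
    intro l
    have h1 : (fun x => x ^ l * φ₀ x)
        = Set.indicator (Set.Ioc (1 / 2 : ℝ) 1) fun x => x ^ l * phi v x := by
      ext x; simp [φ₀, Set.indicator_apply]
    rw [h1]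
    refine Integrable.integrableOn ((integrable_indicator_iff measurableSet_Ioc).2 ?_)
    refine (ContinuousOn.integrableOn_Icc ?_).mono_set Set.Ioc_subset_Icc_self
    refine (continuousOn_pow l).mul ((contDiffOn_phi v).continuousOn.mono fun x hx => ?_)
    have := hx.1
    simp only [Set.mem_Ioi]; linarith
  have hφint : ∀ l : ℕ, ∫ x in Set.Ioo (0 : ℝ) 1, x ^ l * φ₀ x
      = ∫ x in (1 / 2 : ℝ)..1, x ^ l * phi v x := by
    intro l
    have h1 : (fun x => x ^ l * φ₀ x)
        = Set.indicator (Set.Ioc (1 / 2 : ℝ) 1) fun x => x ^ l * phi v x := by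
      ext x; simp [φ₀, Set.indicator_apply]
    rw [h1, ← integral_Ioc_eq_integral_Ioo, setIntegral_indicator measurableSet_Ioc,
      intervalIntegral.integral_of_le (by norm_num), Set.inter_eq_right.2]
    exact Set.Ioc_subset_Ioc_left (by norm_num)
  have hg : IntegrableOn (fun x => x ^ l₀ * (radialWeight f x - φ₀ x)) (Set.Ioo 0 1) :=
    (hint.sub (hφ₀ l₀)).congr (Eventually.of_forall fun x => by simp; ring)
  have hκ' : Tendsto (fun t => (radialWeight f t - φ₀ t) / (1 - t) ^ j) (𝓝[<] 1) (𝓝 κ) := by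
    refine hκ.congr' ?_
    filter_upwards [Ioo_mem_nhdsLT (show (1 / 2 : ℝ) < 1 by norm_num)] with t ht
    simp only [φ₀]
    rw [Set.indicator_of_mem (show t ∈ Set.Ioc (1 / 2 : ℝ) 1 from ⟨ht.1, ht.2.le⟩)]
  have hW := tendsto_pow_mul_integral hg hκ'
  have hm := tendsto_nat_mul_moment hf hf1 hf1' hint
  -- With p_l = `phiCoeff v l` and M_l the moment of the truncated φ_v, k_l - p_l = -[(p_l M_l -
  -- (2l+1)) + p_l (m_l - M_l)] / m_l. The first bracket is negligible, p_l / l² → 2, l m_l → 1, and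
  -- Watson's lemma gives l^{j+1} (m_l - M_l) → κ j!.
  have hlim := ((((tendsto_phiCoeff_mul_integral v j).mul
    tendsto_inv_atTop_nhds_zero_nat).add ((tendsto_phiCoeff_div_sq v).mul hW)).neg).div hm one_ne_zero
  rw [mul_zero, zero_add, div_one] at hlim
  rw [neg_mul]
  refine hlim.congr' ?_
  filter_upwards [eventually_ge_atTop 1, eventually_ge_atTop l₀, hm.eventually_ne one_ne_zero]
    with l hl hl₀ hml
  have hl' : (l : ℝ) ≠ 0 := by positivity
  have hsub : ∫ x in Set.Ioo (0 : ℝ) 1, x ^ l * (radialWeight f x - φ₀ x)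
      = moment f l - ∫ x in (1 / 2 : ℝ)..1, x ^ l * phi v x := by
    rw [← hφint, moment, ← integral_sub (integrableOn_pow_mul_of_le hl₀ hint) (hφ₀ l)]
    exact integral_congr_ae (Eventually.of_forall fun x => by ring)
  have hm0 : moment f l ≠ 0 := right_ne_zero_of_mul hml
  simp only [Pi.div_apply]
  rw [hsub, kernelCoeff]
  field_simp
  ring

/-! ### Comparison of the kernel series with the poles of `f⁻³` -/

/-- The polynomial is expanded in the basis (l+2 choose 2), l+1, 1, whose generating functions are
the pure poles at 1. In particular there is no logarithmic term. -/
theorem hasSum_phiCoeff (v : ℝ) {t : ℝ} (ht : t ∈ Set.Ioo (0 : ℝ) 1) :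
    HasSum (fun l => phiCoeff v l * t ^ l)
      (4 / (1 - t) ^ 3 - 3 / (1 - t) ^ 2 + ((9 - v) / 8 - 1) / (1 - t)) := by
  have h1 := hasSum_choose_mul_geometric_of_norm_lt_one 2 (r := t)
    (by rw [Real.norm_eq_abs, abs_of_pos ht.1]; exact ht.2)
  have h2 := hasSum_succ_mul_pow ⟨ht.1.le, ht.2⟩
  have h3 := hasSum_geometric_of_lt_one ht.1.le ht.2
  have h := ((h1.mul_left 4).sub (h2.mul_left 3)).add (h3.mul_left ((9 - v) / 8 - 1))
  have e : 4 * (1 / (1 - t) ^ (2 + 1)) - 3 * ((1 - t) ^ 2)⁻¹ + ((9 - v) / 8 - 1) * (1 - t)⁻¹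
      = 4 / (1 - t) ^ 3 - 3 / (1 - t) ^ 2 + ((9 - v) / 8 - 1) / (1 - t) := by
    simp only [div_eq_mul_inv]
    norm_num
  rw [e] at h
  refine h.congr_fun fun l => ?_
  rw [Nat.cast_choose_two]
  simp only [phiCoeff]
  push_cast
  ring

theorem isBigO_of_tendsto_pow_mul_div_sq {a : ℕ → ℝ} {j : ℕ} {d : ℝ} (hj : 1 ≤ j)
    (h : Tendsto (fun l : ℕ => (l : ℝ) ^ j * a l / (l : ℝ) ^ 2) atTop (𝓝 d)) :
    a =O[atTop] fun l : ℕ => (l : ℝ) ^ 1 := by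
  have h1 := (h.isBigO_one ℝ).mul (Asymptotics.isBigO_refl (fun l : ℕ => (l : ℝ) ^ 1) atTop)
  simp only [one_mul] at h1
  refine Asymptotics.IsBigO.trans (Asymptotics.IsBigO.of_bound 1 ?_) h1
  filter_upwards [eventually_ge_atTop 1] with l hl
  obtain ⟨k, rfl⟩ := Nat.exists_eq_add_of_le hj
  have hl0 : (l : ℝ) ≠ 0 := by positivity
  rw [one_mul, show (l : ℝ) ^ (1 + k) * a l / (l : ℝ) ^ 2 * (l : ℝ) ^ 1 = (l : ℝ) ^ k * a l by
    rw [pow_add]; field_simp, norm_mul]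
  refine le_mul_of_one_le_left (norm_nonneg _) ?_
  rw [norm_pow, Real.norm_natCast]
  exact one_le_pow₀ (by exact_mod_cast hl)

theorem tendsto_div_one_sub (hf : ContDiffOn ℝ ∞ f (Set.Ioc 0 1)) (hf1 : f 1 = 0)
    (hf1' : derivWithin f (Set.Ioc 0 1) 1 = -1) :
    Tendsto (fun t => f t / (1 - t)) (𝓝[<] 1) (𝓝 1) := by
  have := tendsto_div_pow_of_jet hf (j := 1) (by simpa using hf1)
  simpa [hf1'] using this

theorem tendsto_div_one_sub_second (hf : ContDiffOn ℝ ∞ f (Set.Ioc 0 1)) (hf1 : f 1 = 0)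
    (hf1' : derivWithin f (Set.Ioc 0 1) 1 = -1) :
    Tendsto (fun t => (f t / (1 - t) - 1) / (1 - t)) (𝓝[<] 1)
      (𝓝 (iteratedDerivWithin 2 f (Set.Ioc 0 1) 1 / 2)) := by
  have h1 := (Real.taylor_tendsto (n := 2) (convex_Ioc (0 : ℝ) 1) one_mem_Ioc
    (hf.of_le (WithTop.coe_le_coe.2 le_top))).mono_left nhdsLT_one_le
  have h2 := h1.add_const (iteratedDerivWithin 2 f (Set.Ioc 0 1) 1 / 2)
  rw [zero_add] at h2
  refine h2.congr' ?_
  filter_upwards [self_mem_nhdsWithin] with t ht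
  have ht1 : t - 1 ≠ 0 := by have : t < 1 := ht; linarith
  have ht2 : 1 - t ≠ 0 := by have : t < 1 := ht; linarith
  simp only [taylor_within_apply, Finset.sum_range_succ, Finset.sum_range_zero,
    iteratedDerivWithin_zero, iteratedDerivWithin_one, hf1, hf1', smul_eq_mul]
  norm_num
  rw [← neg_sub 1 t, neg_sq]
  field_simp
  ring

/-- The kernel series minus the one of `φ_v`, near `t = 1`. -/
theorem tsum_kernelCoeff_sub {c : ℝ} {ψ : ℝ → ℝ} {v : ℝ}
    (heq : ∀ᶠ t in 𝓝[<] 1, c / f t ^ 3 - ∑' l, kernelCoeff f l * t ^ l = ψ t)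
    (hO : (fun l => kernelCoeff f l - phiCoeff v l) =O[atTop] fun l : ℕ => (l : ℝ) ^ 1) :
    ∀ᶠ t in 𝓝[<] 1, ∑' l, (kernelCoeff f l - phiCoeff v l) * t ^ l
      = c / f t ^ 3 - ψ t
        - (4 / (1 - t) ^ 3 - 3 / (1 - t) ^ 2 + ((9 - v) / 8 - 1) / (1 - t)) := by
  filter_upwards [heq, Ioo_mem_nhdsLT (zero_lt_one : (0 : ℝ) < 1)] with t h1 ht
  have hB := hasSum_phiCoeff v ht
  have hE := summable_mul_pow_of_isBigO hO (t := t) (by rw [abs_of_pos ht.1]; exact ht.2)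
  have hA : Summable fun l => kernelCoeff f l * t ^ l :=
    (hE.add hB.summable).congr fun l => by ring
  rw [← h1, ← hB.tsum_eq, sub_sub_cancel, ← hA.tsum_sub hB.summable]
  exact tsum_congr fun l => by ring

/-- With a = f''(1), the poles of order three and two of the kernel series have coefficients 4 and
-4a - 1, while those of c f⁻³ are c and -3ac/2. Hence c = 4 and -4a - 1 = -6a. The reference
function φ_1 serves here because φ_v'(1) = 0 for every v. -/
theorem iteratedDerivWithin_two_eq_half (hf : ContDiffOn ℝ ∞ f (Set.Ioc 0 1)) (hf1 : f 1 = 0)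
    (hf1' : derivWithin f (Set.Ioc 0 1) 1 = -1) {l₀ : ℕ}
    (hint : IntegrableOn (fun x => x ^ l₀ * radialWeight f x) (Set.Ioo 0 1))
    {c : ℝ} {ψ : ℝ → ℝ} (hψ : HasExpansion ψ)
    (heq : ∀ᶠ t in 𝓝[<] 1, c / f t ^ 3 - ∑' l, kernelCoeff f l * t ^ l = ψ t)
    (hjet : Tendsto (fun t => (radialWeight f t - phi 1 t) / (1 - t) ^ 1) (𝓝[<] 1)
      (𝓝 (2 * iteratedDerivWithin 2 f (Set.Ioc 0 1) 1 - 1))) :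
    iteratedDerivWithin 2 f (Set.Ioc 0 1) 1 = 1 / 2 := by
  set a := iteratedDerivWithin 2 f (Set.Ioc 0 1) 1
  have hE := tendsto_kernelCoeff_sub_phiCoeff hf hf1 hf1' hint hjet
  have hO := isBigO_of_tendsto_pow_mul_div_sq le_rfl hE
  have hE' : Tendsto (fun l : ℕ => (kernelCoeff f l - phiCoeff 1 l) / ((l : ℝ) + 1)) atTop
      (𝓝 (-2 * (2 * a - 1))) := by
    have h1 := hE.mul (tendsto_natCast_div_add_atTop (𝕜 := ℝ) (1 : ℝ))
    simp only [Nat.factorial_one, Nat.cast_one, mul_one] at h1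
    refine h1.congr' ?_
    filter_upwards [eventually_ge_atTop 1] with l hl
    have hl0 : (l : ℝ) ≠ 0 := by positivity
    have hl1 : (l : ℝ) + 1 ≠ 0 := by positivity
    field_simp
  have hS := tendsto_one_sub_sq_mul_tsum hE'
  have hy : Tendsto (fun t : ℝ => 1 - t) (𝓝[<] 1) (𝓝 0) := by
    simpa using tendsto_one_sub_pow_nhdsLT 0
  have hψ0 : Tendsto (fun t : ℝ => (1 - t) ^ 2 * ψ t) (𝓝[<] 1) (𝓝 0) := by
    have := ((Asymptotics.isBigO_refl (fun t : ℝ => (1 - t) ^ 2) (𝓝[<] 1)).mul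
      hψ.isBigO_one)
    simp only [mul_one] at this
    exact this.trans_tendsto (tendsto_one_sub_pow_nhdsLT 1)
  set u : ℝ → ℝ := fun t => (f t / (1 - t))⁻¹
  have hw := tendsto_div_one_sub hf hf1 hf1'
  have hu : Tendsto u (𝓝[<] 1) (𝓝 1) := by
    have := hw.inv₀ one_ne_zero
    rwa [inv_one] at this
  have h1 : Tendsto (fun t => (c * u t ^ 3 - 4) / (1 - t)) (𝓝[<] 1) (𝓝 (-4 * a - 1)) := by
    have h2 := ((hS.add hψ0).sub_const 3).add (hy.const_mul ((9 - 1) / 8 - 1))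
    have e : -2 * (2 * a - 1) + 0 - 3 + ((9 - 1) / 8 - 1) * 0 = -4 * a - 1 := by ring
    rw [e] at h2
    refine h2.congr' ?_
    filter_upwards [tsum_kernelCoeff_sub heq hO, self_mem_nhdsWithin, hw.eventually_ne one_ne_zero]
      with t h3 ht hft
    have ht2 : 1 - t ≠ 0 := by have : t < 1 := ht; linarith
    have hf0 : f t ≠ 0 := fun h => hft (by simp [h])
    rw [h3]
    simp only [u]
    field_simp
    ring
  have hc : c = 4 := by
    have h2 := h1.mul hy
    rw [mul_zero] at h2
    have h3 : Tendsto (fun t => c * u t ^ 3 - 4) (𝓝[<] 1) (𝓝 (c * 1 ^ 3 - 4)) :=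
      ((hu.pow 3).const_mul c).sub_const 4
    have h4 := tendsto_nhds_unique (h2.congr' ?_) h3
    · linarith
    · filter_upwards [self_mem_nhdsWithin] with t ht
      have ht2 : 1 - t ≠ 0 := by have : t < 1 := ht; linarith
      field_simp
  have h5 := tendsto_div_one_sub_second hf hf1 hf1'
  have h6 : Tendsto (fun t => (c * u t ^ 3 - 4) / (1 - t)) (𝓝[<] 1)
      (𝓝 (-4 * (a / 2) * (1 + 1 + 1 ^ 2) * 1 ^ 3)) := by
    -- With w = f/(1-t), 4 (w⁻³ - 1) = -4 (w - 1)(1 + w + w²) w⁻³.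
    refine (((h5.const_mul (-4)).mul ((hw.const_add 1).add (hw.pow 2))).mul (hu.pow 3)).congr' ?_
    filter_upwards [self_mem_nhdsWithin, hw.eventually_ne one_ne_zero] with t ht hft
    have ht2 : 1 - t ≠ 0 := by have : t < 1 := ht; linarith
    have hf0 : f t ≠ 0 := fun h => hft (by simp [h])
    rw [hc]
    simp only [u]
    field_simp
    ring
  have := tendsto_nhds_unique h1 h6
  linarith

/-- The third power of 1 - t clears all poles, so (1-t)³ S has an expansion. Coefficients tending to
0 give (1-t) S → 0 by the Abelian theorem, which allows the three factors to be divided out again.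
-/
theorem hasExpansion_tsum_kernelCoeff_sub (hf : ContDiffOn ℝ ∞ f (Set.Ioc 0 1)) (hf1 : f 1 = 0)
    (hf1' : derivWithin f (Set.Ioc 0 1) 1 = -1)
    {c : ℝ} {ψ : ℝ → ℝ} (hψ : HasExpansion ψ) {v : ℝ}
    (heq : ∀ᶠ t in 𝓝[<] 1, c / f t ^ 3 - ∑' l, kernelCoeff f l * t ^ l = ψ t)
    (h0 : Tendsto (fun l => kernelCoeff f l - phiCoeff v l) atTop (𝓝 0)) :
    HasExpansion fun t => ∑' l, (kernelCoeff f l - phiCoeff v l) * t ^ l := by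
  have hO : (fun l => kernelCoeff f l - phiCoeff v l) =O[atTop] fun l : ℕ => (l : ℝ) ^ 1 := by
    refine (h0.isBigO_one ℝ).trans (Asymptotics.IsBigO.of_bound 1 ?_)
    filter_upwards [eventually_ge_atTop 1] with l hl
    simpa using hl
  have hS := tendsto_one_sub_mul_tsum h0
  have hy : Tendsto (fun t : ℝ => 1 - t) (𝓝[<] 1) (𝓝 0) := by
    simpa using tendsto_one_sub_pow_nhdsLT 0
  have hw := tendsto_div_one_sub hf hf1 hf1'
  set S : ℝ → ℝ := fun t => ∑' l, (kernelCoeff f l - phiCoeff v l) * t ^ l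
  have hfe : HasExpansion fun t => (f t / (1 - t))⁻¹ := by
    refine HasExpansion.inv ((hasExpansion_of_contDiffOn one_pos hf).div_one_sub ?_) one_ne_zero hw
    have := (hf.continuousOn 1 one_mem_Ioc).tendsto.mono_left nhdsLT_one_le
    rwa [hf1] at this
  have hN : HasExpansion fun t => (1 - t) ^ 3 * S t := by
    have h1 := ((((hasExpansion_polynomial (Polynomial.C c)).mul (hfe.mul (hfe.mul hfe))).sub
      ((hasExpansion_polynomial ((Polynomial.C 1 - Polynomial.X) ^ 3)).mul hψ)).sub
      (hasExpansion_polynomial (Polynomial.C 4 - Polynomial.C 3 * (Polynomial.C 1 - Polynomial.X)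
        + Polynomial.C ((9 - v) / 8 - 1) * (Polynomial.C 1 - Polynomial.X) ^ 2)))
    refine h1.congr ?_
    filter_upwards [tsum_kernelCoeff_sub heq hO, self_mem_nhdsWithin, hw.eventually_ne one_ne_zero]
      with t h3 ht hft
    have ht2 : 1 - t ≠ 0 := by have : t < 1 := ht; linarith
    have hf0 : f t ≠ 0 := fun h => hft (by simp [h])
    simp only [S]
    rw [h3]
    simp
    field_simp
  have hdiv : ∀ k : ℕ, HasExpansion (fun t => (1 - t) ^ (k + 1) * S t) →
      HasExpansion fun t => (1 - t) ^ k * S t := by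
    intro k hk
    refine (hk.div_one_sub ?_).congr ?_
    · have := (hy.pow k).mul hS
      rw [mul_zero] at this
      exact this.congr fun t => by simp only [S]; ring
    · filter_upwards [self_mem_nhdsWithin] with t ht
      have ht2 : 1 - t ≠ 0 := by have : t < 1 := ht; linarith
      rw [pow_succ]
      field_simp
  simpa using hdiv 0 (hdiv 1 (hdiv 2 hN))

/-- If the kernel series differs from a multiple of `f^{-3}` by a function with an expansion at
`1`, then the weight agrees with some `φ_v` to infinite order at `1`. -/
theorem exists_phi_add_flat (hf : ContDiffOn ℝ ∞ f (Set.Ioc 0 1)) (hf1 : f 1 = 0)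
    (hf1' : derivWithin f (Set.Ioc 0 1) 1 = -1)
    {c : ℝ} (hc : c ≠ 0) {ψ : ℝ → ℝ} (hψ : HasExpansion ψ)
    (heq : ∀ᶠ t in 𝓝[<] 1, c / f t ^ 3 - ∑' l, kernelCoeff f l * t ^ l = ψ t) :
    ∃ v : ℝ, ∃ h : ℝ → ℝ, ContDiffOn ℝ ∞ h (Set.Ioc 0 1) ∧
      (∀ k : ℕ, iteratedDerivWithin k h (Set.Ioc 0 1) 1 = 0) ∧
      ∀ t ∈ Set.Ioc (0 : ℝ) 1, radialWeight f t = phi v t + h t := by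
  have hw := tendsto_div_one_sub hf hf1 hf1'
  have hy : Tendsto (fun t : ℝ => 1 - t) (𝓝[<] 1) (𝓝 0) := by
    simpa using tendsto_one_sub_pow_nhdsLT 0
  obtain ⟨l₀, hint⟩ : ∃ l₀ : ℕ,
      IntegrableOn (fun x => x ^ l₀ * radialWeight f x) (Set.Ioo 0 1) := by
    -- If every moment diverged, all kernel coefficients would be 0 by convention, and c f⁻³ would
    -- be bounded near 1, contrary to its pole.
    by_contra! hno
    have h0 : ∀ l, kernelCoeff f l = 0 := fun l => by
      rw [kernelCoeff, moment, integral_undef (hno l), div_zero]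
    simp only [h0, zero_mul, tsum_zero, sub_zero] at heq
    have h1 := (hψ.isBigO_one.mul (Asymptotics.isBigO_refl (fun t : ℝ => (1 - t) ^ 3)
      (𝓝[<] 1)))
    simp only [one_mul] at h1
    have h2 := h1.trans_tendsto (tendsto_one_sub_pow_nhdsLT 2)
    have h3 : Tendsto (fun t => c * ((f t / (1 - t)) ^ 3)⁻¹) (𝓝[<] 1) (𝓝 (c * (1 ^ 3)⁻¹)) :=
      ((hw.pow 3).inv₀ (by norm_num)).const_mul c
    have h4 := tendsto_nhds_unique (h3.congr' ?_) h2
    · apply hc; simpa using h4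
    · filter_upwards [heq, self_mem_nhdsWithin] with t h5 ht
      rw [← h5]
      simp only [div_eq_mul_inv, mul_pow, mul_inv, inv_inv, inv_pow]
      ring
  set I : Set ℝ := Set.Ioc 0 1
  have hu := uniqueDiffOn_Ioc_zero_one
  have hWs := contDiffOn_radialWeight hf
  have hφs : ∀ v, ContDiffOn ℝ ∞ (phi v) I := fun v => (contDiffOn_phi v).mono fun x hx => hx.1
  have hφjet : ∀ v, phi v 1 = 1 ∧ iteratedDerivWithin 1 (phi v) I 1 = 0 ∧
      iteratedDerivWithin 2 (phi v) I 1 = (v - 1) / 16 := by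
    intro v
    obtain ⟨q, hφ, hq, hφ1, hq1⟩ := exists_euler_system_phi v
    have hd : ∀ t ∈ I, iteratedDerivWithin 1 (phi v) I t = q t / t := fun t ht => by
      rw [iteratedDerivWithin_one]
      exact (hφ t ht.1).hasDerivWithinAt.derivWithin (hu t ht)
    refine ⟨hφ1, by rw [hd 1 one_mem_Ioc, hq1, zero_div], ?_⟩
    rw [iteratedDerivWithin_succ, derivWithin_congr hd (hd 1 one_mem_Ioc)]
    have h1 := ((hq 1 one_pos).div (hasDerivAt_id 1) one_ne_zero).hasDerivWithinAt (s := I)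
    refine (h1.derivWithin (hu 1 one_mem_Ioc)).trans ?_
    simp [hq1, hφ1]
    ring
  have hsub : ∀ v k, iteratedDerivWithin k (fun t => radialWeight f t - phi v t) I 1
      = iteratedDerivWithin k (radialWeight f) I 1 - iteratedDerivWithin k (phi v) I 1 := by
    intro v k
    exact iteratedDerivWithin_sub one_mem_Ioc hu
      ((hWs 1 one_mem_Ioc).of_le (by exact_mod_cast le_top))
      ((hφs v 1 one_mem_Ioc).of_le (by exact_mod_cast le_top))
  have hz : ∀ v, iteratedDerivWithin 0 (fun t => radialWeight f t - phi v t) I 1 = 0 := by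
    intro v
    simp [radialWeight_one hf1 hf1', (hφjet v).1]
  have hW1 := derivWithin_radialWeight_one hf hf1 hf1'
  have ha : iteratedDerivWithin 2 f I 1 = 1 / 2 := by
    refine iteratedDerivWithin_two_eq_half hf hf1 hf1' hint hψ heq ?_
    have h1 := tendsto_div_pow_of_jet (hWs.sub (hφs 1)) (j := 1) (fun i hi => by
      obtain rfl : i = 0 := by omega
      exact hz 1)
    have h2 := hsub 1 1
    rw [(hφjet 1).2.1, iteratedDerivWithin_one (f := radialWeight f), hW1, sub_zero] at h2
    rw [h2] at h1
    convert h1 using 2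
    simp
  -- Solves φ_v''(1) = (v-1)/16 = W''(1).
  set v : ℝ := 16 * iteratedDerivWithin 2 (radialWeight f) I 1 + 1
  have hone : iteratedDerivWithin 1 (fun t => radialWeight f t - phi v t) I 1 = 0 := by
    rw [hsub, (hφjet v).2.1, iteratedDerivWithin_one, hW1, ha]
    norm_num
  have htwo : iteratedDerivWithin 2 (fun t => radialWeight f t - phi v t) I 1 = 0 := by
    rw [hsub, (hφjet v).2.2]
    simp only [v]
    ring
  have hlow : ∀ i < 3, iteratedDerivWithin i (fun t => radialWeight f t - phi v t) I 1 = 0 := by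
    intro i hi
    interval_cases i
    exacts [hz v, hone, htwo]
  have hlim : ∀ j, (∀ i < j, iteratedDerivWithin i (fun t => radialWeight f t - phi v t) I 1 = 0) →
      Tendsto (fun l : ℕ => (l : ℝ) ^ j * (kernelCoeff f l - phiCoeff v l) / (l : ℝ) ^ 2) atTop
        (𝓝 (-2 * ((-1) ^ j * iteratedDerivWithin j (fun t => radialWeight f t - phi v t) I 1))) := by
    intro j hj
    have h1 := tendsto_kernelCoeff_sub_phiCoeff hf hf1 hf1' hint
      (tendsto_div_pow_of_jet (hWs.sub (hφs v)) hj)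
    rw [div_mul_cancel₀ _ (by positivity)] at h1
    exact h1
  have hE0 : Tendsto (fun l => kernelCoeff f l - phiCoeff v l) atTop (𝓝 0) := by
    have h1 := (hlim 3 hlow).mul tendsto_inv_atTop_nhds_zero_nat
    rw [mul_zero] at h1
    refine h1.congr' ?_
    filter_upwards [eventually_ge_atTop 1] with l hl
    have hl0 : (l : ℝ) ≠ 0 := by positivity
    field_simp
  have hexp := hasExpansion_tsum_kernelCoeff_sub hf hf1 hf1' hψ heq hE0
  refine ⟨v, fun t => radialWeight f t - phi v t, hWs.sub (hφs v), fun k => ?_,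
    fun t _ => by ring⟩
  induction k using Nat.strong_induction_on with
  | _ j ih =>
    rcases lt_or_ge j 3 with hj | hj
    · exact hlow j hj
    · have h1 := hlim j ih
      -- A first discrepancy of the jets at order j gives a leading term of order l^{2-j}. It is
      -- excluded because the difference series has an expansion.
      have h2 : Tendsto (fun l : ℕ => (l : ℝ) ^ (j - 2) * (kernelCoeff f l - phiCoeff v l)) atTop
          (𝓝 (-2 * ((-1) ^ j *
            iteratedDerivWithin j (fun t => radialWeight f t - phi v t) I 1))) := by
        refine h1.congr' ?_
        filter_upwards [eventually_ge_atTop 1] with l hl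
        have hl0 : (l : ℝ) ≠ 0 := by positivity
        rw [pow_sub₀ _ hl0 (by omega)]
        field_simp
      have h3 := limit_eq_zero_of_hasExpansion hexp h2
      have h4 : ((-1 : ℝ) ^ j) ≠ 0 := pow_ne_zero _ (by norm_num)
      simpa [h4] using h3

/-! ### The volume density of a radial potential -/

/-- The squared Euclidean norm on `ℂ²`. -/
def sqNorm (w : ℂ × ℂ) : ℝ := ‖w.1‖ ^ 2 + ‖w.2‖ ^ 2

theorem continuous_sqNorm : Continuous sqNorm := by unfold sqNorm; fun_prop

theorem sqNorm_nonneg (w : ℂ × ℂ) : 0 ≤ sqNorm w := by unfold sqNorm; positivity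

theorem sqNorm_pos {w : ℂ × ℂ} (hw : w ≠ 0) : 0 < sqNorm w := by
  refine (sqNorm_nonneg w).lt_of_ne' fun h => hw ?_
  have h1 : ‖w.1‖ ^ 2 = 0 := by unfold sqNorm at h; nlinarith [sq_nonneg ‖w.1‖, sq_nonneg ‖w.2‖]
  have h2 : ‖w.2‖ ^ 2 = 0 := by unfold sqNorm at h; nlinarith [sq_nonneg ‖w.1‖, sq_nonneg ‖w.2‖]
  exact Prod.ext (by simpa using h1) (by simpa using h2)

theorem norm_cover_sq (w : ℂ × ℂ) : ‖cover w‖ ^ 2 = 2 * sqNorm w ^ 2 := by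
  rw [EuclideanSpace.norm_sq_eq, Fin.sum_univ_three]
  simp only [cover, sqNorm, Complex.sq_norm, Complex.normSq_apply]
  simp [pow_two]
  ring

theorem cover_mem_manifold {w : ℂ × ℂ} (hw : w ≠ 0) : cover w ∈ manifold := by
  rw [← cover_image]; exact ⟨w, hw, rfl⟩

theorem cover_zero : cover 0 = 0 := by
  ext i; fin_cases i <;> simp [cover]

theorem mem_preimage_ball {w : ℂ × ℂ} :
    w ∈ cover ⁻¹' ball ↔ w ≠ 0 ∧ 2 * sqNorm w ^ 2 < 1 := by
  rw [← norm_cover_sq]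
  constructor
  · rintro ⟨⟨h1, h2⟩, h3⟩
    refine ⟨fun h => h2 (by rw [h, cover_zero]), ?_⟩
    exact pow_lt_one₀ (norm_nonneg _) h3 two_ne_zero
  · rintro ⟨h1, h2⟩
    exact ⟨cover_mem_manifold h1, by
      by_contra! h
      exact absurd h2 (not_lt.2 (one_le_pow₀ h))⟩

theorem hasFDerivAt_sqNorm (w : ℂ × ℂ) : ∃ D : ℂ × ℂ →L[ℝ] ℝ, HasFDerivAt sqNorm D w ∧
    ∀ e, D e = 2 * (conj w.1 * e.1 + conj w.2 * e.2).re := by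
  have h1 := (hasFDerivAt_fst (𝕜 := ℝ) (p := w)).norm_sq
  have h2 := (hasFDerivAt_snd (𝕜 := ℝ) (p := w)).norm_sq
  refine ⟨_, h1.add h2, fun e => ?_⟩
  simp [Complex.inner]
  ring

theorem deltaBar_radial {H : ℝ → ℝ} {H₁ : ℝ} {w : ℂ × ℂ} (hH : HasDerivAt H H₁ (sqNorm w))
    (k : Fin 2) :
    deltaBar (stdVec k) (fun x => ((H (sqNorm x) : ℝ) : ℂ)) w = H₁ * ![w.1, w.2] k := by
  obtain ⟨D, hD, hDe⟩ := hasFDerivAt_sqNorm w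
  have h := (Complex.ofRealCLM.hasFDerivAt).comp w (hH.comp_hasFDerivAt w hD)
  have h' : fderiv ℝ (fun x => ((H (sqNorm x) : ℝ) : ℂ)) w
    = Complex.ofRealCLM.comp (H₁ • D) := h.fderiv
  rw [deltaBar, h']
  fin_cases k
  all_goals
    simp [stdVec, hDe]
    apply Complex.ext <;> simp <;> ring

theorem delta_mul_radial {H : ℝ → ℝ} {H₁ : ℝ} {w : ℂ × ℂ} (hH : HasDerivAt H H₁ (sqNorm w))
    (j k : Fin 2) :
    delta (stdVec j) (fun x => ((H (sqNorm x) : ℝ) : ℂ) * ![x.1, x.2] k) w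
      = H₁ * conj (![w.1, w.2] j) * ![w.1, w.2] k + if j = k then (H (sqNorm w) : ℂ) else 0 := by
  obtain ⟨D, hD, hDe⟩ := hasFDerivAt_sqNorm w
  have h := (Complex.ofRealCLM.hasFDerivAt).comp w (hH.comp_hasFDerivAt w hD)
  have hk : ∃ P : ℂ × ℂ →L[ℝ] ℂ, HasFDerivAt (fun x : ℂ × ℂ => ![x.1, x.2] k) P w ∧
      ∀ e, P e = ![e.1, e.2] k := by
    fin_cases k
    · exact ⟨_, hasFDerivAt_fst, fun e => rfl⟩
    · exact ⟨_, hasFDerivAt_snd, fun e => rfl⟩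
  obtain ⟨P, hP, hPe⟩ := hk
  have h2 := h.mul hP
  have h' : fderiv ℝ (fun x => ((H (sqNorm x) : ℝ) : ℂ) * ![x.1, x.2] k) w = _ := h2.fderiv
  rw [delta, h']
  simp only [add_apply, smul_apply, hPe,
    ContinuousLinearMap.comp_apply, hDe, Complex.ofRealCLM_apply, Function.comp, smul_eq_mul]
  fin_cases j <;> fin_cases k
  all_goals
    simp [stdVec]
    apply Complex.ext <;> simp <;> ring

/-- The Hessian is H' times the identity plus a rank one matrix of trace |w|² H'', so its
eigenvalues are H' and H' + |w|² H''. -/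
theorem complexHessian_radial_det {H H₁ : ℝ → ℝ} {H₂ : ℝ} {w : ℂ × ℂ}
    (hH : ∀ᶠ s in 𝓝 (sqNorm w), HasDerivAt H (H₁ s) s) (hH₁ : HasDerivAt H₁ H₂ (sqNorm w)) :
    (complexHessian (fun x => H (sqNorm x)) w).det
      = ((H₁ (sqNorm w) * (H₁ (sqNorm w) + sqNorm w * H₂) : ℝ) : ℂ) := by
  have hent : ∀ j k, complexHessian (fun x => H (sqNorm x)) w j k
      = H₂ * conj (![w.1, w.2] j) * ![w.1, w.2] k + if j = k then (H₁ (sqNorm w) : ℂ) else 0 := by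
    intro j k
    rw [← delta_mul_radial hH₁ j k]
    have hev : (deltaBar (stdVec k) fun x => ((H (sqNorm x) : ℝ) : ℂ))
        =ᶠ[𝓝 w] fun x => ((H₁ (sqNorm x) : ℝ) : ℂ) * ![x.1, x.2] k := by
      filter_upwards [continuous_sqNorm.continuousAt.eventually hH] with x hx
      exact deltaBar_radial hx k
    simp only [complexHessian, Matrix.of_apply, delta]
    rw [hev.fderiv_eq]
  rw [Matrix.det_fin_two, hent, hent, hent, hent]
  have hs : ∀ z : ℂ, conj z * z = ((‖z‖ ^ 2 : ℝ) : ℂ) := fun z => by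
    rw [mul_comm, Complex.mul_conj, Complex.normSq_eq_norm_sq]
  have e1 := hs w.1
  have e2 := hs w.2
  simp only [sqNorm] at *
  simp
  push_cast at e1 e2 ⊢
  linear_combination (H₁ (‖w.1‖ ^ 2 + ‖w.2‖ ^ 2) * H₂ : ℂ) * (e1 + e2)

/-- With t = 2s² and H = -log f(t), s H' = -2 t f'/f and d/ds = 4s d/dt, so H' (sH')' = 16 t (f'/f)
(t f'/f)'. The factor 2 f³ then gives 32 W. -/
theorem volumeDensity_radial {f : ℝ → ℝ} (hf : ContDiffOn ℝ ∞ f (Set.Ioc 0 1))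
    (hpos : ∀ t ∈ Set.Ioo (0 : ℝ) 1, 0 < f t) {w : ℂ × ℂ} (hw : w ∈ cover ⁻¹' ball) :
    volumeDensity (fun z => f (‖z‖ ^ 2)) w = 32 * radialWeight f (2 * sqNorm w ^ 2) := by
  obtain ⟨hw0, hw1⟩ := mem_preimage_ball.1 hw
  have hs0 := sqNorm_pos hw0
  set s := sqNorm w with hs
  set f₁ := derivWithin f (Set.Ioc 0 1)
  set f₂ := iteratedDerivWithin 2 f (Set.Ioc 0 1)
  have hder : ∀ k, ∀ t ∈ Set.Ioo (0 : ℝ) 1, HasDerivAt (iteratedDerivWithin k f (Set.Ioc 0 1))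
      (iteratedDerivWithin (k + 1) f (Set.Ioc 0 1) t) t := fun k t ht =>
    (hasDerivWithinAt_iteratedDerivWithin hf k ⟨ht.1, ht.2.le⟩).hasDerivAt
      (mem_of_superset (isOpen_Ioo.mem_nhds ht) Set.Ioo_subset_Ioc_self)
  have hf1 : ∀ t ∈ Set.Ioo (0 : ℝ) 1, HasDerivAt f (f₁ t) t := by
    simpa [iteratedDerivWithin_one] using hder 0
  have hf2 : ∀ t ∈ Set.Ioo (0 : ℝ) 1, HasDerivAt f₁ (f₂ t) t := by
    intro t ht
    have h := hder 1 t ht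
    have e : iteratedDerivWithin 1 f (Set.Ioc 0 1) = f₁ := by
      ext x; rw [iteratedDerivWithin_one]
    rwa [e] at h
  have hsq : ∀ s : ℝ, HasDerivAt (fun s : ℝ => 2 * s ^ 2) (4 * s) s := fun s => by
    refine ((hasDerivAt_pow 2 s).const_mul 2).congr_deriv ?_
    norm_num; ring
  have hH : ∀ᶠ r in 𝓝 s, HasDerivAt (fun r => Real.log (1 / f (2 * r ^ 2)))
      (-(4 * r * f₁ (2 * r ^ 2) / f (2 * r ^ 2))) r := by
    have ho : ∀ᶠ r in 𝓝 s, 0 < r ∧ 2 * r ^ 2 < 1 := by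
      refine (lt_mem_nhds hs0).and ?_
      have : ContinuousAt (fun r : ℝ => 2 * r ^ 2) s := by fun_prop
      exact this.eventually (gt_mem_nhds hw1)
    filter_upwards [ho] with r hr
    have hr2 : 2 * r ^ 2 ∈ Set.Ioo (0 : ℝ) 1 := ⟨by have := hr.1; positivity, hr.2⟩
    have h1 := (((hf1 _ hr2).comp r (hsq r)).log (hpos _ hr2).ne').neg
    have e : (fun r => Real.log (1 / f (2 * r ^ 2)))
        = -fun y => Real.log ((f ∘ fun s => 2 * s ^ 2) y) := by
      ext x; simp
    rw [e]
    refine h1.congr_deriv ?_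
    simp only [Function.comp]
    ring
  have ht : 2 * s ^ 2 ∈ Set.Ioo (0 : ℝ) 1 := ⟨by positivity, hw1⟩
  have hft := (hpos _ ht).ne'
  have hH1 := ((((hasDerivAt_id s).const_mul 4).mul ((hf2 _ ht).comp s (hsq s))).div
    ((hf1 _ ht).comp s (hsq s)) hft).neg
  have hdet := complexHessian_radial_det (w := w) (H := fun r => Real.log (1 / f (2 * r ^ 2)))
    (H₁ := fun r => -(4 * r * f₁ (2 * r ^ 2) / f (2 * r ^ 2))) hH hH1
  rw [volumeDensity]
  simp only [norm_cover_sq]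
  rw [hdet, Complex.ofReal_re, ← hs]
  simp only [radialWeight, Function.comp, id]
  change f (2 * s ^ 2) ^ 3 * (2 * _) = 32 * (2 * s ^ 2 * f₁ (2 * s ^ 2) *
    (f (2 * s ^ 2) * f₁ (2 * s ^ 2) + 2 * s ^ 2 * f (2 * s ^ 2) * f₂ (2 * s ^ 2)
      - 2 * s ^ 2 * f₁ (2 * s ^ 2) ^ 2))
  simp only [Pi.mul_apply]
  field_simp
  simp only [Function.comp]
  ring

/-! ### Rotation invariant measures -/

/-- The measure on `ℂ²` with density `Q(|w|²)`. -/
def radialMeasure (Q : ℝ → ℝ≥0∞) : Measure (ℂ × ℂ) := volume.withDensity fun w => Q (sqNorm w)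

instance (Q : ℝ → ℝ≥0∞) : SFinite (radialMeasure Q) := by
  unfold radialMeasure; infer_instance

/-- The action of the torus on `ℂ²`. -/
def torusRotation (a b : ℝ) (w : ℂ × ℂ) : ℂ × ℂ :=
  (Complex.exp (a * Complex.I) * w.1, Complex.exp (b * Complex.I) * w.2)

theorem sqNorm_torusRotation (a b : ℝ) (w : ℂ × ℂ) : sqNorm (torusRotation a b w) = sqNorm w := by
  simp [sqNorm, torusRotation, Complex.norm_exp_ofReal_mul_I]

theorem measurePreserving_torusRotation {Q : ℝ → ℝ≥0∞} (hQ : Measurable Q) (a b : ℝ) :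
    MeasurePreserving (torusRotation a b) (radialMeasure Q) (radialMeasure Q) := by
  have hrot : ∀ c : ℝ, MeasurePreserving (fun z : ℂ => Complex.exp (c * Complex.I) * z) := by
    intro c
    have h := (rotation (Circle.exp c)).measurePreserving
    have e : ⇑(rotation (Circle.exp c)) = fun z : ℂ => Complex.exp (c * Complex.I) * z := by
      ext z; rw [rotation_apply, Circle.coe_exp]
    rwa [e] at h
  have hv : MeasurePreserving (torusRotation a b) volume volume := (hrot a).prod (hrot b)
  have hQm : Measurable fun w => Q (sqNorm w) := hQ.comp continuous_sqNorm.measurable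
  refine ⟨hv.measurable, ?_⟩
  ext s hs
  rw [Measure.map_apply hv.measurable hs, radialMeasure, withDensity_apply _ (hv.measurable hs),
    withDensity_apply _ hs, ← hv.setLIntegral_comp_preimage hs hQm]
  simp only [sqNorm_torusRotation]

/-- Fubini on the product with the circle. Integrability there holds because (θ, w) ↦ (θ, R_θ w)
preserves the product measure. -/
theorem integral_average_of_invariant {X : Type*} [MeasurableSpace X] {ν : Measure X} [SFinite ν]
    {R : ℝ → X → X} (hR : Measurable (Function.uncurry R))
    (hp : ∀ θ, MeasurePreserving (R θ) ν ν) {F : X → ℂ} (hF : Integrable F ν) :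
    Integrable (fun w => (2 * Real.pi)⁻¹ • ∫ θ in (0 : ℝ)..2 * Real.pi, F (R θ w)) ν ∧
    ∫ w, ((2 * Real.pi)⁻¹ • ∫ θ in (0 : ℝ)..2 * Real.pi, F (R θ w)) ∂ν = ∫ w, F w ∂ν := by
  set m : Measure ℝ := volume.restrict (Set.Ioc 0 (2 * Real.pi))
  have hskew : MeasurePreserving (fun p : ℝ × X => (p.1, R p.1 p.2)) (m.prod ν) (m.prod ν) :=
    (MeasurePreserving.id m).skew_product hR (Eventually.of_forall fun θ => (hp θ).map_eq)
  have hint : Integrable (Function.uncurry fun θ w => F (R θ w)) (m.prod ν) :=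
    hskew.integrable_comp_of_integrable (hF.comp_snd m)
  have h2 : (0 : ℝ) ≤ 2 * Real.pi := by positivity
  simp only [intervalIntegral.integral_of_le h2]
  refine ⟨hint.integral_prod_right.fun_smul _, ?_⟩
  rw [integral_smul, ← integral_integral_swap hint]
  have hc : ∀ θ, ∫ w, F (R θ w) ∂ν = ∫ w, F w ∂ν := by
    intro θ
    have h1 := (hp θ).map_eq
    conv_rhs => rw [← h1]
    rw [integral_map (hp θ).measurable.aemeasurable]
    rw [h1]; exact hF.aestronglyMeasurable
  simp only [hc]
  rw [integral_const, smul_smul]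
  simp only [m, measureReal_restrict_apply_univ, Real.volume_real_Ioc_of_le h2, sub_zero]
  rw [inv_mul_cancel₀ (by positivity), one_smul]

/-- The set w₁ = 0 is null, so averages need to be computed only where the point (w₁², i w₁², 0) is
not the origin. -/
theorem ae_radialMeasure_of_forall {Q : ℝ → ℝ≥0∞} (hQ : Measurable Q)
    (hsupp : ∀ s, ¬ 2 * s ^ 2 < 1 → Q s = 0) {p : ℂ × ℂ → Prop}
    (hp : ∀ w ∈ cover ⁻¹' ball, w.1 ≠ 0 → p w) : ∀ᵐ w ∂radialMeasure Q, p w := by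
  have hnull : ∀ᵐ w : ℂ × ℂ, w.1 ≠ 0 := by
    have : {w : ℂ × ℂ | ¬ w.1 ≠ 0} = {0} ×ˢ Set.univ := by ext w; simp
    rw [ae_iff, this, Measure.volume_eq_prod, Measure.prod_prod]
    simp
  have hQm : Measurable fun w => Q (sqNorm w) := hQ.comp continuous_sqNorm.measurable
  rw [radialMeasure, ae_withDensity_iff hQm]
  filter_upwards [hnull] with w hw hQw
  refine hp w (mem_preimage_ball.2 ⟨fun h => hw (by simp [h]), ?_⟩) hw
  by_contra h
  exact hQw (hsupp _ h)

/-! ### Holomorphic functions on the ball -/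

theorem IsHolomorphicOn.differentiableAt_comp {M : Set Amb} {g : Amb → ℂ}
    (hg : IsHolomorphicOn M g) {E : Type*} [NormedAddCommGroup E] [NormedSpace ℂ E] {T : E → Amb}
    {x : E} (hT : DifferentiableAt ℂ T x) (hx : ∀ᶠ x' in 𝓝 x, T x' ∈ M) :
    DifferentiableAt ℂ (fun x => g (T x)) x := by
  obtain ⟨V, hV, hxV, G, hG, hGg⟩ := hg (T x) hx.self_of_nhds
  have h1 : DifferentiableAt ℂ (fun x => G (T x)) x :=
    (hG.differentiableAt (hV.mem_nhds hxV)).comp x hT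
  refine h1.congr_of_eventuallyEq ?_
  filter_upwards [hx, hT.continuousAt.eventually (hV.mem_nhds hxV)] with x' h2 h3
  exact (hGg _ ⟨h3, h2⟩).symm

theorem differentiable_cover : Differentiable ℂ cover := by
  refine (differentiable_euclidean).2 fun i => ?_
  fin_cases i <;> simp [cover] <;> fun_prop

theorem isOpen_preimage_ball : IsOpen (cover ⁻¹' ball) := by
  have : cover ⁻¹' ball = {w | w ≠ 0} ∩ {w | 2 * sqNorm w ^ 2 < 1} := by
    ext w; exact mem_preimage_ball
  rw [this]
  refine isOpen_ne.inter (isOpen_lt ?_ continuous_const)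
  have := continuous_sqNorm
  fun_prop

theorem IsHolomorphicOn.differentiableOn_cover {g : Amb → ℂ} (hg : IsHolomorphicOn ball g) :
    DifferentiableOn ℂ (fun w => g (cover w)) (cover ⁻¹' ball) := fun w hw =>
  (hg.differentiableAt_comp (differentiable_cover w)
    (isOpen_preimage_ball.mem_nhds hw)).differentiableWithinAt

/-- The point `(q, iq, 0)` of the Kepler manifold. -/
def nullPoint (q : ℂ) : Amb := !₂[q, Complex.I * q, 0]

theorem cover_fst (a : ℂ) : cover (a, 0) = nullPoint (a ^ 2) := by
  ext i; fin_cases i <;> simp [cover, nullPoint]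

theorem norm_nullPoint_sq (q : ℂ) : ‖nullPoint q‖ ^ 2 = 2 * ‖q‖ ^ 2 := by
  rw [EuclideanSpace.norm_sq_eq, Fin.sum_univ_three]
  simp [nullPoint]; ring

theorem nullPoint_mem_ball {q : ℂ} (h0 : q ≠ 0) (h1 : ‖q‖ < √(1 / 2)) : nullPoint q ∈ ball := by
  refine ⟨⟨?_, fun h => h0 ?_⟩, ?_⟩
  · rw [Fin.sum_univ_three]
    simp [nullPoint]
    linear_combination q ^ 2 * Complex.I_sq
  · have := congrArg (fun z : Amb => z 0) h
    simpa [nullPoint] using this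
  · have h2 : ‖q‖ ^ 2 < 1 / 2 := by
      rw [← Real.lt_sqrt (norm_nonneg _)]; exact h1
    have h3 := norm_nullPoint_sq q
    by_contra! h4
    have := one_le_pow₀ h4 (n := 2)
    linarith

theorem differentiable_nullPoint : Differentiable ℂ nullPoint := by
  refine (differentiable_euclidean).2 fun i => ?_
  fin_cases i <;> (simp [nullPoint]; try fun_prop)

theorem diffContOnCl_slice {g : Amb → ℂ} (hg : IsHolomorphicOn ball g) {a : ℂ} {r : ℝ}
    (ha : a ≠ 0) (h : 2 * (‖a‖ ^ 2 + r ^ 2) ^ 2 < 1) :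
    DiffContOnCl ℂ (fun b => g (cover (a, b))) (Metric.ball 0 |r|) := by
  refine DifferentiableOn.diffContOnCl fun b hb => ?_
  have hb' : ‖b‖ ≤ |r| := by
    simpa using Metric.closure_ball_subset_closedBall hb
  have hmem : (a, b) ∈ cover ⁻¹' ball := by
    refine mem_preimage_ball.2 ⟨fun h => ha (by simpa using congrArg Prod.fst h), lt_of_le_of_lt ?_ h⟩
    have hb2 : ‖b‖ ^ 2 ≤ r ^ 2 := by rw [← sq_abs r]; gcongr
    simp only [sqNorm]
    gcongr
  refine DifferentiableAt.differentiableWithinAt ?_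
  have hmk : DifferentiableAt ℂ (fun b : ℂ => (a, b)) b := by fun_prop
  exact ((hg.differentiableOn_cover).differentiableAt (isOpen_preimage_ball.mem_nhds hmem)).comp b hmk

/-- Hartogs' theorem on the line `z = (q, iq, 0)`: the restriction extends over the origin. -/
theorem IsHolomorphicOn.exists_extension {g : Amb → ℂ} (hg : IsHolomorphicOn ball g) :
    ∃ G : ℂ → ℂ, DifferentiableOn ℂ G (Metric.ball 0 √(1 / 2)) ∧
      ∀ q, q ≠ 0 → G q = g (nullPoint q) := by
  have hd : DifferentiableOn ℂ (fun q => g (nullPoint q)) (Metric.ball 0 √(1 / 2) \ {0}) := by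
    intro q hq
    refine (hg.differentiableAt_comp (differentiable_nullPoint q) ?_).differentiableWithinAt
    have ho : IsOpen (Metric.ball (0 : ℂ) √(1 / 2) \ {0}) :=
      Metric.isOpen_ball.sdiff isClosed_singleton
    filter_upwards [ho.mem_nhds hq] with q' hq'
    exact nullPoint_mem_ball hq'.2 (by simpa using hq'.1)
  -- The maximum principle in b bounds g(cover (a, 0)) by values on |b| = 1/2. These points stay in
  -- a compact set away from the origin, uniformly in a.
  obtain ⟨C, hC⟩ : ∃ C, ∀ a : ℂ, a ≠ 0 → ‖a‖ ≤ 1 / 2 → ‖g (cover (a, 0))‖ ≤ C := by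
    have hK : IsCompact (Metric.closedBall (0 : ℂ) (1 / 2) ×ˢ Metric.sphere (0 : ℂ) (1 / 2)) :=
      (isCompact_closedBall _ _).prod (isCompact_sphere _ _)
    have hKD : Metric.closedBall (0 : ℂ) (1 / 2) ×ˢ Metric.sphere (0 : ℂ) (1 / 2)
        ⊆ cover ⁻¹' ball := by
      rintro ⟨a, b⟩ ⟨h1, h2⟩
      simp only [mem_closedBall_zero_iff, mem_sphere_zero_iff_norm] at h1 h2
      refine mem_preimage_ball.2 ⟨fun h => ?_, ?_⟩
      · have : b = 0 := congrArg Prod.snd h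
        rw [this] at h2; norm_num at h2
      · have h3 : ‖a‖ ^ 2 ≤ (1 / 2) ^ 2 := by gcongr
        have h4 : sqNorm (a, b) ≤ 1 / 2 := by simp only [sqNorm, h2]; linarith
        have h5 := pow_le_pow_left₀ (sqNorm_nonneg (a, b)) h4 2
        linarith
    obtain ⟨C, hC⟩ := hK.exists_bound_of_continuousOn (hg.differentiableOn_cover.continuousOn.mono hKD)
    refine ⟨C, fun a ha ha2 => ?_⟩
    have h3 : ‖a‖ ^ 2 ≤ (1 / 2) ^ 2 := by gcongr
    have hdc := diffContOnCl_slice hg (r := 1 / 2) ha (by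
      have := pow_le_pow_left₀ (by positivity)
        (show ‖a‖ ^ 2 + (1 / 2 : ℝ) ^ 2 ≤ 1 / 2 by linarith) 2
      linarith)
    rw [abs_of_pos (by norm_num)] at hdc
    refine Complex.norm_le_of_forall_mem_frontier_norm_le Metric.isBounded_ball hdc
      (fun b hb => ?_) (subset_closure (Metric.mem_ball_self (by norm_num)))
    rw [frontier_ball _ (by norm_num)] at hb
    exact hC (a, b) ⟨by simpa using ha2, hb⟩
  refine ⟨_, Complex.differentiableOn_update_limUnder_of_isLittleO
    (Metric.ball_mem_nhds 0 (by positivity)) hd ?_, fun q hq => Function.update_of_ne hq _ _⟩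
  have hO : (fun q => g (nullPoint q) - g (nullPoint 0)) =O[𝓝[≠] 0] fun _ : ℂ => (1 : ℝ) := by
    refine Asymptotics.IsBigO.sub (Asymptotics.IsBigO.of_bound C ?_)
      (Asymptotics.isBigO_const_const _ one_ne_zero _)
    filter_upwards [self_mem_nhdsWithin,
      mem_nhdsWithin_of_mem_nhds (Metric.ball_mem_nhds (0 : ℂ) (by norm_num : (0 : ℝ) < 1 / 4))]
      with q h1 h2
    obtain ⟨a, rfl⟩ := IsAlgClosed.exists_pow_nat_eq q (n := 2) two_pos
    rw [← cover_fst, norm_one, mul_one]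
    refine hC a (fun h => h1 (by simp [h])) ?_
    rw [mem_ball_zero_iff, norm_pow] at h2
    nlinarith [norm_nonneg a]
  refine hO.trans_isLittleO ?_
  rw [Asymptotics.isLittleO_one_left_iff]
  simpa using tendsto_norm_inv_nhdsNE_zero_atTop (α := ℂ)

/-- The mean value property in w₂. For w₁ ≠ 0 the whole disc spanned by the circle lies in the
domain. -/
theorem integral_slice {g : Amb → ℂ} (hg : IsHolomorphicOn ball g) {w : ℂ × ℂ}
    (hw : w ∈ cover ⁻¹' ball) (hw1 : w.1 ≠ 0) :
    (2 * Real.pi)⁻¹ • ∫ θ in (0 : ℝ)..2 * Real.pi, g (cover (torusRotation 0 θ w))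
      = g (nullPoint (w.1 ^ 2)) := by
  have h1 := (diffContOnCl_slice hg (r := ‖w.2‖) hw1 (mem_preimage_ball.1 hw).2).circleAverage
  rw [Real.circleAverage_eq_integral_add w.2.arg, cover_fst] at h1
  rw [← h1]
  congr 1
  refine intervalIntegral.integral_congr fun θ _ => ?_
  simp only [torusRotation, circleMap]
  congr 3
  · simp
  · conv_lhs => rw [← Complex.norm_mul_exp_arg_mul_I w.2]
    push_cast
    rw [add_mul, Complex.exp_add]
    ring

/-- On the circle |z| = |q| one has z̄ = |q|²/z, so the integral becomes Cauchy's formula for the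
l-th Taylor coefficient. -/
theorem integral_circle_taylor {G : ℂ → ℂ} {r : ℝ} (hG : DifferentiableOn ℂ G (Metric.ball 0 r))
    {q : ℂ} (hq : q ≠ 0) (hqr : ‖q‖ < r) (l : ℕ) :
    (2 * Real.pi)⁻¹ • ∫ θ in (0 : ℝ)..2 * Real.pi,
        G (Complex.exp (θ * Complex.I) * q) * conj (Complex.exp (θ * Complex.I) * q) ^ l
      = (l.factorial : ℂ)⁻¹ * iteratedDeriv l G 0 * ((‖q‖ ^ (2 * l) : ℝ) : ℂ) := by
  have hq0 : 0 < ‖q‖ := norm_pos_iff.2 hq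
  have hd : DiffContOnCl ℂ G (Metric.ball 0 ‖q‖) :=
    (hG.mono (Metric.closure_ball_subset_closedBall.trans
      (Metric.closedBall_subset_ball hqr))).diffContOnCl
  have h1 := hd.circleIntegral_one_div_sub_center_pow_smul hq0 l
  have h2 := Real.circleAverage_eq_circleIntegral (c := 0) (R := ‖q‖)
    (f := fun z => G z * conj z ^ l) hq0.ne'
  rw [Real.circleAverage_eq_integral_add q.arg] at h2
  have e1 : ∫ θ in (0 : ℝ)..2 * Real.pi,
      G (Complex.exp (θ * Complex.I) * q) * conj (Complex.exp (θ * Complex.I) * q) ^ l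
      = ∫ θ in (0 : ℝ)..2 * Real.pi, (fun z => G z * conj z ^ l) (circleMap 0 ‖q‖ (θ + q.arg)) := by
    refine intervalIntegral.integral_congr fun θ _ => ?_
    have : Complex.exp (θ * Complex.I) * q = circleMap 0 ‖q‖ (θ + q.arg) := by
      conv_lhs => rw [← Complex.norm_mul_exp_arg_mul_I q]
      simp only [circleMap]
      push_cast
      rw [add_mul, Complex.exp_add]
      ring
    simp only [this]
  rw [e1, h2]
  have e2 : ∮ z in C(0, ‖q‖), (z - 0)⁻¹ • (G z * conj z ^ l)
      = ∮ z in C(0, ‖q‖), ((‖q‖ ^ (2 * l) : ℝ) : ℂ) • ((1 / (z - 0) ^ (l + 1)) • G z) := by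
    refine circleIntegral.integral_congr hq0.le fun z hz => ?_
    have hz' : ‖z‖ = ‖q‖ := by simpa using hz
    have hz0 : z ≠ 0 := fun h => hq0.ne' (by rw [← hz', h, norm_zero])
    have h3 : z * conj z = ((‖q‖ ^ 2 : ℝ) : ℂ) := by
      rw [Complex.mul_conj, Complex.normSq_eq_norm_sq, hz']
    have h4 : ((‖q‖ ^ (2 * l) : ℝ) : ℂ) = z ^ l * conj z ^ l := by
      rw [← mul_pow, h3, pow_mul]; push_cast; rfl
    simp only [h4, sub_zero, smul_eq_mul]
    field_simp
    ring
  rw [e2, circleIntegral.integral_smul, h1]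
  have hpi : (2 * Real.pi * Complex.I : ℂ) ≠ 0 := Complex.two_pi_I_ne_zero
  simp only [smul_eq_mul]
  field_simp

/-- Integrating a holomorphic function against `conj (w₁²)^l` extracts a Taylor coefficient of its
restriction to the line `(q, iq, 0)`. -/
theorem integral_mul_conj_pow {Q : ℝ → ℝ≥0∞} (hQ : Measurable Q)
    (hsupp : ∀ s, ¬ 2 * s ^ 2 < 1 → Q s = 0) {g : Amb → ℂ} (hg : IsHolomorphicOn ball g)
    {G : ℂ → ℂ} (hG : DifferentiableOn ℂ G (Metric.ball 0 √(1 / 2)))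
    (hGg : ∀ q, q ≠ 0 → G q = g (nullPoint q)) (l : ℕ)
    (hint : Integrable (fun w => g (cover w) * conj (w.1 ^ 2) ^ l) (radialMeasure Q)) :
    ∫ w, g (cover w) * conj (w.1 ^ 2) ^ l ∂radialMeasure Q
      = (l.factorial : ℂ)⁻¹ * iteratedDeriv l G 0
        * ((∫ w, ‖w.1‖ ^ (4 * l) ∂radialMeasure Q : ℝ) : ℂ) := by
  have hmeas : ∀ κ₁ κ₂ : ℝ, Measurable
      (Function.uncurry fun (θ : ℝ) (w : ℂ × ℂ) => torusRotation (κ₁ * θ) (κ₂ * θ) w) := by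
    intro κ₁ κ₂
    refine Continuous.measurable ?_
    unfold torusRotation Function.uncurry
    fun_prop
  -- Rotation of w₂ alone replaces g ∘ cover by its restriction to the line w₂ = 0.
  obtain ⟨i1, e1⟩ := integral_average_of_invariant (hmeas 0 1)
    (fun θ => measurePreserving_torusRotation hQ _ _) hint
  have ae1 : (fun w => (2 * Real.pi)⁻¹ • ∫ θ in (0 : ℝ)..2 * Real.pi,
      g (cover (torusRotation (0 * θ) (1 * θ) w)) *
        conj ((torusRotation (0 * θ) (1 * θ) w).1 ^ 2) ^ l)
      =ᵐ[radialMeasure Q] fun w => G (w.1 ^ 2) * conj (w.1 ^ 2) ^ l := by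
    refine ae_radialMeasure_of_forall hQ hsupp fun w hw hw1 => ?_
    beta_reduce
    rw [hGg _ (pow_ne_zero 2 hw1), ← integral_slice hg hw hw1, smul_mul_assoc,
      ← intervalIntegral.integral_mul_const]
    congr 1
    refine intervalIntegral.integral_congr fun θ _ => ?_
    simp [torusRotation]
  rw [← e1, integral_congr_ae ae1]
  -- Rotation of w₁ at half speed makes w₁² run through its circle exactly once.
  obtain ⟨-, e2⟩ := integral_average_of_invariant (hmeas (1 / 2) 0)
    (fun θ => measurePreserving_torusRotation hQ _ _) (i1.congr ae1)
  rw [← e2, ← integral_complex_ofReal, ← integral_const_mul]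
  refine integral_congr_ae (ae_radialMeasure_of_forall hQ hsupp fun w hw hw1 => ?_)
  have hlt : ‖w.1 ^ 2‖ < √(1 / 2) := by
    rw [Real.lt_sqrt (norm_nonneg _), norm_pow]
    have h1 := (mem_preimage_ball.1 hw).2
    have h2 : ‖w.1‖ ^ 2 ≤ sqNorm w := by simp only [sqNorm]; nlinarith [sq_nonneg ‖w.2‖]
    have h3 := pow_le_pow_left₀ (sq_nonneg ‖w.1‖) h2 2
    linarith
  have h := integral_circle_taylor hG (pow_ne_zero 2 hw1) hlt l
  have e : ∀ θ : ℝ, (torusRotation (1 / 2 * θ) (0 * θ) w).1 ^ 2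
      = Complex.exp (θ * Complex.I) * w.1 ^ 2 := by
    intro θ
    simp only [torusRotation]
    rw [mul_pow, ← Complex.exp_nat_mul]
    congr 2
    push_cast
    ring
  beta_reduce
  simp only [e]
  rw [h, norm_pow, ← pow_mul, show 2 * (2 * l) = 4 * l by ring]

/-! ### The reproducing kernel of a radial weight -/

/-- The integral of `|w₁|^{4l}` against a radial measure. -/
def monomialNorm (Q : ℝ → ℝ≥0∞) (l : ℕ) : ℝ≥0∞ := ∫⁻ w, ‖w.1‖ₑ ^ (4 * l) ∂radialMeasure Q

theorem integral_norm_pow_eq (Q : ℝ → ℝ≥0∞) (l : ℕ) :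
    ∫ w, ‖w.1‖ ^ (4 * l) ∂radialMeasure Q = (monomialNorm Q l).toReal := by
  have h := integral_norm_eq_lintegral_enorm (μ := radialMeasure Q)
    (f := fun w : ℂ × ℂ => w.1 ^ (4 * l)) (by fun_prop)
  simp only [norm_pow, enorm_pow] at h
  exact h

theorem integrable_norm_pow {Q : ℝ → ℝ≥0∞} {l : ℕ} (h : monomialNorm Q l ≠ ⊤) :
    Integrable (fun w : ℂ × ℂ => ‖w.1‖ ^ (4 * l)) (radialMeasure Q) := by
  refine ⟨by fun_prop, ?_⟩
  rw [hasFiniteIntegral_iff_enorm]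
  simp only [enorm_pow, enorm_norm]
  exact h.lt_top

theorem memLp_conj_pow {Q : ℝ → ℝ≥0∞} {l : ℕ} (h : monomialNorm Q l ≠ ⊤) :
    MemLp (fun w : ℂ × ℂ => conj (w.1 ^ 2) ^ l) 2 (radialMeasure Q) := by
  refine (memLp_two_iff_integrable_sq_norm (by fun_prop)).2 ((integrable_norm_pow h).congr ?_)
  refine Eventually.of_forall fun w => ?_
  simp only [norm_pow, RCLike.norm_conj, ← pow_mul]
  ring

theorem integrable_mul_conj_pow {Q : ℝ → ℝ≥0∞} {l : ℕ} (h : monomialNorm Q l ≠ ⊤) {F : ℂ × ℂ → ℂ}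
    (hF : MemLp F 2 (radialMeasure Q)) :
    Integrable (fun w => F w * conj (w.1 ^ 2) ^ l) (radialMeasure Q) :=
  hF.integrable_mul (memLp_conj_pow h)

theorem norm_fst_sq_lt {w : ℂ × ℂ} (hw : w ∈ cover ⁻¹' ball) : ‖w.1‖ ^ 2 < √(1 / 2) := by
  rw [Real.lt_sqrt (by positivity)]
  have h1 := (mem_preimage_ball.1 hw).2
  have h2 : ‖w.1‖ ^ 2 ≤ sqNorm w := by simp only [sqNorm]; nlinarith [sq_nonneg ‖w.2‖]
  have h3 := pow_le_pow_left₀ (sq_nonneg ‖w.1‖) h2 2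
  linarith

theorem restrict_radialMeasure {Q : ℝ → ℝ≥0∞} (δ : ℝ) :
    (radialMeasure Q).restrict {w | δ < sqNorm w} = radialMeasure ((Set.Ioi δ).indicator Q) := by
  have hm : MeasurableSet {w : ℂ × ℂ | δ < sqNorm w} :=
    measurableSet_lt measurable_const continuous_sqNorm.measurable
  rw [radialMeasure, restrict_withDensity hm, ← withDensity_indicator hm, radialMeasure]
  rfl

variable {Q : ℝ → ℝ≥0∞} {g : Amb → ℂ} {G : ℂ → ℂ}

/-- Taylor coefficients in front of monomials of infinite norm vanish for functions in `L²`. -/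
theorem taylorCoeff_eq_zero (hQ : Measurable Q) (hsupp : ∀ s, ¬ 2 * s ^ 2 < 1 → Q s = 0)
    (hfin : ∀ δ > 0, radialMeasure Q {w | δ < sqNorm w} < ⊤)
    (hg : IsHolomorphicOn ball g) (hG : DifferentiableOn ℂ G (Metric.ball 0 √(1 / 2)))
    (hGg : ∀ q, q ≠ 0 → G q = g (nullPoint q))
    (hL2 : MemLp (fun w => g (cover w)) 2 (radialMeasure Q)) {l : ℕ}
    (hl : monomialNorm Q l = ⊤) : (l.factorial : ℂ)⁻¹ * iteratedDeriv l G 0 = 0 := by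
  set a : ℂ := (l.factorial : ℂ)⁻¹ * iteratedDeriv l G 0
  by_contra ha
  have ha0 : 0 < ‖a‖ := norm_pos_iff.2 ha
  have hsq := (memLp_two_iff_integrable_sq_norm hL2.1).1 hL2
  set A : ℝ := ∫ w, ‖g (cover w)‖ ^ 2 ∂radialMeasure Q
  -- Cutting off |w|² ≤ δ makes the monomial norm N finite. Then |a| N ≤ ∫ |g| |w₁|^{2l} ≤ A/(2|a|)
  -- + |a| N/2, so N ≤ A/|a|² independently of δ. Letting δ → 0 contradicts the infinite norm.
  have key : ∀ δ > 0, ∫⁻ w in {w | δ < sqNorm w}, ‖w.1‖ₑ ^ (4 * l) ∂radialMeasure Q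
      ≤ ENNReal.ofReal (A / ‖a‖ ^ 2) := by
    intro δ hδ
    set Q' := (Set.Ioi δ).indicator Q
    have hQ' : Measurable Q' := hQ.indicator measurableSet_Ioi
    have hsupp' : ∀ s, ¬ 2 * s ^ 2 < 1 → Q' s = 0 := fun s hs => by
      simp [Q', Set.indicator_apply, hsupp s hs]
    rw [restrict_radialMeasure]
    change monomialNorm Q' l ≤ _
    have hfin' : monomialNorm Q' l ≠ ⊤ := by
      have h1 : monomialNorm Q' l ≤ ∫⁻ _, 1 ∂radialMeasure Q' := by
        refine lintegral_mono_ae (ae_radialMeasure_of_forall hQ' hsupp' fun w hw _ => ?_)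
        refine pow_le_one' ?_ _
        have h2 := norm_fst_sq_lt hw
        have h3 : √(1 / 2 : ℝ) ≤ 1 := Real.sqrt_le_one.2 (by norm_num)
        have h4 : ‖w.1‖ ≤ 1 := by nlinarith [norm_nonneg w.1]
        rw [← ofReal_norm]
        exact ENNReal.ofReal_le_one.2 h4
      rw [lintegral_one, ← restrict_radialMeasure, Measure.restrict_apply_univ] at h1
      exact (h1.trans_lt (hfin δ hδ)).ne
    have hle : radialMeasure Q' ≤ radialMeasure Q := by
      rw [← restrict_radialMeasure]; exact Measure.restrict_le_self
    have hL2' := hL2.mono_measure hle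
    have hsq' := hsq.mono_measure hle
    have hint := integrable_mul_conj_pow hfin' hL2'
    have h1 := integral_mul_conj_pow hQ' hsupp' hg hG hGg l hint
    rw [integral_norm_pow_eq] at h1
    have h2 : ‖a‖ * (monomialNorm Q' l).toReal
        ≤ ∫ w, (‖g (cover w)‖ ^ 2 * (2 * ‖a‖)⁻¹ + ‖w.1‖ ^ (4 * l) * (‖a‖ / 2))
          ∂radialMeasure Q' := by
      have h3 := congrArg norm h1
      rw [norm_mul, Complex.norm_real, Real.norm_of_nonneg ENNReal.toReal_nonneg] at h3
      rw [← h3]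
      refine (norm_integral_le_integral_norm _).trans (integral_mono hint.norm
        ((hsq'.mul_const _).add ((integrable_norm_pow hfin').mul_const _)) fun w => ?_)
      simp only [norm_mul, norm_pow, RCLike.norm_conj, ← pow_mul]
      rw [show 4 * l = 2 * l * 2 by ring, pow_mul ‖w.1‖ (2 * l) 2]
      have h4 := sq_nonneg (‖g (cover w)‖ - ‖a‖ * ‖w.1‖ ^ (2 * l))
      have h5 := mul_nonneg (inv_nonneg.2 (show 0 ≤ 2 * ‖a‖ by positivity)) h4
      have h6 : (2 * ‖a‖)⁻¹ * (‖g (cover w)‖ - ‖a‖ * ‖w.1‖ ^ (2 * l)) ^ 2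
        = ‖g (cover w)‖ ^ 2 * (2 * ‖a‖)⁻¹ + (‖w.1‖ ^ (2 * l)) ^ 2 * (‖a‖ / 2)
          - ‖g (cover w)‖ * ‖w.1‖ ^ (2 * l) := by
        field_simp; ring
      linarith
    rw [integral_add (hsq'.mul_const _) ((integrable_norm_pow hfin').mul_const _),
      integral_mul_const, integral_mul_const, integral_norm_pow_eq] at h2
    have h7 : ∫ w, ‖g (cover w)‖ ^ 2 ∂radialMeasure Q' ≤ A :=
      integral_mono_measure hle (Eventually.of_forall fun w => by positivity) hsq
    rw [ENNReal.le_ofReal_iff_toReal_le hfin' (by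
      have : 0 ≤ A := integral_nonneg fun w => by positivity
      positivity), le_div_iff₀ (by positivity)]
    have h8 : (∫ w, ‖g (cover w)‖ ^ 2 ∂radialMeasure Q') * (2 * ‖a‖)⁻¹ ≤ A * (2 * ‖a‖)⁻¹ := by
      gcongr
    have h9 : ‖a‖ * (monomialNorm Q' l).toReal ≤ A * ‖a‖⁻¹ := by
      have : (2 * ‖a‖)⁻¹ = ‖a‖⁻¹ / 2 := by rw [mul_inv]; ring
      rw [this] at h2 h8
      linarith
    calc (monomialNorm Q' l).toReal * ‖a‖ ^ 2 = (‖a‖ * (monomialNorm Q' l).toReal) * ‖a‖ := by ring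
      _ ≤ A * ‖a‖⁻¹ * ‖a‖ := by gcongr
      _ = A := by field_simp
  have hU : (⋃ n : ℕ, {w : ℂ × ℂ | 1 / ((n : ℝ) + 1) < sqNorm w}) = {w | 0 < sqNorm w} := by
    ext w
    rw [Set.mem_iUnion]
    change (∃ n : ℕ, 1 / ((n : ℝ) + 1) < sqNorm w) ↔ 0 < sqNorm w
    refine ⟨fun ⟨n, hn⟩ => lt_trans (by positivity) hn, fun h => exists_nat_one_div_lt h⟩
  have hlim : ∫⁻ w in {w | 0 < sqNorm w}, ‖w.1‖ₑ ^ (4 * l) ∂radialMeasure Q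
      ≤ ENNReal.ofReal (A / ‖a‖ ^ 2) := by
    rw [← hU, setLIntegral_iUnion_of_directed]
    · exact iSup_le fun n => key _ (by positivity)
    · exact directed_of_isDirected_le fun m n hmn w (hw : 1 / ((m : ℝ) + 1) < sqNorm w) =>
        show 1 / ((n : ℝ) + 1) < sqNorm w from lt_of_le_of_lt (Nat.one_div_le_one_div hmn) hw
  have hres : (radialMeasure Q).restrict {w | 0 < sqNorm w} = radialMeasure Q := by
    refine Measure.restrict_eq_self_of_ae_mem ?_
    exact ae_radialMeasure_of_forall hQ hsupp fun w hw _ => sqNorm_pos (mem_preimage_ball.1 hw).1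
  rw [hres] at hlim
  exact absurd (hl ▸ hlim : ⊤ ≤ ENNReal.ofReal (A / ‖a‖ ^ 2)) (by simp)

/-- The coefficients of the reproducing kernel at the point `(q, iq, 0)`. -/
def reproducingCoeff (Q : ℝ → ℝ≥0∞) (q : ℝ) (l : ℕ) : ℝ := 2 * q ^ l / (monomialNorm Q l).toReal

/-- The reproducing kernel at the point `(q, iq, 0)`. -/
def reproducingFun (Q : ℝ → ℝ≥0∞) (q : ℝ) (z : Amb) : ℂ :=
  ∑' l, (reproducingCoeff Q q l : ℂ) * ((z 0 - Complex.I * z 1) / 2) ^ l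

theorem reproducingFun_cover (q : ℝ) (w : ℂ × ℂ) :
    reproducingFun Q q (cover w) = ∑' l, (reproducingCoeff Q q l : ℂ) * (w.1 ^ 2) ^ l := by
  have : (cover w 0 - Complex.I * cover w 1) / 2 = w.1 ^ 2 := by
    simp [cover]
    linear_combination (-(w.1 ^ 2 + w.2 ^ 2) / 2) * Complex.I_sq
  simp only [reproducingFun, this]

theorem norm_half_lt_of_mem_ball {z : Amb} (hz : z ∈ ball) :
    ‖(z 0 - Complex.I * z 1) / 2‖ < √(1 / 2) := by
  obtain ⟨w, hw, rfl⟩ : ∃ w, w ≠ 0 ∧ cover w = z := by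
    have := hz.1
    rw [← cover_image] at this
    exact this
  have : (cover w 0 - Complex.I * cover w 1) / 2 = w.1 ^ 2 := by
    simp [cover]
    linear_combination (-(w.1 ^ 2 + w.2 ^ 2) / 2) * Complex.I_sq
  rw [this, norm_pow]
  exact norm_fst_sq_lt hz

theorem isHolomorphicOn_reproducingFun {q : ℝ}
    (hs : Summable fun l => |reproducingCoeff Q q l| * √(1 / 2) ^ l) :
    IsHolomorphicOn ball (reproducingFun Q q) := by
  have hd : DifferentiableOn ℂ (fun x : ℂ => ∑' l, (reproducingCoeff Q q l : ℂ) * x ^ l)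
      (Metric.ball 0 √(1 / 2)) := by
    refine Complex.differentiableOn_tsum_of_summable_norm hs (fun l => by fun_prop)
      Metric.isOpen_ball fun l x hx => ?_
    rw [norm_mul, norm_pow, Complex.norm_real, Real.norm_eq_abs]
    have := (mem_ball_zero_iff.1 hx).le
    gcongr
  have hlin : Differentiable ℂ fun z : Amb => (z 0 - Complex.I * z 1) / 2 := by fun_prop
  intro p hp
  refine ⟨{z | ‖(z 0 - Complex.I * z 1) / 2‖ < √(1 / 2)},
    isOpen_lt hlin.continuous.norm continuous_const, norm_half_lt_of_mem_ball hp,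
    reproducingFun Q q, ?_, fun _ _ => rfl⟩
  exact hd.comp hlin.differentiableOn fun z hz => mem_ball_zero_iff.2 hz

theorem measurableSet_ball : MeasurableSet ball := by
  have h1 : ball = {z : Amb | ∑ j, z j * z j = 0} ∩ {z | z ≠ 0} ∩ {z | ‖z‖ < 1} := by
    ext z; simp [ball, manifold]
  rw [h1]
  refine (MeasurableSet.inter ?_ isOpen_ne.measurableSet).inter
    (isOpen_lt continuous_norm continuous_const).measurableSet
  exact (isClosed_eq (by fun_prop) continuous_const).measurableSet

/-- Pairing g with (w₁²)^l yields its l-th Taylor coefficient along (q, iq, 0) times the norm of the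
monomial, so dividing by the norms and summing against q^l restores g(q, iq, 0). The 2 in the
coefficients offsets the 1/2 in the measure of the two-sheeted cover. The weight may be singular at
the origin, so low monomials may fail to be square integrable. The square integrability of the
kernel function and the interchange of sum and integral therefore rest on domination by the first
integrable monomial. -/
theorem isReproducingAt_radial (hQ : Measurable Q) (hsupp : ∀ s, ¬ 2 * s ^ 2 < 1 → Q s = 0)
    (hfin : ∀ δ > 0, radialMeasure Q {w | δ < sqNorm w} < ⊤)
    (hne : ∀ l, monomialNorm Q l ≠ 0) {q : ℝ} (hq : 0 < q) (hq1 : q < √(1 / 2))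
    (hs : Summable fun l => |reproducingCoeff Q q l| * √(1 / 2) ^ l) :
    IsReproducingAt ball ((2⁻¹ : ℝ≥0∞) • Measure.map cover (radialMeasure Q)) (nullPoint q)
      (reproducingFun Q q) := by
  set ν := radialMeasure Q
  set μ : Measure Amb := (2⁻¹ : ℝ≥0∞) • Measure.map cover ν
  set R : ℝ := √(1 / 2)
  have hR : 0 < R := by positivity
  have hcm : Measurable cover := differentiable_cover.continuous.measurable
  have hmap : Measure.map cover ν = (2 : ℝ≥0∞) • μ := by
    rw [smul_smul, ENNReal.mul_inv_cancel two_ne_zero (by simp), one_smul]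
  have hball : ∀ᵐ z ∂Measure.map cover ν, z ∈ ball := by
    rw [ae_map_iff (p := fun z => z ∈ ball) hcm.aemeasurable measurableSet_ball]
    exact ae_radialMeasure_of_forall hQ hsupp fun w hw _ => hw
  have hhol := isHolomorphicOn_reproducingFun hs
  have hcont : ContinuousOn (reproducingFun Q q) ball := fun z hz => by
    obtain ⟨V, hV, hzV, G, hG, hGg⟩ := hhol z hz
    have h1 : ContinuousWithinAt G (V ∩ ball) z :=
      (hG.continuousOn.continuousAt (hV.mem_nhds hzV)).continuousWithinAt
    have h2 := h1.congr (fun y hy => (hGg y hy).symm) (hGg z ⟨hzV, hz⟩).symm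
    rwa [Set.inter_comm, continuousWithinAt_inter (hV.mem_nhds hzV)] at h2
  have hmeas : AEStronglyMeasurable (reproducingFun Q q) (Measure.map cover ν) := by
    have h1 := hcont.aestronglyMeasurable (μ := Measure.map cover ν) measurableSet_ball
    rwa [Measure.restrict_eq_self_of_ae_mem hball] at h1
  have hL2iff : ∀ g : Amb → ℂ, MemLp g 2 μ → MemLp (fun w => g (cover w)) 2 ν := by
    intro g hg
    have h1 : MemLp g 2 (Measure.map cover ν) := by
      rw [hmap]; exact hg.smul_measure (by simp)
    exact (memLp_map_measure_iff h1.1 hcm.aemeasurable).1 h1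
  -- the size of the terms relative to the first integrable monomial
  obtain ⟨l₀, hl₀⟩ : ∃ l₀ : ℕ, ∀ l, reproducingCoeff Q q l ≠ 0 →
      l₀ ≤ l ∧ monomialNorm Q l₀ ≠ ⊤ := by
    by_cases hex : ∃ l, monomialNorm Q l ≠ ⊤
    · refine ⟨Nat.find hex, fun l hl => ⟨Nat.find_min' hex fun h => hl ?_, Nat.find_spec hex⟩⟩
      simp [reproducingCoeff, h]
    · push Not at hex
      exact ⟨0, fun l hl => absurd (by simp [reproducingCoeff, hex l]) hl⟩
  have hterm : ∀ l, ∀ w ∈ cover ⁻¹' ball, |reproducingCoeff Q q l| * ‖w.1‖ ^ (2 * l)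
      ≤ |reproducingCoeff Q q l| * R ^ l * ((R ^ l₀)⁻¹ * ‖w.1‖ ^ (2 * l₀)) := by
    intro l w hw
    by_cases hc : reproducingCoeff Q q l = 0
    · simp [hc]
    · obtain ⟨k, rfl⟩ := Nat.exists_eq_add_of_le (hl₀ l hc).1
      have h1 : (‖w.1‖ ^ 2) ^ k ≤ R ^ k :=
        pow_le_pow_left₀ (by positivity) (norm_fst_sq_lt hw).le k
      have h2 : R ^ (l₀ + k) * ((R ^ l₀)⁻¹ * ‖w.1‖ ^ (2 * l₀)) = R ^ k * ‖w.1‖ ^ (2 * l₀) := by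
        rw [pow_add]; field_simp
      rw [mul_assoc, h2, mul_add, pow_add, mul_comm (‖w.1‖ ^ (2 * l₀)), pow_mul ‖w.1‖ 2 k]
      gcongr
  have hnorm : ∀ l (w : ℂ × ℂ), ‖(reproducingCoeff Q q l : ℂ) * (w.1 ^ 2) ^ l‖
      = |reproducingCoeff Q q l| * ‖w.1‖ ^ (2 * l) := fun l w => by
    rw [norm_mul, norm_pow, norm_pow, ← pow_mul, Complex.norm_real, Real.norm_eq_abs]
  have hsummable : ∀ w ∈ cover ⁻¹' ball,
      Summable fun l => ‖(reproducingCoeff Q q l : ℂ) * (w.1 ^ 2) ^ l‖ := fun w hw => by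
    refine Summable.of_nonneg_of_le (fun l => norm_nonneg _) (fun l => ?_)
      (hs.mul_right ((R ^ l₀)⁻¹ * ‖w.1‖ ^ (2 * l₀)))
    rw [hnorm]
    exact hterm l w hw
  have hkL2 : MemLp (reproducingFun Q q) 2 μ := by
    refine MemLp.smul_measure ?_ (by simp)
    rw [memLp_map_measure_iff hmeas hcm.aemeasurable]
    have hmeas' := hmeas.comp_measurable hcm
    by_cases hall : ∀ l, reproducingCoeff Q q l = 0
    · have : reproducingFun Q q ∘ cover = 0 := by
        ext w; simp [Function.comp, reproducingFun, hall]
      rw [this]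
      exact MemLp.zero
    · push Not at hall
      obtain ⟨l₁, hl₁⟩ := hall
      refine ((memLp_conj_pow (hl₀ l₁ hl₁).2).const_mul
        (((∑' l, |reproducingCoeff Q q l| * R ^ l) * (R ^ l₀)⁻¹ : ℝ) : ℂ)).mono hmeas'
        (ae_radialMeasure_of_forall hQ hsupp fun w hw _ => ?_)
      rw [Function.comp, reproducingFun_cover]
      refine (norm_tsum_le_tsum_norm (hsummable w hw)).trans ?_
      simp only [hnorm]
      have h1 := (hsummable w hw)
      simp only [hnorm] at h1
      refine (h1.tsum_le_tsum (hterm · w hw) (hs.mul_right _)).trans (le_of_eq ?_)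
      rw [tsum_mul_right, norm_mul, Complex.norm_real, norm_pow, RCLike.norm_conj, norm_pow,
        ← pow_mul, Real.norm_of_nonneg, mul_assoc]
      exact mul_nonneg (tsum_nonneg fun l => by positivity) (by positivity)
  refine ⟨⟨hhol, hkL2⟩, fun g hg => ?_⟩
  obtain ⟨G, hG, hGg⟩ := hg.1.exists_extension
  have hgL2 := hL2iff g hg.2
  -- reduction to an integral over `ℂ²`
  have hint : ∫ x, g x * conj (reproducingFun Q q x) ∂μ
      = 2⁻¹ * ∫ w, ∑' l, g (cover w) * ((reproducingCoeff Q q l : ℂ) * conj (w.1 ^ 2) ^ l) ∂ν := by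
    have h1 : MemLp g 2 (Measure.map cover ν) := by
      rw [hmap]; exact hg.2.smul_measure (by simp)
    rw [integral_smul_measure, integral_map hcm.aemeasurable
      (f := fun x => g x * conj (reproducingFun Q q x)) (h1.1.mul (Complex.continuous_conj.comp_aestronglyMeasurable hmeas))]
    have h2 : ((2⁻¹ : ℝ≥0∞).toReal) = (2⁻¹ : ℝ) := by simp
    rw [h2, Complex.real_smul]
    push_cast
    congr 1
    refine integral_congr_ae (Eventually.of_forall fun w => ?_)
    simp only [reproducingFun_cover]
    rw [tsum_mul_left, Complex.conj_tsum]
    simp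
  have hvals : ∀ l, Integrable (fun w => g (cover w) *
      ((reproducingCoeff Q q l : ℂ) * conj (w.1 ^ 2) ^ l)) ν ∧
      ∫ w, g (cover w) * ((reproducingCoeff Q q l : ℂ) * conj (w.1 ^ 2) ^ l) ∂ν
        = 2 * ((l.factorial : ℂ)⁻¹ * iteratedDeriv l G 0 * (q : ℂ) ^ l) := by
    intro l
    -- For infinite norm `toReal` is 0 and so is the kernel coefficient, in accordance with the
    -- vanishing Taylor coefficient of g.
    by_cases hl : monomialNorm Q l = ⊤
    · have h1 := taylorCoeff_eq_zero hQ hsupp hfin hg.1 hG hGg hgL2 hl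
      simp [reproducingCoeff, hl, h1]
    · have h1 := integrable_mul_conj_pow hl hgL2
      have e : (fun w => g (cover w) * ((reproducingCoeff Q q l : ℂ) * conj (w.1 ^ 2) ^ l))
          = fun w => (reproducingCoeff Q q l : ℂ) * (g (cover w) * conj (w.1 ^ 2) ^ l) := by
        ext w; ring
      rw [e]
      refine ⟨h1.const_mul _, ?_⟩
      rw [integral_const_mul, integral_mul_conj_pow hQ hsupp hg.1 hG hGg l h1,
        integral_norm_pow_eq, reproducingCoeff]
      have h2 : ((monomialNorm Q l).toReal : ℂ) ≠ 0 := by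
        exact_mod_cast (ENNReal.toReal_pos (hne l) hl).ne'
      push_cast
      field_simp
  have hsumnorm : Summable fun l => ∫ w, ‖g (cover w) *
      ((reproducingCoeff Q q l : ℂ) * conj (w.1 ^ 2) ^ l)‖ ∂ν := by
    by_cases hall : ∀ l, reproducingCoeff Q q l = 0
    · simp [hall, summable_zero]
    · push Not at hall
      obtain ⟨l₁, hl₁⟩ := hall
      have h1 := (integrable_mul_conj_pow (hl₀ l₁ hl₁).2 hgL2).norm
      refine Summable.of_nonneg_of_le (fun l => integral_nonneg fun w => norm_nonneg _) (fun l => ?_)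
        (hs.mul_right ((R ^ l₀)⁻¹ * ∫ w, ‖g (cover w) * conj (w.1 ^ 2) ^ l₀‖ ∂ν))
      rw [← integral_const_mul, ← integral_const_mul]
      refine integral_mono_ae (hvals l).1.norm ((h1.const_mul _).const_mul _)
        (ae_radialMeasure_of_forall hQ hsupp fun w hw _ => ?_)
      simp only [norm_mul, norm_pow, RCLike.norm_conj, Complex.norm_real, Real.norm_eq_abs,
        ← pow_mul]
      have h2 := mul_le_mul_of_nonneg_left (hterm l w hw) (norm_nonneg (g (cover w)))
      refine h2.trans (le_of_eq ?_)
      ring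
  have htotal := hasSum_integral_of_summable_integral_norm (fun l => (hvals l).1) hsumnorm
  have htaylor := Complex.hasSum_taylorSeries_on_ball hG (z := (q : ℂ))
    (by rw [mem_ball_zero_iff, Complex.norm_real, Real.norm_of_nonneg hq.le]; exact hq1)
  rw [hint, ← htotal.tsum_eq, ← hGg _ (by exact_mod_cast hq.ne'), ← htaylor.tsum_eq,
    tsum_congr fun l => (hvals l).2, tsum_mul_left, ← mul_assoc, inv_mul_cancel₀ two_ne_zero,
    one_mul]
  refine tsum_congr fun l => ?_
  simp only [sub_zero, smul_eq_mul]
  ring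

/-! ### Integrals of radial functions -/

/-- Polar coordinates with s = r², so that r dr dθ = ds dθ / 2. -/
theorem lintegral_norm_sq_complex {φ : ℝ → ℝ≥0∞} (hφ : Measurable φ) :
    ∫⁻ z : ℂ, φ (‖z‖ ^ 2) = ENNReal.ofReal Real.pi * ∫⁻ s in Set.Ioi (0 : ℝ), φ s := by
  have himg : (fun y : ℝ => y ^ 2) '' Set.Ioi 0 = Set.Ioi 0 := by
    ext s
    constructor
    · rintro ⟨y, hy, rfl⟩
      have : (0 : ℝ) < y := hy
      exact pow_pos this 2
    · intro hs
      exact ⟨√s, Real.sqrt_pos.2 hs, Real.sq_sqrt (le_of_lt hs)⟩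
  have h2 := lintegral_image_eq_lintegral_abs_deriv_mul (s := Set.Ioi (0 : ℝ))
    (f := fun y => y ^ 2) (f' := fun y => 2 * y) measurableSet_Ioi
    (fun x _ => by simpa using (hasDerivAt_pow 2 x).hasDerivWithinAt)
    (fun x hx y hy h => (pow_left_inj₀ (le_of_lt hx) (le_of_lt hy) two_ne_zero).1 h) φ
  rw [himg] at h2
  have hg : Measurable fun y : ℝ => ENNReal.ofReal y * φ (y ^ 2) :=
    ENNReal.measurable_ofReal.mul (hφ.comp (by fun_prop))
  have h3 : ∫⁻ y in Set.Ioi (0 : ℝ), ENNReal.ofReal |2 * y| * φ (y ^ 2)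
      = 2 * ∫⁻ y in Set.Ioi (0 : ℝ), ENNReal.ofReal y * φ (y ^ 2) := by
    rw [← lintegral_const_mul _ hg]
    refine setLIntegral_congr_fun measurableSet_Ioi fun y hy => ?_
    have hy' : (0 : ℝ) < y := hy
    rw [abs_of_pos (by positivity), ENNReal.ofReal_mul zero_le_two]
    simp [mul_assoc]
  rw [h2, h3, ← Complex.lintegral_comp_polarCoord_symm]
  have h4 : ∫⁻ p in polarCoord.target,
      ENNReal.ofReal p.1 • φ (‖Complex.polarCoord.symm p‖ ^ 2)
      = ∫⁻ p in Set.Ioi (0 : ℝ) ×ˢ Set.Ioo (-Real.pi) Real.pi,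
        ENNReal.ofReal p.1 * φ (p.1 ^ 2) := by
    rw [polarCoord_target]
    refine setLIntegral_congr_fun (measurableSet_Ioi.prod measurableSet_Ioo) fun p _ => ?_
    simp
  rw [h4, Measure.volume_eq_prod, ← Measure.prod_restrict,
    lintegral_prod (fun p : ℝ × ℝ => ENNReal.ofReal p.1 * φ (p.1 ^ 2))
      (hg.comp measurable_fst).aemeasurable]
  simp only [lintegral_const, Measure.restrict_apply_univ, Real.volume_Ioo]
  rw [lintegral_mul_const _ hg, show Real.pi - -Real.pi = Real.pi * 2 by ring,
    ENNReal.ofReal_mul Real.pi_pos.le]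
  simp
  ring

theorem lintegral_add_Ioi {Q : ℝ → ℝ≥0∞} {a : ℝ} :
    ∫⁻ s in Set.Ioi (0 : ℝ), Q (a + s) = ∫⁻ s in Set.Ioi a, Q s := by
  rw [← lintegral_indicator measurableSet_Ioi, ← lintegral_indicator measurableSet_Ioi]
  conv_rhs => rw [← lintegral_add_left_eq_self _ a]
  refine lintegral_congr fun s => ?_
  simp [Set.indicator_apply]

theorem lintegral_Ioo_pow (s : ℝ) (hs : 0 < s) (l : ℕ) :
    ∫⁻ x in Set.Ioo 0 s, ENNReal.ofReal x ^ (2 * l)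
      = ENNReal.ofReal (s ^ (2 * l + 1) / (2 * l + 1)) := by
  have h1 : ∫⁻ x in Set.Ioo 0 s, ENNReal.ofReal x ^ (2 * l)
      = ∫⁻ x in Set.Ioo 0 s, ENNReal.ofReal (x ^ (2 * l)) :=
    setLIntegral_congr_fun measurableSet_Ioo fun x hx => (ENNReal.ofReal_pow hx.1.le _).symm
  have hint : IntegrableOn (fun x : ℝ => x ^ (2 * l)) (Set.Ioo 0 s) :=
    (Continuous.integrableOn_Icc (by fun_prop)).mono_set Set.Ioo_subset_Icc_self
  rw [h1, ← ofReal_integral_eq_lintegral_ofReal hint, ← integral_Ioc_eq_integral_Ioo,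
    ← intervalIntegral.integral_of_le hs.le, integral_pow]
  · congr 1
    push_cast
    ring
  · exact (ae_restrict_iff' measurableSet_Ioo).2
      (Eventually.of_forall fun x hx => pow_nonneg hx.1.le _)

/-- In the variables x = |w₁|² and s = |w|² Lebesgue measure becomes π² dx ds on 0 < x < s. Tonelli
leaves ∫₀ˢ x^{2l} dx inside. -/
theorem monomialNorm_eq_lintegral {Q : ℝ → ℝ≥0∞} (hQ : Measurable Q) (l : ℕ) :
    monomialNorm Q l = ENNReal.ofReal (Real.pi ^ 2) * ∫⁻ s in Set.Ioi (0 : ℝ),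
      Q s * ENNReal.ofReal (s ^ (2 * l + 1) / (2 * l + 1)) := by
  have hQm : Measurable fun w : ℂ × ℂ => Q (sqNorm w) := hQ.comp continuous_sqNorm.measurable
  have hQ2 : Measurable fun p : ℝ × ℝ => Q (p.1 + p.2) := hQ.comp (by fun_prop)
  have hpow : Measurable fun x : ℝ => ENNReal.ofReal x ^ (2 * l) := by fun_prop
  have h1 : monomialNorm Q l
      = ∫⁻ a : ℂ, ∫⁻ b : ℂ, ENNReal.ofReal (‖a‖ ^ 2) ^ (2 * l) * Q (‖a‖ ^ 2 + ‖b‖ ^ 2) := by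
    rw [monomialNorm, radialMeasure, lintegral_withDensity_eq_lintegral_mul _ hQm (by fun_prop),
      Measure.volume_eq_prod, lintegral_prod _ (hQm.mul (by fun_prop)).aemeasurable]
    refine lintegral_congr fun a => lintegral_congr fun b => ?_
    simp only [Pi.mul_apply, sqNorm]
    rw [mul_comm, ENNReal.ofReal_pow (norm_nonneg _), ofReal_norm, ← pow_mul,
      show 2 * (2 * l) = 4 * l by ring]
  have h2 : ∀ x : ℝ, ∫⁻ b : ℂ, ENNReal.ofReal x ^ (2 * l) * Q (x + ‖b‖ ^ 2)
      = ENNReal.ofReal Real.pi * (ENNReal.ofReal x ^ (2 * l) * ∫⁻ s in Set.Ioi x, Q s) := by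
    intro x
    rw [lintegral_const_mul _ (by fun_prop),
      lintegral_norm_sq_complex (φ := fun s => Q (x + s)) (by fun_prop), lintegral_add_Ioi]
    ring
  have hF : Measurable (Function.uncurry fun x s : ℝ => if 0 < x ∧ x < s then
      ENNReal.ofReal x ^ (2 * l) * Q s else 0) := by
    refine Measurable.ite ?_ ?_ measurable_const
    · exact (measurableSet_lt measurable_const measurable_fst).inter
        (measurableSet_lt measurable_fst measurable_snd)
    · exact (hpow.comp measurable_fst).mul (hQ.comp measurable_snd)
  have hinner : ∀ x : ℝ, (∫⁻ s, if 0 < x ∧ x < s then ENNReal.ofReal x ^ (2 * l) * Q s else 0)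
      = (Set.Ioi (0 : ℝ)).indicator
        (fun x => ENNReal.ofReal x ^ (2 * l) * ∫⁻ s in Set.Ioi x, Q s) x := by
    intro x
    by_cases hx : 0 < x
    · rw [Set.indicator_of_mem (show x ∈ Set.Ioi 0 from hx), ← lintegral_const_mul _ hQ,
        ← lintegral_indicator measurableSet_Ioi]
      refine lintegral_congr fun s => ?_
      simp [Set.indicator_apply, hx]
    · rw [Set.indicator_of_notMem (show x ∉ Set.Ioi 0 from hx)]
      simp [hx]
  have hmeas : Measurable fun x : ℝ => ENNReal.ofReal x ^ (2 * l) * ∫⁻ s in Set.Ioi x, Q s := by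
    refine hpow.mul ?_
    have : ∀ x : ℝ, ∫⁻ s in Set.Ioi x, Q s = ∫⁻ s in Set.Ioi (0 : ℝ), Q (x + s) := fun x =>
      lintegral_add_Ioi.symm
    simp only [this]
    exact Measurable.lintegral_prod_right hQ2
  rw [h1]
  simp only [h2]
  rw [lintegral_norm_sq_complex (φ := fun x => ENNReal.ofReal Real.pi *
    (ENNReal.ofReal x ^ (2 * l) * ∫⁻ s in Set.Ioi x, Q s)) (hmeas.const_mul _),
    lintegral_const_mul _ hmeas, ← mul_assoc, ← ENNReal.ofReal_mul Real.pi_pos.le, ← sq,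
    ← lintegral_indicator measurableSet_Ioi]
  congr 1
  simp only [← hinner]
  rw [lintegral_lintegral_swap hF.aemeasurable, ← lintegral_indicator measurableSet_Ioi]
  refine lintegral_congr fun s => ?_
  by_cases hs : 0 < s
  · rw [Set.indicator_of_mem (show s ∈ Set.Ioi 0 from hs), ← lintegral_Ioo_pow s hs,
      ← lintegral_const_mul _ hpow, ← lintegral_indicator measurableSet_Ioo]
    refine lintegral_congr fun x => ?_
    simp only [Set.indicator_apply, Set.mem_Ioo, mul_comm (Q s)]
  · rw [Set.indicator_of_notMem (show s ∉ Set.Ioi 0 from hs)]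
    have : ∀ x : ℝ, ¬ (0 < x ∧ x < s) := fun x h => hs (h.1.trans h.2)
    simp [this]

/-! ### The weight of a radial potential -/

/-- The density of the weight `W` as a function of `|w|²`. -/
def weightDensity (f : ℝ → ℝ) : ℝ → ℝ≥0∞ :=
  (Set.Ioo 0 √(1 / 2)).indicator fun s => ENNReal.ofReal (32 * radialWeight f (2 * s ^ 2))

theorem two_mul_sq_mem {s : ℝ} (hs : s ∈ Set.Ioo 0 √(1 / 2)) : 2 * s ^ 2 ∈ Set.Ioo (0 : ℝ) 1 := by
  have h1 := hs.1
  have h2 := (Real.lt_sqrt h1.le).1 hs.2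
  exact ⟨by positivity, by linarith⟩

theorem measurable_weightDensity (hf : ContDiffOn ℝ ∞ f (Set.Ioc 0 1)) :
    Measurable (weightDensity f) := by
  classical
  rw [weightDensity, ← Set.piecewise_eq_indicator]
  refine ContinuousOn.measurable_piecewise ?_ continuousOn_const measurableSet_Ioo
  refine ENNReal.continuous_ofReal.comp_continuousOn (continuousOn_const.mul
    ((contDiffOn_radialWeight hf).continuousOn.comp (by fun_prop) fun s hs => ?_))
  exact Set.Ioo_subset_Ioc_self (two_mul_sq_mem hs)

theorem weightDensity_eq_zero (s : ℝ) (hs : ¬ 2 * s ^ 2 < 1) : weightDensity f s = 0 :=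
  Set.indicator_of_notMem (fun h => hs (two_mul_sq_mem h).2) _

theorem weightMeasure_eq_map (hf : ContDiffOn ℝ ∞ f (Set.Ioc 0 1))
    (hpos : ∀ t ∈ Set.Ioo (0 : ℝ) 1, 0 < f t) :
    weightMeasure (fun x => f (‖x‖ ^ 2))
      = (2⁻¹ : ℝ≥0∞) • Measure.map cover (radialMeasure (weightDensity f)) := by
  rw [weightMeasure, ← withDensity_indicator isOpen_preimage_ball.measurableSet, radialMeasure]
  congr 3
  funext w
  by_cases hw : w ∈ cover ⁻¹' ball
  · have h := mem_preimage_ball.1 hw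
    have hs : sqNorm w ∈ Set.Ioo 0 √(1 / 2) :=
      ⟨sqNorm_pos h.1, (Real.lt_sqrt (sqNorm_nonneg w)).2 (by linarith [h.2])⟩
    rw [Set.indicator_of_mem hw, weightDensity, Set.indicator_of_mem hs,
      volumeDensity_radial hf hpos hw]
  · rw [Set.indicator_of_notMem hw, weightDensity, Set.indicator_of_notMem]
    intro hs
    refine hw (mem_preimage_ball.2 ⟨?_, (two_mul_sq_mem hs).2⟩)
    rintro rfl
    simp [sqNorm] at hs

theorem radialWeight_nonneg (hf : ContDiffOn ℝ ∞ f (Set.Ioc 0 1))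
    (hpos : ∀ t ∈ Set.Ioo (0 : ℝ) 1, 0 < f t) (hvol : HasNonnegVolume fun z => f (‖z‖ ^ 2))
    {t : ℝ} (ht : t ∈ Set.Ioo (0 : ℝ) 1) : 0 ≤ radialWeight f t := by
  have h0 : 0 ≤ t / 2 := by have := ht.1; positivity
  -- The point (√√(t/2), 0) has |w|² = √(t/2), hence lies over |z|² = t.
  have hs : sqNorm ((√√(t / 2) : ℝ), 0) = √(t / 2) := by
    simp only [sqNorm, Complex.norm_real, norm_zero, Real.norm_of_nonneg (Real.sqrt_nonneg _),
      Real.sq_sqrt (Real.sqrt_nonneg (t / 2))]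
    ring
  have ht' : 2 * sqNorm ((√√(t / 2) : ℝ), 0) ^ 2 = t := by
    rw [hs, Real.sq_sqrt h0]; ring
  have hw : (((√√(t / 2) : ℝ) : ℂ), (0 : ℂ)) ∈ cover ⁻¹' ball := by
    refine mem_preimage_ball.2 ⟨fun h => ?_, by rw [ht']; exact ht.2⟩
    rw [h] at ht'
    simp [sqNorm] at ht'
    exact ht.1.ne ht'
  have h := hvol _ hw
  rw [volumeDensity_radial hf hpos hw, ht'] at h
  linarith

/-- Substitution x = 2s², dx = 4s ds, which turns 32 s^{2l+1} ds into 8 x^l dx / 2^l. -/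
theorem monomialNorm_weightDensity (hf : ContDiffOn ℝ ∞ f (Set.Ioc 0 1)) (l : ℕ) :
    monomialNorm (weightDensity f) l = ENNReal.ofReal (8 * Real.pi ^ 2 / (2 ^ l * (2 * l + 1)))
      * ∫⁻ x in Set.Ioo (0 : ℝ) 1, ENNReal.ofReal (x ^ l * radialWeight f x) := by
  have himg : (fun s : ℝ => 2 * s ^ 2) '' Set.Ioo 0 √(1 / 2) = Set.Ioo 0 1 := by
    ext t
    constructor
    · rintro ⟨s, hs, rfl⟩
      exact two_mul_sq_mem hs
    · intro ht
      have h0 : 0 < t / 2 := by have := ht.1; positivity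
      refine ⟨√(t / 2), ⟨Real.sqrt_pos.2 h0, Real.sqrt_lt_sqrt h0.le ?_⟩, ?_⟩
      · linarith [ht.2]
      · simp only [Real.sq_sqrt h0.le]; ring
  have h2 := lintegral_image_eq_lintegral_abs_deriv_mul (s := Set.Ioo 0 √(1 / 2))
    (f := fun s => 2 * s ^ 2) (f' := fun s => 2 * (2 * s)) measurableSet_Ioo
    (fun x _ => by simpa using ((hasDerivAt_pow 2 x).const_mul 2).hasDerivWithinAt)
    (fun x hx y hy h => (pow_left_inj₀ hx.1.le hy.1.le two_ne_zero).1
      (mul_left_cancel₀ two_ne_zero h))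
    (fun x => ENNReal.ofReal (x ^ l * radialWeight f x))
  rw [himg] at h2
  rw [monomialNorm_eq_lintegral (measurable_weightDensity hf), h2]
  have hmeas : AEMeasurable (fun x : ℝ => ENNReal.ofReal |2 * (2 * x)| *
      ENNReal.ofReal ((2 * x ^ 2) ^ l * radialWeight f (2 * x ^ 2)))
      (volume.restrict (Set.Ioo 0 √(1 / 2))) := by
    refine ContinuousOn.aemeasurable ?_ measurableSet_Ioo
    refine ContinuousOn.ennreal_mul
      (ENNReal.continuous_ofReal.comp_continuousOn (by fun_prop))
      (ENNReal.continuous_ofReal.comp_continuousOn ((by fun_prop : ContinuousOn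
        (fun x : ℝ => (2 * x ^ 2) ^ l) _).mul ((contDiffOn_radialWeight hf).continuousOn.comp
        (by fun_prop) fun s hs => Set.Ioo_subset_Ioc_self (two_mul_sq_mem hs)))) ?_ ?_
    · intro x hx; right; exact ENNReal.ofReal_ne_top
    · intro x hx; right; exact ENNReal.ofReal_ne_top
  have hc : (8 * Real.pi ^ 2 / (2 ^ l * (2 * l + 1)) : ℝ)
      = Real.pi ^ 2 * (8 / (2 ^ l * (2 * l + 1))) := by ring
  rw [hc, ENNReal.ofReal_mul (by positivity), mul_assoc, ← lintegral_const_mul'' _ hmeas]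
  congr 1
  have hres : ∫⁻ s in Set.Ioi (0 : ℝ), weightDensity f s *
        ENNReal.ofReal (s ^ (2 * l + 1) / (2 * l + 1))
      = ∫⁻ s in Set.Ioo 0 √(1 / 2), ENNReal.ofReal (32 * radialWeight f (2 * s ^ 2)) *
        ENNReal.ofReal (s ^ (2 * l + 1) / (2 * l + 1)) := by
    rw [← lintegral_indicator measurableSet_Ioi, ← lintegral_indicator measurableSet_Ioo]
    refine lintegral_congr fun s => ?_
    by_cases hs : s ∈ Set.Ioo 0 √(1 / 2)
    · rw [Set.indicator_of_mem hs, Set.indicator_of_mem (show s ∈ Set.Ioi 0 from hs.1),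
        weightDensity, Set.indicator_of_mem hs]
    · rw [Set.indicator_of_notMem hs]
      have : weightDensity f s = 0 := Set.indicator_of_notMem hs _
      simp [Set.indicator_apply, this]
  rw [hres]
  refine setLIntegral_congr_fun measurableSet_Ioo fun s hs => ?_
  have hs0 := hs.1
  rw [mul_comm, ← ENNReal.ofReal_mul (by positivity), ← ENNReal.ofReal_mul (by positivity),
    ← ENNReal.ofReal_mul (by positivity), abs_of_pos (by positivity)]
  congr 1
  rw [mul_pow, ← pow_mul, pow_succ]
  field_simp
  ring

theorem toReal_monomialNorm_weightDensity (hf : ContDiffOn ℝ ∞ f (Set.Ioc 0 1))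
    (hpos : ∀ t ∈ Set.Ioo (0 : ℝ) 1, 0 < f t) (hvol : HasNonnegVolume fun z => f (‖z‖ ^ 2))
    (l : ℕ) : (monomialNorm (weightDensity f) l).toReal
      = 8 * Real.pi ^ 2 / (2 ^ l * (2 * l + 1)) * moment f l := by
  rw [monomialNorm_weightDensity hf, ENNReal.toReal_mul, ENNReal.toReal_ofReal (by positivity),
    moment, integral_eq_lintegral_of_nonneg_ae]
  · refine (ae_restrict_iff' measurableSet_Ioo).2 (Eventually.of_forall fun x hx => ?_)
    exact mul_nonneg (pow_nonneg hx.1.le l) (radialWeight_nonneg hf hpos hvol hx)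
  · refine ContinuousOn.aestronglyMeasurable ?_ measurableSet_Ioo
    exact (by fun_prop : ContinuousOn (fun x : ℝ => x ^ l) _).mul
      ((contDiffOn_radialWeight hf).continuousOn.mono Set.Ioo_subset_Ioc_self)

/-- Nothing is known about f near 0, so a bound is available only away from the origin. -/
theorem weightDensity_le (hf : ContDiffOn ℝ ∞ f (Set.Ioc 0 1)) {δ : ℝ} (hδ : 0 < δ) :
    ∃ C : ℝ, ∀ s, δ < s → weightDensity f s ≤ ENNReal.ofReal C := by
  have hcont : ContinuousOn (radialWeight f) (Set.Icc (2 * δ ^ 2) 1) :=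
    (contDiffOn_radialWeight hf).continuousOn.mono fun x hx =>
      ⟨lt_of_lt_of_le (by positivity) hx.1, hx.2⟩
  obtain ⟨C, hC⟩ := isCompact_Icc.exists_bound_of_continuousOn hcont
  refine ⟨32 * C, fun s hs => ?_⟩
  by_cases h : s ∈ Set.Ioo 0 √(1 / 2)
  · rw [weightDensity, Set.indicator_of_mem h]
    refine ENNReal.ofReal_le_ofReal ?_
    have h1 := pow_le_pow_left₀ hδ.le hs.le 2
    have h2 := hC (2 * s ^ 2) ⟨by linarith, (two_mul_sq_mem h).2.le⟩
    have h3 := le_abs_self (radialWeight f (2 * s ^ 2))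
    rw [Real.norm_eq_abs] at h2
    linarith
  · rw [weightDensity, Set.indicator_of_notMem h]
    exact zero_le

theorem radialMeasure_weightDensity_lt_top (hf : ContDiffOn ℝ ∞ f (Set.Ioc 0 1)) {δ : ℝ}
    (hδ : 0 < δ) : radialMeasure (weightDensity f) {w | δ < sqNorm w} < ⊤ := by
  obtain ⟨C, hC⟩ := weightDensity_le hf hδ
  rw [radialMeasure, withDensity_apply _
    (measurableSet_lt measurable_const continuous_sqNorm.measurable)]
  have hball : MeasurableSet (Metric.ball (0 : ℂ × ℂ) 1) := Metric.isOpen_ball.measurableSet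
  calc ∫⁻ w in {w | δ < sqNorm w}, weightDensity f (sqNorm w)
      ≤ ∫⁻ w, (Metric.ball (0 : ℂ × ℂ) 1).indicator (fun _ => ENNReal.ofReal C) w := by
        rw [← lintegral_indicator (measurableSet_lt measurable_const continuous_sqNorm.measurable)]
        refine lintegral_mono fun w => ?_
        refine Set.indicator_apply_le fun hw => ?_
        by_cases h : 2 * sqNorm w ^ 2 < 1
        · have h1 : sqNorm w < 1 := by
            by_contra hc
            have := one_le_pow₀ (not_lt.1 hc) (n := 2)
            linarith
          have hwb : w ∈ Metric.ball (0 : ℂ × ℂ) 1 := by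
            simp only [sqNorm] at h1
            rw [mem_ball_zero_iff, Prod.norm_def, max_lt_iff]
            constructor <;> rw [← sq_lt_one_iff₀ (norm_nonneg _)] <;>
              nlinarith [sq_nonneg ‖w.1‖, sq_nonneg ‖w.2‖]
          rw [Set.indicator_of_mem hwb]
          exact hC _ hw
        · rw [weightDensity_eq_zero _ h]
          exact zero_le
    _ = ENNReal.ofReal C * volume (Metric.ball (0 : ℂ × ℂ) 1) := by
        rw [lintegral_indicator hball, setLIntegral_const]
    _ < ⊤ := ENNReal.mul_lt_top ENNReal.ofReal_lt_top measure_ball_lt_top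

theorem monomialNorm_weightDensity_ne_zero (hf : ContDiffOn ℝ ∞ f (Set.Ioc 0 1)) (hf1 : f 1 = 0)
    (hf1' : derivWithin f (Set.Ioc 0 1) 1 = -1) (l : ℕ) :
    monomialNorm (weightDensity f) l ≠ 0 := by
  have hlim : Tendsto (radialWeight f) (𝓝[Set.Ioc 0 1] 1) (𝓝 1) := by
    have := (contDiffOn_radialWeight hf).continuousOn 1 one_mem_Ioc
    rwa [ContinuousWithinAt, radialWeight_one hf1 hf1'] at this
  have hev := hlim.eventually (eventually_gt_nhds (show (1 / 2 : ℝ) < 1 by norm_num))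
  obtain ⟨ε, hε, hεs⟩ := Metric.mem_nhdsWithin_iff.1 hev
  set a : ℝ := max (1 / 2) (1 - ε)
  have ha : a < 1 := max_lt (by norm_num) (by linarith)
  have ha2 : 1 / 2 ≤ a := le_max_left _ _
  have haε : 1 - ε ≤ a := le_max_right _ _
  have hle : ENNReal.ofReal ((1 / 2) ^ l * (1 / 2)) * volume (Set.Ioo a 1)
      ≤ ∫⁻ x in Set.Ioo (0 : ℝ) 1, ENNReal.ofReal (x ^ l * radialWeight f x) := by
    rw [← setLIntegral_const]
    refine (setLIntegral_mono' measurableSet_Ioo fun x hx => ?_).trans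
      (lintegral_mono_set (Set.Ioo_subset_Ioo_left (by linarith)))
    have h1 : 1 / 2 < radialWeight f x := hεs ⟨by
      rw [Metric.mem_ball, Real.dist_eq, abs_lt]
      constructor <;> linarith [hx.1, hx.2], by linarith [hx.1], hx.2.le⟩
    have h2 : (1 / 2 : ℝ) ^ l ≤ x ^ l := pow_le_pow_left₀ (by norm_num) (ha2.trans hx.1.le) l
    exact ENNReal.ofReal_le_ofReal (mul_le_mul h2 h1.le (by norm_num)
      (pow_nonneg (by linarith [hx.1]) l))
  have hpos : 0 < ENNReal.ofReal ((1 / 2) ^ l * (1 / 2)) * volume (Set.Ioo a 1) := by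
    rw [Real.volume_Ioo]
    exact ENNReal.mul_pos (ENNReal.ofReal_pos.2 (by positivity)).ne'
      (ENNReal.ofReal_pos.2 (by linarith)).ne'
  rw [monomialNorm_weightDensity hf]
  exact mul_ne_zero (ENNReal.ofReal_pos.2 (by positivity)).ne' (hpos.trans_le hle).ne'

/-- If some moment integral converges, l m_l → 1 makes k_l of order l². Otherwise all coefficients
are 0. -/
theorem isBigO_kernelCoeff (hf : ContDiffOn ℝ ∞ f (Set.Ioc 0 1)) (hf1 : f 1 = 0)
    (hf1' : derivWithin f (Set.Ioc 0 1) 1 = -1) :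
    kernelCoeff f =O[atTop] fun l : ℕ => (l : ℝ) ^ 2 := by
  by_cases h : ∃ l₀ : ℕ, IntegrableOn (fun x => x ^ l₀ * radialWeight f x) (Set.Ioo 0 1)
  · obtain ⟨l₀, hint⟩ := h
    have hev := (tendsto_nat_mul_moment hf hf1 hf1' hint).eventually
      (eventually_gt_nhds (show (1 / 2 : ℝ) < 1 by norm_num))
    refine Asymptotics.IsBigO.of_bound 6 ?_
    filter_upwards [hev, eventually_ge_atTop 1] with l hl hl1
    have hl1' : (1 : ℝ) ≤ l := by exact_mod_cast hl1
    have hm : 0 < moment f l := by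
      by_contra hc
      nlinarith
    rw [kernelCoeff, Real.norm_of_nonneg (by positivity), Real.norm_of_nonneg (by positivity),
      div_le_iff₀ hm]
    nlinarith
  · have h0 : kernelCoeff f = fun _ => 0 := by
      funext l
      rw [kernelCoeff, moment, integral_undef (fun hi => h ⟨l, hi⟩), div_zero]
    rw [h0]
    exact Asymptotics.isBigO_zero _ _

theorem reproducingCoeff_weightDensity (hf : ContDiffOn ℝ ∞ f (Set.Ioc 0 1))
    (hpos : ∀ t ∈ Set.Ioo (0 : ℝ) 1, 0 < f t) (hvol : HasNonnegVolume fun z => f (‖z‖ ^ 2))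
    (q : ℝ) (l : ℕ) : reproducingCoeff (weightDensity f) q l
      = (4 * Real.pi ^ 2)⁻¹ * (kernelCoeff f l * (2 * q) ^ l) := by
  have hpi := Real.pi_pos
  rw [reproducingCoeff, toReal_monomialNorm_weightDensity hf hpos hvol, kernelCoeff, mul_pow]
  by_cases hm : moment f l = 0
  · simp [hm]
  · field_simp
    ring

/-- The weighted Bergman kernel of a radial potential on the diagonal. -/
theorem bergmanKernel_nullPoint (hf : ContDiffOn ℝ ∞ f (Set.Ioc 0 1)) (hf1 : f 1 = 0)
    (hf1' : derivWithin f (Set.Ioc 0 1) 1 = -1)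
    (hpos : ∀ t ∈ Set.Ioo (0 : ℝ) 1, 0 < f t) (hvol : HasNonnegVolume fun z => f (‖z‖ ^ 2))
    {q : ℝ} (hq : 0 < q) (hq1 : q < √(1 / 2)) :
    bergmanKernel ball (weightMeasure fun x => f (‖x‖ ^ 2)) (nullPoint q) (nullPoint q)
      = (((4 * Real.pi ^ 2)⁻¹ * ∑' l, kernelCoeff f l * (2 * q ^ 2) ^ l : ℝ) : ℂ) := by
  have hhalf : √(1 / 2) ^ 2 = (1 / 2 : ℝ) := Real.sq_sqrt (by norm_num)
  have hs : Summable fun l => |reproducingCoeff (weightDensity f) q l| * √(1 / 2) ^ l := by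
    have h2 : |2 * q * √(1 / 2)| < 1 := by
      rw [abs_of_pos (by positivity)]
      nlinarith
    have := (summable_mul_pow_of_isBigO (isBigO_kernelCoeff hf hf1 hf1') h2).abs.mul_left
      (4 * Real.pi ^ 2)⁻¹
    refine this.congr fun l => ?_
    rw [reproducingCoeff_weightDensity hf hpos hvol, mul_pow, abs_mul, abs_mul, abs_mul, abs_mul,
      abs_of_pos (show 0 < √(1 / 2 : ℝ) ^ l by positivity),
      abs_of_pos (show 0 < (4 * Real.pi ^ 2)⁻¹ by positivity)]
    ring
  have hrep := isReproducingAt_radial (measurable_weightDensity hf) weightDensity_eq_zero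
    (fun δ hδ => radialMeasure_weightDensity_lt_top hf hδ)
    (monomialNorm_weightDensity_ne_zero hf hf1 hf1') hq hq1 hs
  rw [weightMeasure_eq_map hf hpos, bergmanKernel_diag hrep, reproducingFun]
  have hz : (nullPoint q 0 - Complex.I * nullPoint q 1) / 2 = q := by
    simp [nullPoint]
    linear_combination (-(q : ℂ) / 2) * Complex.I_sq
  rw [hz, ← tsum_mul_left, Complex.ofReal_tsum]
  refine tsum_congr fun l => ?_
  rw [reproducingCoeff_weightDensity hf hpos hvol, ← Complex.ofReal_pow, ← Complex.ofReal_mul]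
  congr 1
  rw [mul_pow, mul_pow, ← pow_mul, mul_comm 2 l, pow_mul]
  ring

/-! ### From boundary smoothness to an expansion in one variable -/

theorem nullPoint_mem_ballWithBoundary : nullPoint √(1 / 2 : ℝ) ∈ ballWithBoundary := by
  have h1 : ‖nullPoint √(1 / 2 : ℝ)‖ ^ 2 = 1 := by
    rw [norm_nullPoint_sq, Complex.norm_real, Real.norm_of_nonneg (Real.sqrt_nonneg _),
      Real.sq_sqrt (by norm_num)]
    norm_num
  refine ⟨⟨?_, fun h => ?_⟩, ?_⟩
  · simp only [nullPoint, Fin.sum_univ_three]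
    simp
    linear_combination ((√2 : ℂ)⁻¹) ^ 2 * Complex.I_sq
  · rw [h] at h1
    simp at h1
  · rw [← sq_le_one_iff₀ (norm_nonneg _)]
    exact h1.le

/-- Smoothness at the single boundary point (√½, i√½, 0) suffices. The curve t ↦ (q, iq, 0) with q =
√(t/2) is smooth in t, has |z|² = t and ends there, so the local extension restricts to a function
smooth up to t = 1. The factor 4π² clears the constant of the kernel. -/
theorem exists_expansion_of_isSmoothUpToBoundary (hf : ContDiffOn ℝ ∞ f (Set.Ioc 0 1))
    (hf1 : f 1 = 0) (hf1' : derivWithin f (Set.Ioc 0 1) 1 = -1)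
    (hpos : ∀ t ∈ Set.Ioo (0 : ℝ) 1, 0 < f t) (hvol : HasNonnegVolume fun z => f (‖z‖ ^ 2))
    {c : ℝ} (hc : IsSmoothUpToBoundary fun z => ((c / f (‖z‖ ^ 2) ^ 3 : ℝ) : ℂ) -
      bergmanKernel ball (weightMeasure fun x => f (‖x‖ ^ 2)) z z) :
    ∃ ψ : ℝ → ℝ, HasExpansion ψ ∧ ∀ᶠ t in 𝓝[<] 1,
      4 * Real.pi ^ 2 * c / f t ^ 3 - ∑' l, kernelCoeff f l * t ^ l = ψ t := by
  obtain ⟨V, hVo, hpV, G, hG, hGV⟩ := hc _ nullPoint_mem_ballWithBoundary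
  have hγ : ContDiffOn ℝ ∞ (fun t : ℝ => nullPoint (√(t / 2) : ℝ)) (Set.Ioi 0) := by
    have h1 : ContDiff ℝ ∞ fun q : ℂ => nullPoint q :=
      (differentiable_nullPoint.contDiff (n := ∞)).restrict_scalars ℝ
    refine h1.comp_contDiffOn (Complex.ofRealCLM.contDiff.comp_contDiffOn ?_)
    refine ContDiffOn.sqrt (by fun_prop) fun t ht => ?_
    have : (0 : ℝ) < t := ht
    positivity
  have hγ1 : ∀ᶠ t in 𝓝 (1 : ℝ), nullPoint (√(t / 2) : ℝ) ∈ V :=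
    (hγ.continuousOn.continuousAt (Ioi_mem_nhds one_pos)).eventually
      (hVo.mem_nhds hpV)
  obtain ⟨ε, hε, hεV⟩ := Metric.eventually_nhds_iff.1 hγ1
  set a : ℝ := max 0 (1 - ε)
  have ha : a < 1 := max_lt one_pos (by linarith)
  have ha0 : 0 ≤ a := le_max_left _ _
  have haV : ∀ t ∈ Set.Ioc a 1, nullPoint (√(t / 2) : ℝ) ∈ V := fun t ht => hεV (by
    have : 1 - ε < t := (le_max_right _ _).trans_lt ht.1
    rw [Real.dist_eq, abs_lt]
    constructor <;> linarith [ht.2])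
  refine ⟨fun t => 4 * Real.pi ^ 2 * (G (nullPoint (√(t / 2) : ℝ))).re,
    hasExpansion_of_contDiffOn ha (contDiffOn_const.mul
      (Complex.reCLM.contDiff.comp_contDiffOn (hG.comp (hγ.mono fun t ht => ?_) haV))), ?_⟩
  · exact lt_of_le_of_lt ha0 ht.1
  filter_upwards [Ioo_mem_nhdsLT ha] with t ht
  have ht0 : 0 < t / 2 := by linarith [ht.1]
  have hq : 0 < √(t / 2) := Real.sqrt_pos.2 ht0
  have hq1 : √(t / 2) < √(1 / 2) := Real.sqrt_lt_sqrt ht0.le (by linarith [ht.2])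
  have hmem : nullPoint (√(t / 2) : ℝ) ∈ ball := nullPoint_mem_ball
    (by exact_mod_cast hq.ne') (by rwa [Complex.norm_real, Real.norm_of_nonneg hq.le])
  have htq : 2 * √(t / 2) ^ 2 = t := by rw [Real.sq_sqrt ht0.le]; ring
  rw [hGV _ ⟨haV t ⟨ht.1, ht.2.le⟩, hmem⟩]
  beta_reduce
  rw [bergmanKernel_nullPoint hf hf1 hf1' hpos hvol hq hq1, htq, norm_nullPoint_sq,
    Complex.norm_real, Real.norm_of_nonneg hq.le, htq, ← Complex.ofReal_sub, Complex.ofReal_re]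
  have hpi := Real.pi_pos
  field_simp
end Kepler

end

theorem theorem1 (f : ℝ → ℝ)
    (hf : ContDiffOn ℝ ∞ f (Set.Ioc 0 1))
    (hf1 : f 1 = 0)
    (hf1' : derivWithin f (Set.Ioc 0 1) 1 = -1)
    (hpos : ∀ t ∈ Set.Ioo (0 : ℝ) 1, 0 < f t)
    (hvol : Kepler.HasNonnegVolume fun z => f (‖z‖ ^ 2))
    (hbal : ∃ c : ℝ, c ≠ 0 ∧ Kepler.IsSmoothUpToBoundary fun z =>
      ((c / f (‖z‖ ^ 2) ^ 3 : ℝ) : ℂ) -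
        Kepler.bergmanKernel Kepler.ball (Kepler.weightMeasure fun x => f (‖x‖ ^ 2)) z z) :
    ∃ v : ℝ, ∃ h : ℝ → ℝ,
      ContDiffOn ℝ ∞ h (Set.Ioc 0 1) ∧
      (∀ k : ℕ, iteratedDerivWithin k h (Set.Ioc 0 1) 1 = 0) ∧
      ∀ t ∈ Set.Ioc (0 : ℝ) 1, Kepler.radialWeight f t = Kepler.phi v t + h t := by
  obtain ⟨c, hc, hsmooth⟩ := hbal
  obtain ⟨ψ, hψ, heq⟩ :=
    Kepler.exists_expansion_of_isSmoothUpToBoundary hf hf1 hf1' hpos hvol hsmooth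
  exact Kepler.exists_phi_add_flat hf hf1 hf1'
    (mul_ne_zero (by have := Real.pi_pos; positivity) hc) hψ heq
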